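/- **Setting.** Let $(a_i)_{i\ge 1}$ be positive numbers with $\sum_i a_i<\infty$, and let $P$ be the Borel probability measure on $\ell^2$ obtained by restricting to $\ell^2$ the product measure $\prod_i N(0,a_i^2)$ on $\mathbb R^{\infty}$. Let $\mathbf e_i$ be the unit vectors of $\ell^2$ and $D_if(\mathbf x)=\lim_{t\to0}\frac{f(\mathbf x+t\mathbf e_i)-f(\mathbf x)}{t}$. Let $U\subset\ell^2$ be open. A function $f:U\to\mathbb R$ is *$F$-continuous* if for all $\mathbf x\in U$ and $n\in\mathbb N$ the map $(s_1,\dots,s_n)\mapsto f(\mathbf x+s_1\mathbf e_1+\dots+s_n\mathbf e_n)$ is continuous on the set where it is defined. Call $f$ *$F$-smooth on $U$* if $f$ is $F$-continuous and Borel and all its partial derivatives of all orders $\ge1$ exist on $U$ and are bounded, $F$-continuous and Borel. A set $E$ is *uniformly included* in $U$, written $E\stackrel{\circ}{\subset}U$, if $E$ is bounded and for some $r>0$ all balls $B(\mathbf x;r)$, $\mathbf x\in E$, lie in $U$. Let $C^\infty_{S,b}(U)$ be the set of $F$-smooth $f$ on $U$ such that $f$ and each of its partial derivatives are bounded on $U$,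 and let $C_F^\infty(U)$ be the set of $F$-smooth $f$ on $U$ with $\sup_U\big(|f|+\sum_i|D_if|^2\big)<\infty$ and $\operatorname{supp}f\stackrel{\circ}{\subset}U$. For $f\in L^2(U,P)$, a function $v\in L^2(U,P)$ is the weak derivative $D_if$ if $\int_U v\varphi\,dP=\int_U f\,\big(-D_i\varphi+\tfrac{x_i}{a_i^2}\varphi\big)\,dP$ for all $\varphi\in C_F^\infty(U)$. The space $W^{1,2}(U)$ consists of all $f\in L^2(U,P)$ that have weak derivatives $D_if\in L^2(U,P)$ for all $i$ and satisfy $$\|f\|_{W^{1,2}(U)}^2=\int_U|f|^2\,dP+\sum_{i=1}^\infty a_i^2\int_U|D_if|^2\,dP<\infty .$$ **Assumptions on $O$.** Let $g:\ell^2\to\mathbb R$ be continuously Fréchet differentiable, and let $O=\{g>0\}$, with $\partial O=\{g=0\}$ and $Dg(\mathbf x)\ne0$ for all $\mathbf x\in\partial O$. Assume that for every $\mathbf x_0\in\partial O$ there are $k\in\mathbb N$ and $r>0$ for which the following holds, with $U_0=B(\mathbf x_0;r)$, $\mathbb H_k=\{\mathbf x\in\ell^2:x_k>0\}$, and $\psi(\mathbf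 x)$ the point obtained from $\mathbf x$ by replacing its $k$-th coordinate by $g(\mathbf x)$. There is a function $h$ on $\psi(U_0)$ with $h(\psi(\mathbf x))=x_k$ for all $\mathbf x\in U_0$ (so that $\psi^{-1}=\tau$ on $\psi(U_0)$, where $\tau(\mathbf y)$ is obtained from $\mathbf y$ by replacing its $k$-th coordinate by $h(\mathbf y)$), such that: 1. $h$ is continuously Fréchet differentiable and $F$-smooth on $\psi(U_0)$, and $g$ is $F$-smooth on $U_0$; 2. for some $\delta\in(0,\infty)$ and all $\mathbf x\in U_0$, $\mathbf y\in\psi(U_0)$ one has $|x_k|<\delta$, $|y_k|<\delta$, $|g(\mathbf x)|<\delta$, $|h(\mathbf y)|<\delta$, $\frac1\delta<|D_kg(\mathbf x)|<\delta$, $\frac1\delta<|D_kh(\mathbf y)|<\delta$ and $\sum_{i=1}^\infty a_i^2|D_ih(\mathbf y)|^2<\delta$; 3. $E\stackrel{\circ}{\subset}U_0\cap O$ implies $\psi(E)\stackrel{\circ}{\subset}\psi(U_0)\cap\mathbb H_k$, and $E'\stackrel{\circ}{\subset}\psi(U_0)\cap\mathbb H_k$ implies $\tau(E')\stackrel{\circ}{\subset}U_0\cap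 O$. **Theorem.** For every $f\in W^{1,2}(O)$ there is a sequence $(\varphi_n)_{n\ge1}\subset C^\infty_{S,b}(\ell^2)\cap C^\infty_F(\ell^2)$ whose restrictions to $O$ belong to $W^{1,2}(O)$ and satisfy $$\lim_{n\to\infty}\|\varphi_n-f\|_{W^{1,2}(O)}=0 .$$ -/

import Mathlib

open MeasureTheory Filter Topology

noncomputable section

namespace GaussSobolev

/-- The real Hilbert space `ℓ²`, with coordinates indexed by `ℕ` (starting from `0`). -/
abbrev L2 : Type := lp (fun _ : ℕ => ℝ) 2

/-- `ℓ²` carries its Borel σ-algebra. -/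
instance instMeasurableSpaceL2 : MeasurableSpace L2 := borel L2

instance instBorelSpaceL2 : BorelSpace L2 := ⟨rfl⟩

/-- The `i`-th unit vector of `ℓ²`. -/
def e (i : ℕ) : L2 := lp.single 2 i (1 : ℝ)

/-- The restriction to `ℓ²` of the product measure on `ℝ^ℕ` of the centred normal laws with standard
deviations `a i` (variances `(a i)²`). It assigns to a Borel set `B ⊆ ℓ²` the product measure
of `B`. -/
def P (a : ℕ → ℝ) : Measure L2 :=
  Measure.comap (fun x : L2 => (x : ℕ → ℝ))
    (Measure.infinitePi fun i => ProbabilityTheory.gaussianReal 0 (Real.toNNReal (a i ^ 2)))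

/-- The inclusion of `ℓ²` into `ℝ^ℕ` is a measurable embedding, so that the measure `P` is indeed
given by `P B = (product measure)(B)`. -/
theorem measurableEmbedding_coe : MeasurableEmbedding (fun x : L2 => (x : ℕ → ℝ)) := by
  have hsep : TopologicalSpace.SeparableSpace L2 := by
    have h1 : TopologicalSpace.IsSeparable
        ((Submodule.span ℝ (Set.range e) : Submodule ℝ L2) : Set L2) :=
      (Set.countable_range e).isSeparable.span
    have h2 : closure ((Submodule.span ℝ (Set.range e) : Submodule ℝ L2) : Set L2) = Set.univ := by
      refine Set.eq_univ_of_forall fun x => ?_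
      have hx := lp.hasSum_single (p := 2) (by simp) x
      refine mem_closure_of_tendsto hx (Eventually.of_forall fun s => ?_)
      refine Submodule.sum_mem _ fun i _ => ?_
      have : lp.single 2 i (x i) = x i • e i := by
        rw [e, ← lp.single_smul]; simp
      rw [this]
      exact Submodule.smul_mem _ _ (Submodule.subset_span ⟨i, rfl⟩)
    have h3 := h1.closure
    rw [h2] at h3
    exact TopologicalSpace.isSeparable_univ_iff.1 h3
  have : SecondCountableTopology L2 := UniformSpace.secondCountable_of_separable L2
  exact (lp.uniformContinuous_coe (p := 2)).continuous.measurableEmbedding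
    (fun x y h => lp.ext h)

theorem P_apply (a : ℕ → ℝ) (B : Set L2) :
    P a B = Measure.infinitePi
      (fun i => ProbabilityTheory.gaussianReal 0 (Real.toNNReal (a i ^ 2)))
      ((fun x : L2 => (x : ℕ → ℝ)) '' B) :=
  measurableEmbedding_coe.comap_apply _ _

/-- The partial derivative `D_i f` with respect to the `i`-th coordinate. -/
def pd (i : ℕ) (f : L2 → ℝ) (x : L2) : ℝ := deriv (fun t : ℝ => f (x + t • e i)) 0

/-- `f` has a partial derivative with respect to the `i`-th coordinate at `x`. -/
def HasPd (i : ℕ) (f : L2 → ℝ) (x : L2) : Prop :=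
  DifferentiableAt ℝ (fun t : ℝ => f (x + t • e i)) 0

/-- Iterated partial derivatives: `iterPd [i₁, …, iₘ] f = D_{i₁} ⋯ D_{iₘ} f`. -/
def iterPd : List ℕ → (L2 → ℝ) → (L2 → ℝ)
  | [], f => f
  | i :: l, f => pd i (iterPd l f)

/-- `f` is `F`-continuous on `O`: its restriction to the intersection of `O` with each affine
subspace `x + span (e 0, …, e (n - 1))`, `x ∈ O`, is continuous. -/
def FContinuousOn (O : Set L2) (f : L2 → ℝ) : Prop :=
  ∀ x ∈ O, ∀ n : ℕ, ContinuousOn (fun s : Fin n → ℝ => f (x + ∑ i : Fin n, s i • e i))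
    {s : Fin n → ℝ | x + ∑ i : Fin n, s i • e i ∈ O}

/-- The class of `F`-continuous Borel functions on the open set `O` all of whose partial
derivatives, of all orders `≥ 1`, exist on `O` and are bounded, `F`-continuous and Borel on `O`.
(Here and below, only the values on `O` of a function `L2 → ℝ` matter.) -/
structure IsFSmooth (O : Set L2) (f : L2 → ℝ) : Prop where
  fcont : FContinuousOn O f
  meas : Measurable fun x : O => f x
  hasPd : ∀ (l : List ℕ) (i : ℕ), ∀ x ∈ O, HasPd i (iterPd l f) x
  fcont_pd : ∀ (l : List ℕ) (i : ℕ), FContinuousOn O (iterPd (i :: l) f)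
  meas_pd : ∀ (l : List ℕ) (i : ℕ), Measurable fun x : O => iterPd (i :: l) f x
  bdd_pd : ∀ (l : List ℕ) (i : ℕ), ∃ C : ℝ, ∀ x ∈ O, |iterPd (i :: l) f x| ≤ C

/-- The class `C^∞_{S,b}(O)`: moreover `f` and all its partial derivatives are bounded on `O`. -/
structure IsCSb (O : Set L2) (f : L2 → ℝ) : Prop where
  smooth : IsFSmooth O f
  bdd : ∀ l : List ℕ, ∃ C : ℝ, ∀ x ∈ O, |f x| + |iterPd l f x| ≤ C

/-- `E` is uniformly included in `O`: `E` is bounded and the balls of some fixed positive radius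
around the points of `E` lie in `O`. -/
def UnifIncl (E O : Set L2) : Prop :=
  ∃ r > 0, ∃ R > 0, (⋃ x ∈ E, Metric.ball x r) ⊆ O ∧ E ⊆ Metric.ball 0 R

/-- The class `C^∞_F(O)` of test functions: moreover `|f| + ∑ᵢ |D_i f|²` is bounded on `O` and the
support of `f` is uniformly included in `O`. -/
structure IsCF (O : Set L2) (f : L2 → ℝ) : Prop where
  smooth : IsFSmooth O f
  bdd : ∃ C : ℝ, ∀ x ∈ O, Summable (fun i => |pd i f x| ^ 2) ∧
    |f x| + ∑' i, |pd i f x| ^ 2 ≤ C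
  supp : UnifIncl (closure {x | x ∈ O ∧ f x ≠ 0}) O

/-- `D_i^* φ = - D_i φ + (x_i / a_i²) φ`. -/
def pdStar (a : ℕ → ℝ) (i : ℕ) (φ : L2 → ℝ) (x : L2) : ℝ :=
  -pd i φ x + x i / a i ^ 2 * φ x

/-- `g ∈ L²(O, P)` is the weak partial derivative `D_i f` of `f` on `O`. -/
def IsWeakPd (a : ℕ → ℝ) (O : Set L2) (i : ℕ) (f g : L2 → ℝ) : Prop :=
  MemLp g 2 ((P a).restrict O) ∧
    ∀ φ : L2 → ℝ, IsCF O φ →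
      ∫ x in O, g x * φ x ∂(P a) = ∫ x in O, f x * pdStar a i φ x ∂(P a)

open Classical in
/-- The weak partial derivative `D_i f` on `O`, determined up to equality `P`-almost everywhere
on `O` (and `0` if there is none in `L²(O, P)`). -/
def weakPd (a : ℕ → ℝ) (O : Set L2) (i : ℕ) (f : L2 → ℝ) : L2 → ℝ :=
  if h : ∃ g, IsWeakPd a O i f g then h.choose else 0

/-- `f ∈ W^{1,2}(O)`. -/
structure MemW12 (a : ℕ → ℝ) (O : Set L2) (f : L2 → ℝ) : Prop where
  memLp : MemLp f 2 ((P a).restrict O)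
  exists_weakPd : ∀ i, ∃ g, IsWeakPd a O i f g
  summable : Summable fun i => a i ^ 2 * ∫ x in O, |weakPd a O i f x| ^ 2 ∂(P a)

/-- The norm of `W^{1,2}(O)`. -/
def normW12 (a : ℕ → ℝ) (O : Set L2) (f : L2 → ℝ) : ℝ :=
  Real.sqrt (∫ x in O, |f x| ^ 2 ∂(P a) +
    ∑' i, a i ^ 2 * ∫ x in O, |weakPd a O i f x| ^ 2 ∂(P a))

/-- The open half space `{x | x_k > 0}`. -/
def halfSpace (k : ℕ) : Set L2 := {x | 0 < x k}

/-- Replace the `k`-th coordinate of `x` by `g x`. -/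
def replaceCoord (k : ℕ) (g : L2 → ℝ) (x : L2) : L2 := x + (g x - x k) • e k

/-- The local straightening condition for `O = {g > 0}` on the open set `U`, in the direction of the
`k`-th coordinate. Here `ψ = replaceCoord k g` maps `U` to `ψ(U)`, the function `h` on `ψ(U)` is the
`k`-th coordinate of the inverse of `ψ`, and `τ = replaceCoord k h = ψ⁻¹`. -/
def Straightens (a : ℕ → ℝ) (O : Set L2) (g : L2 → ℝ) (U : Set L2) (k : ℕ) : Prop :=
  ∃ h : L2 → ℝ,
    (∀ x ∈ U, h (replaceCoord k g x) = x k) ∧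
    ContDiffOn ℝ 1 h (replaceCoord k g '' U) ∧
    IsFSmooth (replaceCoord k g '' U) h ∧
    IsFSmooth U g ∧
    (∃ δ > 0,
      (∀ y ∈ replaceCoord k g '' U,
        |y k| < δ ∧ |h y| < δ ∧ 1 / δ < |pd k h y| ∧ |pd k h y| < δ ∧
        Summable (fun i => a i ^ 2 * |pd i h y| ^ 2) ∧
        ∑' i, a i ^ 2 * |pd i h y| ^ 2 < δ) ∧
      (∀ x ∈ U, |x k| < δ ∧ |g x| < δ ∧ 1 / δ < |pd k g x| ∧ |pd k g x| < δ)) ∧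
    (∀ E : Set L2, UnifIncl E (U ∩ O) →
      UnifIncl (replaceCoord k g '' E) (replaceCoord k g '' U ∩ halfSpace k)) ∧
    (∀ E : Set L2, UnifIncl E (replaceCoord k g '' U ∩ halfSpace k) →
      UnifIncl (replaceCoord k h '' E) (U ∩ O))

/-- `O` is an open subset of `ℓ²` with `C¹` boundary, given globally by the defining function `g`. -/
structure IsC1Domain (O : Set L2) (g : L2 → ℝ) : Prop where
  isOpen : IsOpen O
  contDiff : ContDiff ℝ 1 g
  frontier_eq : frontier O = {x | g x = 0}
  eq_pos : O = {x | 0 < g x}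
  fderiv_ne : ∀ x ∈ frontier O, fderiv ℝ g x ≠ 0

end GaussSobolev

end

/-!
Smooth functions are dense in the Gaussian Sobolev space `W^{1,2}(O)` because every function of
this space can be approximated by functions that vanish off a compact set, and these can be pushed
away from the boundary of `O`.

A function together with all its weak partial derivatives is regarded as a single function `w` on
`ℕ × ℓ²`, and this product carries the measure `M a` for which the norm of `W^{1,2}` is the
`L²`-norm (`summable_and_normW12_eq`). Weak differentiability is the predicate `MemW`; the
functions in question are extended by zero off `O`.

*Truncation.* Since `∑ i, a i < ∞`, the series `q x = ∑ i, x i ^ 2 / a i` converges almost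
everywhere (`ae_summable_sq_div`), and the sets `{q ≤ c}` lie in compact cubes (`isCompact_cube`).
The factors `χ (q / ν)` are limits of smooth cylinder functions, and their `i`-th derivative is at
most `C / √(a i)`, which the weights `a i ^ 2` compensate. So multiplication by them preserves
`W^{1,2}(O)` (`MemW.trunc`), and as `ν → ∞` the products converge to the given function
(`tendsto_trunc`).

*Localization.* A function vanishing off a compact set is cut into finitely many pieces, each
vanishing off a small ball (`MemW.approx_of_subset_iUnion`). Near a boundary point some partial
derivative `D_k g` equals approximately a number `c ≠ 0`, and `g` increases in the direction
`c e_k`. Hence a piece `u` supported near this point may be replaced by its translate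
`u (· + t c e_k)`, which is weakly differentiable on a set that contains the points of the closure of `O`
where the translate is supported, and these form a compact set. Multiplied by a cut-off function
it extends by zero to a function of class `W^{1,2}(ℓ²)` (`MemW.approx_frontier`). The translates
converge to `u` as `t → 0` (`tendsto_shiftJet`). The translation of a weakly differentiable
function is weakly differentiable by the Cameron–Martin formula (`P_map_add`, `MemW.shiftJet`).

*The whole space.* If `r ∈ W^{1,2}(ℓ²)` is orthogonal to the smooth functions, testing with
`cos (s ⟨l, x⟩ + c)`, where `l` has finitely many nonzero coordinates, gives an ordinary differential
equation in `s` for `∫ r cos (s ⟨l, x⟩ + c) dP` whose only solution on the line is zero; so the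
Fourier transform of `r` vanishes, and `r = 0` (`MemW.ae_eq_zero`). Orthogonal projection yields
the density of the smooth functions with bounded support in `W^{1,2}(ℓ²)` (`MemW.approx_univ`).
-/

open MeasureTheory Filter Topology

noncomputable section

namespace GaussSobolev

/-! ### Partial derivatives and bounded `F`-smooth functions -/

theorem continuous_line (x : L2) (i : ℕ) : Continuous fun t : ℝ => x + t • e i := by fun_prop

theorem eventually_line_mem {O : Set L2} (hO : IsOpen O) {x : L2} (hx : x ∈ O) (i : ℕ) :
    ∀ᶠ t : ℝ in 𝓝 0, x + t • e i ∈ O :=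
  (continuous_line x i).continuousAt.eventually (by simpa using hO.mem_nhds hx)

theorem pd_congr {O : Set L2} (hO : IsOpen O) {f g : L2 → ℝ} (h : ∀ x ∈ O, f x = g x) (i : ℕ)
    {x : L2} (hx : x ∈ O) : pd i f x = pd i g x :=
  Filter.EventuallyEq.deriv_eq ((eventually_line_mem hO hx i).mono fun _ ht => h _ ht)

theorem HasPd.congr {O : Set L2} (hO : IsOpen O) {f g : L2 → ℝ} (h : ∀ x ∈ O, f x = g x) {i : ℕ}
    {x : L2} (hx : x ∈ O) (hf : HasPd i f x) : HasPd i g x :=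
  DifferentiableAt.congr_of_eventuallyEq hf
    ((eventually_line_mem hO hx i).mono fun _ ht => (h _ ht).symm)

theorem pd_mul {i : ℕ} {f g : L2 → ℝ} {x : L2} (hf : HasPd i f x) (hg : HasPd i g x) :
    pd i (fun y => f y * g y) x = pd i f x * g x + f x * pd i g x := by
  have := deriv_fun_mul hf hg
  simpa [pd] using this

theorem pd_add {i : ℕ} {f g : L2 → ℝ} {x : L2} (hf : HasPd i f x) (hg : HasPd i g x) :
    pd i (fun y => f y + g y) x = pd i f x + pd i g x :=
  deriv_fun_add hf hg

theorem HasPd.mul {i : ℕ} {f g : L2 → ℝ} {x : L2} (hf : HasPd i f x) (hg : HasPd i g x) :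
    HasPd i (fun y => f y * g y) x :=
  DifferentiableAt.fun_mul hf hg

theorem HasPd.add {i : ℕ} {f g : L2 → ℝ} {x : L2} (hf : HasPd i f x) (hg : HasPd i g x) :
    HasPd i (fun y => f y + g y) x :=
  DifferentiableAt.fun_add hf hg

theorem HasPd.hasDerivAt {i : ℕ} {f : L2 → ℝ} {x : L2} {t : ℝ} (hf : HasPd i f (x + t • e i)) :
    HasDerivAt (fun s : ℝ => f (x + s • e i)) (pd i f (x + t • e i)) t := by
  have h : HasDerivAt (fun s : ℝ => f (x + t • e i + s • e i)) (pd i f (x + t • e i)) (t - t) := by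
    rw [sub_self]; exact DifferentiableAt.hasDerivAt hf
  have := h.comp_sub_const t t
  refine this.congr_of_eventuallyEq (Eventually.of_forall fun s => ?_)
  simp only [add_assoc, ← add_smul]
  congr 3; ring

/-- The requirements made on every function in the hierarchy of partial derivatives of a bounded
`F`-smooth function. -/
structure IsTame (O : Set L2) (f : L2 → ℝ) : Prop where
  fcont : FContinuousOn O f
  meas : Measurable fun x : O => f x
  bdd : ∃ C : ℝ, ∀ x ∈ O, |f x| ≤ C
  hasPd : ∀ i, ∀ x ∈ O, HasPd i f x

theorem IsTame.congr {O : Set L2} (hO : IsOpen O) {f g : L2 → ℝ} (h : ∀ x ∈ O, f x = g x)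
    (hf : IsTame O f) : IsTame O g where
  fcont x hx n := (hf.fcont x hx n).congr fun s hs => (h _ hs).symm
  meas := by
    have : (fun x : O => g x) = fun x : O => f x := funext fun x => (h _ x.2).symm
    rw [this]; exact hf.meas
  bdd := by
    obtain ⟨C, hC⟩ := hf.bdd
    exact ⟨C, fun x hx => h x hx ▸ hC x hx⟩
  hasPd i x hx := (hf.hasPd i x hx).congr hO h hx

theorem IsTame.mul {O : Set L2} {f g : L2 → ℝ} (hf : IsTame O f) (hg : IsTame O g) :
    IsTame O fun x => f x * g x where
  fcont x hx n := (hf.fcont x hx n).mul (hg.fcont x hx n)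
  meas := hf.meas.mul hg.meas
  bdd := by
    obtain ⟨C, hC⟩ := hf.bdd
    obtain ⟨D, hD⟩ := hg.bdd
    refine ⟨C * D, fun x hx => ?_⟩
    rw [abs_mul]
    exact mul_le_mul (hC x hx) (hD x hx) (abs_nonneg _) ((abs_nonneg _).trans (hC x hx))
  hasPd i x hx := (hf.hasPd i x hx).mul (hg.hasPd i x hx)

theorem IsTame.add {O : Set L2} {f g : L2 → ℝ} (hf : IsTame O f) (hg : IsTame O g) :
    IsTame O fun x => f x + g x where
  fcont x hx n := (hf.fcont x hx n).add (hg.fcont x hx n)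
  meas := hf.meas.add hg.meas
  bdd := by
    obtain ⟨C, hC⟩ := hf.bdd
    obtain ⟨D, hD⟩ := hg.bdd
    exact ⟨C + D, fun x hx => (abs_add_le _ _).trans (add_le_add (hC x hx) (hD x hx))⟩
  hasPd i x hx := (hf.hasPd i x hx).add (hg.hasPd i x hx)

theorem IsTame.mono {O O' : Set L2} (h : O' ⊆ O) {f : L2 → ℝ} (hf : IsTame O f) :
    IsTame O' f where
  fcont x hx n := (hf.fcont x (h hx) n).mono fun _ hs => h hs
  meas := hf.meas.comp (measurable_subtype_coe.subtype_mk (h := fun x : O' => h x.2))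
  bdd := by
    obtain ⟨C, hC⟩ := hf.bdd
    exact ⟨C, fun x hx => hC x (h hx)⟩
  hasPd i x hx := hf.hasPd i x (h hx)

theorem isCSb_iff {O : Set L2} {f : L2 → ℝ} : IsCSb O f ↔ ∀ l, IsTame O (iterPd l f) := by
  constructor
  · intro h l
    have hb : ∃ C : ℝ, ∀ x ∈ O, |iterPd l f x| ≤ C := by
      obtain ⟨C, hC⟩ := h.bdd l
      exact ⟨C, fun x hx => by have := hC x hx; have := abs_nonneg (f x); linarith⟩
    cases l with
    | nil => exact ⟨h.smooth.fcont, h.smooth.meas, hb, h.smooth.hasPd []⟩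
    | cons i l =>
      exact ⟨h.smooth.fcont_pd l i, h.smooth.meas_pd l i, hb, h.smooth.hasPd (i :: l)⟩
  · intro h
    refine ⟨⟨(h []).fcont, (h []).meas, fun l i x hx => (h l).hasPd i x hx,
      fun l i => (h (i :: l)).fcont, fun l i => (h (i :: l)).meas, fun l i => (h (i :: l)).bdd⟩,
      fun l => ?_⟩
    obtain ⟨C, hC⟩ := (h []).bdd
    obtain ⟨D, hD⟩ := (h l).bdd
    exact ⟨C + D, fun x hx => add_le_add (hC x hx) (hD x hx)⟩

/-- A coinduction principle: if every function of a class `S` is tame on `O` and the partial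
derivatives of the functions in `S` agree on `O` with functions in `S`, then the functions in `S`
are of class `C^∞_{S,b}(O)`. -/
theorem isCSb_of_closed {O : Set L2} (hO : IsOpen O) (S : Set (L2 → ℝ))
    (hS : ∀ f ∈ S, IsTame O f) (hd : ∀ f ∈ S, ∀ i, ∃ f' ∈ S, ∀ x ∈ O, pd i f x = f' x)
    {f : L2 → ℝ} (hf : f ∈ S) : IsCSb O f := by
  have key : ∀ l, ∃ f' ∈ S, ∀ x ∈ O, iterPd l f x = f' x := by
    intro l
    induction l with
    | nil => exact ⟨f, hf, fun x _ => rfl⟩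
    | cons i l ih =>
      obtain ⟨f', hf', h⟩ := ih
      obtain ⟨f'', hf'', h'⟩ := hd f' hf' i
      exact ⟨f'', hf'', fun x hx => (pd_congr hO h i hx).trans (h' x hx)⟩
  refine isCSb_iff.2 fun l => ?_
  obtain ⟨f', hf', h⟩ := key l
  exact (hS f' hf').congr hO fun x hx => (h x hx).symm

theorem iterPd_append (l l' : List ℕ) (f : L2 → ℝ) :
    iterPd l (iterPd l' f) = iterPd (l ++ l') f := by
  induction l with
  | nil => rfl
  | cons i l ih => simp only [List.cons_append, iterPd, ih]

theorem IsCSb.tame {O : Set L2} {f : L2 → ℝ} (hf : IsCSb O f) : IsTame O f := isCSb_iff.1 hf []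

theorem IsCSb.pd {O : Set L2} {f : L2 → ℝ} (hf : IsCSb O f) (i : ℕ) : IsCSb O (pd i f) := by
  refine isCSb_iff.2 fun l => ?_
  have := isCSb_iff.1 hf (l ++ [i])
  rwa [← iterPd_append] at this

theorem IsCSb.mono {O O' : Set L2} (h : O' ⊆ O) {f : L2 → ℝ} (hf : IsCSb O f) : IsCSb O' f :=
  isCSb_iff.2 fun l => (isCSb_iff.1 hf l).mono h

theorem isTame_zero (O : Set L2) : IsTame O fun _ => 0 where
  fcont _ _ _ := continuousOn_const
  meas := measurable_const
  bdd := ⟨0, by simp⟩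
  hasPd _ _ _ := differentiableAt_const _

theorem IsCSb.mul {O : Set L2} (hO : IsOpen O) {f g : L2 → ℝ} (hf : IsCSb O f)
    (hg : IsCSb O g) : IsCSb O fun x => f x * g x := by
  let S : AddSubmonoid (L2 → ℝ) :=
    AddSubmonoid.closure {u | ∃ v w, IsCSb O v ∧ IsCSb O w ∧ u = fun x => v x * w x}
  have hmem : ∀ v w, IsCSb O v → IsCSb O w → (fun x => v x * w x) ∈ S := fun v w hv hw =>
    AddSubmonoid.subset_closure ⟨v, w, hv, hw, rfl⟩
  have hS : ∀ u ∈ S, IsTame O u := by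
    intro u hu
    induction hu using AddSubmonoid.closure_induction with
    | mem u hu =>
      obtain ⟨v, w, hv, hw, rfl⟩ := hu
      exact hv.tame.mul hw.tame
    | zero => exact isTame_zero O
    | add u v _ _ hu hv => exact hu.add hv
  refine isCSb_of_closed hO (S : Set (L2 → ℝ)) hS ?_ (hmem f g hf hg)
  intro u hu i
  induction hu using AddSubmonoid.closure_induction with
  | mem u hu =>
    obtain ⟨v, w, hv, hw, rfl⟩ := hu
    exact ⟨_, S.add_mem (hmem _ _ (hv.pd i) hw) (hmem _ _ hv (hw.pd i)),
      fun x hx => pd_mul (hv.tame.hasPd i x hx) (hw.tame.hasPd i x hx)⟩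
  | zero =>
    exact ⟨0, S.zero_mem, fun x _ => by simp [GaussSobolev.pd]⟩
  | add u v hu' hv' hu hv =>
    obtain ⟨u', hu1, hu2⟩ := hu
    obtain ⟨v', hv1, hv2⟩ := hv
    refine ⟨_, S.add_mem hu1 hv1, fun x hx => ?_⟩
    rw [Pi.add_apply, ← hu2 x hx, ← hv2 x hx]
    exact pd_add ((hS u hu').hasPd i x hx) ((hS v hv').hasPd i x hx)

/-! ### Translation and extension by zero of test functions -/

theorem pd_comp_add (i : ℕ) (f : L2 → ℝ) (v x : L2) :
    pd i (fun y => f (y + v)) x = pd i f (x + v) := by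
  simp only [pd, add_right_comm]

theorem iterPd_comp_add (l : List ℕ) (f : L2 → ℝ) (v : L2) :
    iterPd l (fun y => f (y + v)) = fun y => iterPd l f (y + v) := by
  induction l with
  | nil => rfl
  | cons i l ih =>
    funext x
    simp only [iterPd, ih, pd_comp_add]

theorem IsTame.comp_add {O : Set L2} {f : L2 → ℝ} (hf : IsTame O f) (v : L2) :
    IsTame ((· + v) ⁻¹' O) fun x => f (x + v) where
  fcont x hx n := by
    have := hf.fcont (x + v) hx n
    simpa only [add_right_comm x v, Set.mem_preimage] using this
  meas := by
    have h : Measurable fun x : ((· + v) ⁻¹' O : Set L2) => (⟨x + v, x.2⟩ : O) :=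
      Measurable.subtype_mk ((measurable_subtype_coe).add_const v)
    exact hf.meas.comp h
  bdd := by
    obtain ⟨C, hC⟩ := hf.bdd
    exact ⟨C, fun x hx => hC _ hx⟩
  hasPd i x hx := by
    have := hf.hasPd i (x + v) hx
    unfold HasPd at this ⊢
    simpa only [add_right_comm x v] using this

theorem IsCSb.comp_add {O : Set L2} {f : L2 → ℝ} (hf : IsCSb O f) (v : L2) :
    IsCSb ((· + v) ⁻¹' O) fun x => f (x + v) := by
  refine isCSb_iff.2 fun l => ?_
  rw [iterPd_comp_add]
  exact (isCSb_iff.1 hf l).comp_add v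

/-- At the points of `O` where `f` does not vanish, `O` contains the ball of radius `r`. -/
def SuppIncl (r : ℝ) (O : Set L2) (f : L2 → ℝ) : Prop :=
  ∀ x ∈ O, f x ≠ 0 → Metric.ball x r ⊆ O

theorem SuppIncl.pd {r : ℝ} {O : Set L2} (hO : IsOpen O) {f : L2 → ℝ} (h : SuppIncl r O f)
    (i : ℕ) : SuppIncl r O (pd i f) := by
  intro x hx hne y hy
  by_contra hyO
  refine hne ?_
  have h1 : ∀ᶠ t : ℝ in 𝓝 0, x + t • e i ∈ Metric.ball y r :=
    (continuous_line x i).continuousAt.eventually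
      (by
        beta_reduce
        rw [zero_smul, add_zero]
        exact Metric.isOpen_ball.mem_nhds (Metric.mem_ball_comm.1 hy))
  have h2 : (fun t : ℝ => f (x + t • e i)) =ᶠ[𝓝 0] fun _ => 0 := by
    filter_upwards [h1, eventually_line_mem hO hx i] with t ht htO
    by_contra hf
    exact hyO (h _ htO hf (Metric.mem_ball_comm.1 ht))
  simp [GaussSobolev.pd, h2.deriv_eq]

theorem SuppIncl.indicator_eq_zero {r : ℝ} {O : Set L2} {f : L2 → ℝ} (h : SuppIncl r O f) {x : L2}
    (hx : x ∉ O) {y : L2} (hy : y ∈ Metric.ball x r) : O.indicator f y = 0 := by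
  by_contra hne
  have hyO : y ∈ O := Set.mem_of_indicator_ne_zero hne
  rw [Set.indicator_of_mem hyO] at hne
  exact hx (h y hyO hne (Metric.mem_ball_comm.1 hy))

theorem pd_indicator {r : ℝ} (hr : 0 < r) {O : Set L2} (hO : IsOpen O) {f : L2 → ℝ}
    (h : SuppIncl r O f) (i : ℕ) (x : L2) :
    pd i (O.indicator f) x = O.indicator (pd i f) x := by
  by_cases hx : x ∈ O
  · rw [Set.indicator_of_mem hx]
    exact pd_congr hO (fun y hy => Set.indicator_of_mem hy f) i hx
  · rw [Set.indicator_of_notMem hx,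
      pd_congr (g := fun _ => 0) Metric.isOpen_ball
        (fun y hy => h.indicator_eq_zero hx hy) i (Metric.mem_ball_self hr)]
    simp [pd]

theorem IsTame.indicator {r : ℝ} (hr : 0 < r) {O : Set L2} (hO : IsOpen O) {f : L2 → ℝ}
    (hf : IsTame O f) (h : SuppIncl r O f) : IsTame Set.univ (O.indicator f) where
  fcont x _ n := by
    rw [show {s : Fin n → ℝ | x + ∑ i : Fin n, s i • e i ∈ Set.univ} = Set.univ by simp,
      continuousOn_univ, continuous_iff_continuousAt]
    intro s
    have hc : Continuous fun s : Fin n → ℝ => x + ∑ i : Fin n, s i • e i := by fun_prop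
    by_cases hs : x + ∑ i : Fin n, s i • e i ∈ O
    · have hc' : Continuous fun s' : Fin n → ℝ =>
          x + ∑ i : Fin n, s i • e i + ∑ i : Fin n, s' i • e i := by fun_prop
      have h1 := hf.fcont _ hs n
      have h2 := h1.continuousAt (x := 0) ((hO.preimage hc').mem_nhds (by simpa using hs))
      have h3 : ContinuousAt (fun s' : Fin n → ℝ => s' - s) s := by fun_prop
      have h4 := ContinuousAt.comp (f := fun s' : Fin n → ℝ => s' - s) (x := s)
        (by simpa using h2) h3
      refine h4.congr ?_
      filter_upwards [(hO.preimage hc).mem_nhds hs] with s' hs'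
      rw [Set.indicator_of_mem (show x + ∑ i : Fin n, s' i • e i ∈ O from hs')]
      simp only [Function.comp, Pi.sub_apply, sub_smul, Finset.sum_sub_distrib]
      congr 1
      abel
    · refine (continuousAt_const (y := (0 : ℝ))).congr ?_
      have : ∀ᶠ s' in 𝓝 s, x + ∑ i : Fin n, s' i • e i ∈
          Metric.ball (x + ∑ i : Fin n, s i • e i) r :=
        hc.continuousAt.eventually (Metric.ball_mem_nhds _ hr)
      filter_upwards [this] with s' hs'
      exact (h.indicator_eq_zero hs hs').symm
  meas := by
    suffices hm : Measurable (O.indicator f) from hm.comp measurable_subtype_coe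
    refine measurable_of_restrict_of_restrict_compl hO.measurableSet ?_ ?_
    · rw [show O.domRestrict (O.indicator f) = fun x : O => f x from funext fun x => by simp]
      exact hf.meas
    · rw [show Oᶜ.domRestrict (O.indicator f) = fun _ => 0 from funext fun x => by
        simp [Set.indicator_of_notMem (show x.1 ∉ O from x.2)]]
      exact measurable_const
  bdd := by
    obtain ⟨C, hC⟩ := hf.bdd
    refine ⟨max C 0, fun x _ => ?_⟩
    by_cases hx : x ∈ O
    · rw [Set.indicator_of_mem hx]; exact (hC x hx).trans (le_max_left _ _)
    · rw [Set.indicator_of_notMem hx]; simp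
  hasPd i x _ := by
    by_cases hx : x ∈ O
    · exact (hf.hasPd i x hx).congr hO (fun y hy => (Set.indicator_of_mem hy f).symm) hx
    · exact HasPd.congr (f := fun _ => 0) Metric.isOpen_ball
        (fun y hy => (h.indicator_eq_zero hx hy).symm) (Metric.mem_ball_self hr)
        (differentiableAt_const _)

theorem IsCSb.indicator {r : ℝ} (hr : 0 < r) {O : Set L2} (hO : IsOpen O) {f : L2 → ℝ}
    (hf : IsCSb O f) (h : SuppIncl r O f) : IsCSb Set.univ (O.indicator f) := by
  refine isCSb_of_closed isOpen_univ
    {u | ∃ v, IsCSb O v ∧ SuppIncl r O v ∧ u = O.indicator v} ?_ ?_ ⟨f, hf, h, rfl⟩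
  · rintro u ⟨v, hv, hs, rfl⟩
    exact hv.tame.indicator hr hO hs
  · rintro u ⟨v, hv, hs, rfl⟩ i
    exact ⟨_, ⟨_, hv.pd i, hs.pd hO i, rfl⟩, fun x _ => pd_indicator hr hO hs i x⟩

/-! ### Test functions -/

theorem UnifIncl.mono {E E' O : Set L2} (h : E' ⊆ E) (hE : UnifIncl E O) : UnifIncl E' O := by
  obtain ⟨r, hr, R, hR, h1, h2⟩ := hE
  exact ⟨r, hr, R, hR, (Set.biUnion_subset_biUnion_left h).trans h1, h.trans h2⟩

theorem UnifIncl.closure {E O : Set L2} (hE : UnifIncl E O) : UnifIncl (closure E) O := by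
  obtain ⟨r, hr, R, hR, h1, h2⟩ := hE
  refine ⟨r, hr, R + 1, by linarith, ?_, ?_⟩
  · refine Set.iUnion₂_subset fun x hx y hy => ?_
    obtain ⟨z, hz, hzE⟩ := mem_closure_iff.1 hx _ Metric.isOpen_ball (Metric.mem_ball_comm.1 hy)
    exact h1 (Set.mem_biUnion hzE (Metric.mem_ball_comm.1 hz))
  · refine (closure_mono h2).trans (Metric.closure_ball_subset_closedBall.trans ?_)
    exact Metric.closedBall_subset_ball (by linarith)

theorem isCF_iff {O : Set L2} {f : L2 → ℝ} :
    IsCF O f ↔ IsCSb O f ∧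
      (∃ C : ℝ, ∀ x ∈ O, Summable (fun i => |pd i f x| ^ 2) ∧ ∑' i, |pd i f x| ^ 2 ≤ C) ∧
      UnifIncl {x | x ∈ O ∧ f x ≠ 0} O := by
  constructor
  · intro h
    obtain ⟨C, hC⟩ := h.bdd
    have hf : ∀ x ∈ O, |f x| ≤ C := fun x hx =>
      le_trans (le_add_of_nonneg_right (tsum_nonneg fun i => by positivity)) (hC x hx).2
    refine ⟨isCSb_iff.2 fun l => ?_, ⟨C, fun x hx => ⟨(hC x hx).1, ?_⟩⟩,
      h.supp.mono subset_closure⟩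
    · cases l with
      | nil => exact ⟨h.smooth.fcont, h.smooth.meas, ⟨C, hf⟩, h.smooth.hasPd []⟩
      | cons i l =>
        exact ⟨h.smooth.fcont_pd l i, h.smooth.meas_pd l i, h.smooth.bdd_pd l i,
          h.smooth.hasPd (i :: l)⟩
    · exact le_trans (le_add_of_nonneg_left (abs_nonneg _)) (hC x hx).2
  · rintro ⟨h1, ⟨C, hC⟩, h3⟩
    obtain ⟨D, hD⟩ := h1.tame.bdd
    exact ⟨h1.smooth, ⟨D + C, fun x hx => ⟨(hC x hx).1, add_le_add (hD x hx) (hC x hx).2⟩⟩,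
      h3.closure⟩

theorem IsCF.csb {O : Set L2} {f : L2 → ℝ} (hf : IsCF O f) : IsCSb O f := (isCF_iff.1 hf).1

theorem IsCF.suppIncl {O : Set L2} {f : L2 → ℝ} (hf : IsCF O f) : ∃ r > 0, SuppIncl r O f := by
  obtain ⟨r, hr, R, hR, h1, h2⟩ := (isCF_iff.1 hf).2.2
  refine ⟨r, hr, fun x hx hne y hy => h1 ?_⟩
  exact Set.mem_iUnion₂.2 ⟨x, ⟨hx, hne⟩, hy⟩

theorem IsCF.exists_bound {O : Set L2} {f : L2 → ℝ} (hf : IsCF O f) :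
    ∃ R > 0, ∀ x ∈ O, f x ≠ 0 → ‖x‖ < R := by
  obtain ⟨r, hr, R, hR, h1, h2⟩ := (isCF_iff.1 hf).2.2
  exact ⟨R, hR, fun x hx hne => by simpa using h2 (show x ∈ {x | x ∈ O ∧ f x ≠ 0} from ⟨hx, hne⟩)⟩

/-- Test functions on `O` extend by zero to test functions on `ℓ²`. -/
theorem IsCF.indicator {O : Set L2} (hO : IsOpen O) {f : L2 → ℝ} (hf : IsCF O f) :
    IsCF Set.univ (O.indicator f) := by
  obtain ⟨r, hr, hs⟩ := hf.suppIncl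
  obtain ⟨R, hR, hb⟩ := hf.exists_bound
  obtain ⟨h1, ⟨C, hC⟩, h3⟩ := isCF_iff.1 hf
  refine isCF_iff.2 ⟨h1.indicator hr hO hs, ⟨max C 0, fun x _ => ?_⟩, 1, one_pos, R, hR, by simp,
    ?_⟩
  · simp only [pd_indicator hr hO hs]
    by_cases hx : x ∈ O
    · simp only [Set.indicator_of_mem hx]
      exact ⟨(hC x hx).1, (hC x hx).2.trans (le_max_left _ _)⟩
    · simp [Set.indicator_of_notMem hx, summable_zero]
  · rintro x ⟨-, hne⟩
    have hx : x ∈ O := Set.mem_of_indicator_ne_zero hne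
    rw [Set.indicator_of_mem hx] at hne
    simpa using hb x hx hne

theorem IsCF.comp_add {O : Set L2} {f : L2 → ℝ} (hf : IsCF O f) (v : L2) :
    IsCF ((· + v) ⁻¹' O) fun x => f (x + v) := by
  obtain ⟨h1, ⟨C, hC⟩, r, hr, R, hR, h3, h4⟩ := isCF_iff.1 hf
  refine isCF_iff.2 ⟨h1.comp_add v, ⟨C, fun x hx => ?_⟩, r, hr, R + ‖v‖, by positivity, ?_, ?_⟩
  · simpa only [pd_comp_add] using hC (x + v) hx
  · refine Set.iUnion₂_subset fun x hx y hy => ?_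
    refine h3 (Set.mem_biUnion (x := x + v) hx ?_)
    simpa using hy
  · intro x hx
    have : ‖x + v‖ < R := by simpa using h4 (show x + v ∈ {x | x ∈ O ∧ f x ≠ 0} from hx)
    have h5 : ‖x‖ ≤ ‖x + v‖ + ‖v‖ := by simpa using norm_sub_le (x + v) v
    simp only [Metric.mem_ball, dist_zero_right]
    linarith

theorem pdStar_mul {a : ℕ → ℝ} {i : ℕ} {f g : L2 → ℝ} {x : L2} (hf : HasPd i f x)
    (hg : HasPd i g x) :
    pdStar a i (fun y => f y * g y) x = f x * pdStar a i g x - pd i f x * g x := by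
  rw [pdStar, pdStar, pd_mul hf hg]; ring

/-- Test functions form a module over the functions with bounded derivatives and bounded gradient.
-/
theorem IsCF.mul_left {O : Set L2} (hO : IsOpen O) {f b : L2 → ℝ} (hf : IsCF O f)
    (hb : IsCSb O b)
    (hbg : ∃ C : ℝ, ∀ x ∈ O, Summable (fun i => |pd i b x| ^ 2) ∧ ∑' i, |pd i b x| ^ 2 ≤ C) :
    IsCF O fun x => b x * f x := by
  obtain ⟨h1, ⟨C, hC⟩, h3⟩ := isCF_iff.1 hf
  obtain ⟨D, hD⟩ := hbg
  obtain ⟨A, hA⟩ := h1.tame.bdd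
  obtain ⟨B, hB⟩ := hb.tame.bdd
  refine isCF_iff.2 ⟨hb.mul hO h1, ⟨2 * A ^ 2 * D + 2 * B ^ 2 * C, fun x hx => ?_⟩,
    h3.mono ?_⟩
  swap
  · rintro x ⟨hx, hne⟩
    exact ⟨hx, right_ne_zero_of_mul hne⟩
  obtain ⟨hs, hle⟩ := hC x hx
  obtain ⟨hs', hle'⟩ := hD x hx
  have hA0 := (abs_nonneg _).trans (hA x hx)
  have hB0 := (abs_nonneg _).trans (hB x hx)
  have hs2 : Summable fun i => 2 * A ^ 2 * |pd i b x| ^ 2 + 2 * B ^ 2 * |pd i f x| ^ 2 :=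
    (hs'.mul_left _).add (hs.mul_left _)
  have hterm : ∀ i, |pd i (fun y => b y * f y) x| ^ 2 ≤
      2 * A ^ 2 * |pd i b x| ^ 2 + 2 * B ^ 2 * |pd i f x| ^ 2 := by
    intro i
    rw [pd_mul (hb.tame.hasPd i x hx) (h1.tame.hasPd i x hx)]
    have e1 : |pd i b x * f x + b x * pd i f x| ≤ A * |pd i b x| + B * |pd i f x| := by
      refine (abs_add_le _ _).trans (add_le_add ?_ ?_)
      · rw [abs_mul, mul_comm]; gcongr; exact hA x hx
      · rw [abs_mul]; gcongr; exact hB x hx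
    calc _ ≤ (A * |pd i b x| + B * |pd i f x|) ^ 2 := by gcongr
      _ ≤ _ := by nlinarith [sq_nonneg (A * |pd i b x| - B * |pd i f x|)]
  have hs3 := Summable.of_nonneg_of_le (fun i => by positivity) hterm hs2
  refine ⟨hs3, (hs3.tsum_le_tsum hterm hs2).trans ?_⟩
  rw [Summable.tsum_add (hs'.mul_left _) (hs.mul_left _), tsum_mul_left, tsum_mul_left]
  gcongr

/-! ### Smooth functions with bounded Fréchet derivatives -/

/-- Functions of class `C^∞` in the sense of Fréchet that are bounded together with all their
iterated derivatives. -/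
def BddSmooth {E : Type*} [NormedAddCommGroup E] [NormedSpace ℝ E] (f : E → ℝ) : Prop :=
  ContDiff ℝ (⊤ : ℕ∞) f ∧ ∀ n : ℕ, ∃ C : ℝ, ∀ x, ‖iteratedFDeriv ℝ n f x‖ ≤ C

section General

variable {E F : Type*} [NormedAddCommGroup E] [NormedSpace ℝ E] [NormedAddCommGroup F]
  [NormedSpace ℝ F]

theorem BddSmooth.const (c : ℝ) : BddSmooth fun _ : E => c := by
  refine ⟨contDiff_const, fun n => ?_⟩
  cases n with
  | zero => exact ⟨‖c‖, fun x => by simp⟩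
  | succ n => exact ⟨0, fun x => by simp [iteratedFDeriv_const_of_ne (Nat.succ_ne_zero n)]⟩

theorem BddSmooth.add {f g : E → ℝ} (hf : BddSmooth f) (hg : BddSmooth g) :
    BddSmooth fun x => f x + g x := by
  refine ⟨hf.1.add hg.1, fun n => ?_⟩
  obtain ⟨C, hC⟩ := hf.2 n
  obtain ⟨D, hD⟩ := hg.2 n
  refine ⟨C + D, fun x => ?_⟩
  have h := iteratedFDeriv_add_apply (i := n) (x := x)
    (hf.1.of_le (by exact_mod_cast le_top)).contDiffAt
    (hg.1.of_le (by exact_mod_cast le_top)).contDiffAt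
  have h' : iteratedFDeriv ℝ n (fun x => f x + g x) x =
    iteratedFDeriv ℝ n f x + iteratedFDeriv ℝ n g x := h
  rw [h']
  exact (norm_add_le _ _).trans (add_le_add (hC x) (hD x))

theorem BddSmooth.mul {f g : E → ℝ} (hf : BddSmooth f) (hg : BddSmooth g) :
    BddSmooth fun x => f x * g x := by
  refine ⟨hf.1.mul hg.1, fun n => ?_⟩
  choose C hC using hf.2
  choose D hD using hg.2
  refine ⟨∑ i ∈ Finset.range (n + 1), (n.choose i : ℝ) * C i * D (n - i), fun x => ?_⟩
  refine (norm_iteratedFDeriv_mul_le hf.1 hg.1 x (by exact_mod_cast le_top)).trans ?_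
  refine Finset.sum_le_sum fun i _ => ?_
  have := (norm_nonneg _).trans (hC i x)
  gcongr
  exacts [hC i x, hD _ x]

theorem BddSmooth.const_mul {f : E → ℝ} (hf : BddSmooth f) (c : ℝ) : BddSmooth fun x => c * f x :=
  (BddSmooth.const c).mul hf

theorem BddSmooth.one_sub {f : E → ℝ} (hf : BddSmooth f) : BddSmooth fun x => 1 - f x := by
  simpa [sub_eq_add_neg] using (BddSmooth.const 1).add (hf.const_mul (-1))

theorem BddSmooth.comp_clm {f : F → ℝ} (hf : BddSmooth f) (T : E →L[ℝ] F) :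
    BddSmooth fun x => f (T x) := by
  refine ⟨hf.1.comp T.contDiff, fun n => ?_⟩
  obtain ⟨C, hC⟩ := hf.2 n
  refine ⟨C * ‖T‖ ^ n, fun x => ?_⟩
  have := T.iteratedFDeriv_comp_right hf.1 x (i := n) (by exact_mod_cast le_top)
  rw [show (fun x => f (T x)) = f ∘ T from rfl, this]
  refine (ContinuousMultilinearMap.norm_compContinuousLinearMap_le _ _).trans ?_
  simp only [Finset.prod_const, Finset.card_univ, Fintype.card_fin]
  gcongr
  exact hC _

theorem BddSmooth.comp_add {f : E → ℝ} (hf : BddSmooth f) (v : E) :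
    BddSmooth fun x => f (x + v) := by
  refine ⟨hf.1.comp (contDiff_id.add contDiff_const), fun n => ?_⟩
  obtain ⟨C, hC⟩ := hf.2 n
  refine ⟨C, fun x => ?_⟩
  rw [iteratedFDeriv_comp_add_right]
  exact hC _

theorem BddSmooth.bdd {f : E → ℝ} (hf : BddSmooth f) : ∃ C, ∀ x, |f x| ≤ C := by
  obtain ⟨C, hC⟩ := hf.2 0
  exact ⟨C, fun x => by simpa using hC x⟩

theorem BddSmooth.differentiable {f : E → ℝ} (hf : BddSmooth f) : Differentiable ℝ f :=
  hf.1.differentiable (by simp)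

theorem BddSmooth.fderiv_bdd {f : E → ℝ} (hf : BddSmooth f) : ∃ C, ∀ x, ‖fderiv ℝ f x‖ ≤ C := by
  obtain ⟨C, hC⟩ := hf.2 1
  exact ⟨C, fun x => by simpa [norm_iteratedFDeriv_one] using hC x⟩

theorem BddSmooth.fderiv_apply {f : E → ℝ} (hf : BddSmooth f) (v : E) :
    BddSmooth fun x => fderiv ℝ f x v := by
  have h1 : ContDiff ℝ (⊤ : ℕ∞) (fderiv ℝ f) := hf.1.fderiv_right (by simp)
  refine ⟨h1.clm_apply contDiff_const, fun n => ?_⟩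
  obtain ⟨C, hC⟩ := hf.2 (n + 1)
  refine ⟨‖v‖ * C, fun x => ?_⟩
  refine (norm_iteratedFDeriv_clm_apply_const (N := (⊤ : ℕ∞)) h1.contDiffAt
    (by exact_mod_cast le_top)).trans ?_
  rw [norm_iteratedFDeriv_fderiv]
  gcongr
  exact hC x

end General

theorem BddSmooth.of_hasCompactSupport {f : ℝ → ℝ} (hf : ContDiff ℝ (⊤ : ℕ∞) f)
    (hc : HasCompactSupport f) : BddSmooth f := by
  refine ⟨hf, fun n => ?_⟩
  exact (hc.iteratedFDeriv n).exists_bound_of_continuous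
    (hf.continuous_iteratedFDeriv (by exact_mod_cast le_top))

theorem bddSmooth_cos : BddSmooth Real.cos := by
  refine ⟨Real.contDiff_cos, fun n => ⟨1, fun x => ?_⟩⟩
  rw [norm_iteratedFDeriv_eq_norm_iteratedDeriv]
  exact Real.abs_iteratedDeriv_cos_le_one n x

theorem inner_e_left (i : ℕ) (x : L2) : inner ℝ (e i) x = x i := by
  rw [e, lp.inner_single_left]; simp

theorem inner_e_right (i : ℕ) (x : L2) : inner ℝ x (e i) = x i := by
  rw [real_inner_comm, inner_e_left]

theorem norm_e (i : ℕ) : ‖e i‖ = 1 := by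
  rw [e, lp.norm_single (by norm_num)]; simp

theorem e_apply (i j : ℕ) : (e i : ℕ → ℝ) j = if i = j then 1 else 0 := by
  rw [e, lp.coeFn_single, Pi.single_apply]
  simp only [eq_comm]

theorem norm_sq_eq_tsum (x : L2) : HasSum (fun i => x i ^ 2) (‖x‖ ^ 2) := by
  have := lp.hasSum_inner (𝕜 := ℝ) x x
  rw [real_inner_self_eq_norm_sq] at this
  simpa [sq] using this

theorem pd_eq_fderiv {f : L2 → ℝ} {x : L2} (hf : DifferentiableAt ℝ f x) (i : ℕ) :
    HasPd i f x ∧ pd i f x = fderiv ℝ f x (e i) := by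
  have h : HasDerivAt (fun t : ℝ => f (x + t • e i)) (fderiv ℝ f x (e i)) 0 :=
    hf.hasFDerivAt.hasLineDerivAt (e i)
  exact ⟨h.differentiableAt, h.deriv⟩

theorem BddSmooth.hasPd {f : L2 → ℝ} (hf : BddSmooth f) (i : ℕ) (x : L2) : HasPd i f x :=
  (pd_eq_fderiv (hf.differentiable x) i).1

theorem BddSmooth.pd_eq {f : L2 → ℝ} (hf : BddSmooth f) (i : ℕ) :
    pd i f = fun x => fderiv ℝ f x (e i) :=
  funext fun x => (pd_eq_fderiv (hf.differentiable x) i).2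

theorem BddSmooth.pd {f : L2 → ℝ} (hf : BddSmooth f) (i : ℕ) : BddSmooth (pd i f) := by
  rw [hf.pd_eq]; exact hf.fderiv_apply _

theorem BddSmooth.continuous {f : L2 → ℝ} (hf : BddSmooth f) : Continuous f := hf.1.continuous

theorem BddSmooth.isCSb {f : L2 → ℝ} (hf : BddSmooth f) (O : Set L2) : IsCSb O f := by
  refine IsCSb.mono (Set.subset_univ O) ?_
  refine isCSb_of_closed isOpen_univ {u | BddSmooth u} ?_ ?_ hf
  · intro u hu
    obtain ⟨C, hC⟩ := hu.bdd
    refine ⟨fun x _ n => Continuous.continuousOn ?_, (hu.continuous.measurable).comp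
      measurable_subtype_coe, ⟨C, fun x _ => hC x⟩, fun i x _ => hu.hasPd i x⟩
    have := hu.continuous
    fun_prop
  · intro u hu i
    exact ⟨_, hu.pd i, fun x _ => rfl⟩

/-- Bessel's equality: the partial derivatives are the coordinates of the gradient. -/
theorem hasSum_sq_fderiv (T : L2 →L[ℝ] ℝ) : HasSum (fun i => |T (e i)| ^ 2) (‖T‖ ^ 2) := by
  set y := (InnerProductSpace.toDual ℝ L2).symm T
  have h1 : ‖T‖ = ‖y‖ := by simp [y]
  have h2 : ∀ i, T (e i) = y i := fun i => by
    rw [← inner_e_right, InnerProductSpace.toDual_symm_apply]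
  simp only [h1, h2, sq_abs]
  exact norm_sq_eq_tsum y

theorem BddSmooth.grad_bdd {f : L2 → ℝ} (hf : BddSmooth f) :
    ∃ C : ℝ, ∀ x, Summable (fun i => |GaussSobolev.pd i f x| ^ 2) ∧
      ∑' i, |GaussSobolev.pd i f x| ^ 2 ≤ C := by
  obtain ⟨C, hC⟩ := hf.fderiv_bdd
  refine ⟨C ^ 2, fun x => ?_⟩
  have h := hasSum_sq_fderiv (fderiv ℝ f x)
  simp only [fun i => congrFun (hf.pd_eq i) x]
  refine ⟨h.summable, ?_⟩
  rw [h.tsum_eq]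
  gcongr
  exact hC x

theorem BddSmooth.pd_bdd {f : L2 → ℝ} (hf : BddSmooth f) :
    ∃ C : ℝ, ∀ i x, |GaussSobolev.pd i f x| ≤ C := by
  obtain ⟨C, hC⟩ := hf.fderiv_bdd
  refine ⟨C, fun i x => ?_⟩
  rw [hf.pd_eq i]
  refine ((fderiv ℝ f x).le_opNorm (e i)).trans ?_
  rw [norm_e, mul_one]
  exact hC x

theorem IsCF.bddSmooth_mul {O : Set L2} (hO : IsOpen O) {f b : L2 → ℝ}
    (hf : IsCF O f) (hb : BddSmooth b) : IsCF O fun x => b x * f x := by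
  obtain ⟨C, hC⟩ := hb.grad_bdd
  exact hf.mul_left hO (hb.isCSb O) ⟨C, fun x _ => hC x⟩

theorem BddSmooth.isCF {O : Set L2} {f : L2 → ℝ} (hf : BddSmooth f)
    (h : UnifIncl {x | f x ≠ 0} O) : IsCF O f := by
  obtain ⟨C, hC⟩ := hf.grad_bdd
  exact isCF_iff.2 ⟨hf.isCSb O, ⟨C, fun x _ => hC x⟩, h.mono fun x hx => hx.2⟩

/-! ### Cut-off functions -/

/-- The radial function equal to `1` on the unit ball and to `0` off the ball of radius `√2`. -/
def normCut (x : L2) : ℝ := Real.smoothTransition (2 - ‖x‖ ^ 2)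

theorem normCut_eq_one {x : L2} (hx : ‖x‖ ≤ 1) : normCut x = 1 :=
  Real.smoothTransition.one_of_one_le (by nlinarith [norm_nonneg x])

theorem normCut_eq_zero {x : L2} (hx : 2 ≤ ‖x‖ ^ 2) : normCut x = 0 :=
  Real.smoothTransition.zero_of_nonpos (by linarith)

theorem contDiff_normCut : ContDiff ℝ (⊤ : ℕ∞) normCut :=
  Real.smoothTransition.contDiff.comp (contDiff_const.sub (contDiff_norm_sq ℝ))

/-- By invariance under the isometries of `ℓ²`, the derivatives of the radial cut-off function need
only be bounded on a segment, which is compact. -/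
theorem bddSmooth_normCut : BddSmooth normCut := by
  refine ⟨contDiff_normCut, fun n => ?_⟩
  have hcont : Continuous fun x => ‖iteratedFDeriv ℝ n normCut x‖ :=
    (contDiff_normCut.continuous_iteratedFDeriv (by exact_mod_cast le_top)).norm
  obtain ⟨C, hC⟩ := (isCompact_Icc (a := (0 : ℝ)) (b := 2)).exists_bound_of_continuousOn
    (f := fun s : ℝ => ‖iteratedFDeriv ℝ n normCut (s • e 0)‖)
    (hcont.comp (by fun_prop : Continuous fun s : ℝ => s • e 0)).continuousOn
  refine ⟨max C 0, fun x => ?_⟩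
  by_cases hx : ‖x‖ ≤ 2
  · have hn : ‖x‖ = ‖‖x‖ • e 0‖ := by simp [norm_smul, norm_e]
    let g : L2 ≃ₗᵢ[ℝ] L2 := (ℝ ∙ (x - ‖x‖ • e 0))ᗮ.reflection
    have hg : g x = ‖x‖ • e 0 := Submodule.reflection_sub hn
    have hinv : normCut ∘ g = normCut := by
      funext y
      simp [normCut]
    have h1 := g.norm_iteratedFDeriv_comp_right (𝕜 := ℝ) normCut x n
    rw [hinv, hg] at h1
    rw [h1]
    have := hC ‖x‖ ⟨norm_nonneg x, hx⟩
    rw [norm_norm] at this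
    exact this.trans (le_max_left _ _)
  · have hsub : tsupport normCut ⊆ Metric.closedBall 0 2 := by
      refine closure_minimal (fun y hy => ?_) Metric.isClosed_closedBall
      by_contra hy2
      refine hy (normCut_eq_zero ?_)
      simp only [Metric.mem_closedBall, dist_zero_right, not_le] at hy2
      nlinarith
    have h0 : iteratedFDeriv ℝ n normCut x = 0 := by
      by_contra hne
      have := hsub (support_iteratedFDeriv_subset n hne)
      simp at this
      exact hx this
    rw [h0, norm_zero]
    exact le_max_right _ _

/-- A cut-off function equal to `1` on `ball c r` and supported in `ball c (2 * r)`. -/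
def cutoff (c : L2) (r : ℝ) (x : L2) : ℝ := normCut (r⁻¹ • (x - c))

theorem bddSmooth_cutoff (c : L2) (r : ℝ) : BddSmooth (cutoff c r) := by
  have h1 := bddSmooth_normCut.comp_clm (r⁻¹ • ContinuousLinearMap.id ℝ L2)
  have h2 := h1.comp_add (-c)
  have h3 : cutoff c r = fun x => normCut ((r⁻¹ • ContinuousLinearMap.id ℝ L2) (x + -c)) := by
    funext x
    simp only [cutoff, sub_eq_add_neg, _root_.smul_apply,
      ContinuousLinearMap.id_apply]
  rw [h3]
  exact h2

theorem cutoff_nonneg (c : L2) (r : ℝ) (x : L2) : 0 ≤ cutoff c r x :=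
  Real.smoothTransition.nonneg _

theorem cutoff_le_one (c : L2) (r : ℝ) (x : L2) : cutoff c r x ≤ 1 :=
  Real.smoothTransition.le_one _

theorem cutoff_eq_one {c : L2} {r : ℝ} (hr : 0 < r) {x : L2} (hx : dist x c ≤ r) :
    cutoff c r x = 1 := by
  refine normCut_eq_one ?_
  rw [norm_smul, ← dist_eq_norm, Real.norm_eq_abs, abs_inv, abs_of_pos hr]
  rw [inv_mul_le_iff₀ hr]; linarith

theorem dist_lt_of_cutoff_ne_zero {c : L2} {r : ℝ} (hr : 0 < r) {x : L2}
    (hx : cutoff c r x ≠ 0) : dist x c < 2 * r := by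
  by_contra hle
  refine hx (normCut_eq_zero ?_)
  rw [norm_smul, ← dist_eq_norm, Real.norm_eq_abs, abs_inv, abs_of_pos hr]
  have h2 : 2 ≤ r⁻¹ * dist x c := by
    rw [le_inv_mul_iff₀ hr]; linarith
  nlinarith

theorem unifIncl_of_cutoff {c : L2} {r : ℝ} (hr : 0 < r) {O : Set L2}
    (h : Metric.ball c (3 * r) ⊆ O) : UnifIncl {x | cutoff c r x ≠ 0} O := by
  refine ⟨r, hr, ‖c‖ + 2 * r, by positivity, Set.iUnion₂_subset fun x hx y hy => h ?_,
    fun x hx => ?_⟩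
  · have h1 := dist_lt_of_cutoff_ne_zero hr hx
    have h2 := dist_triangle y x c
    rw [Metric.mem_ball] at hy ⊢
    linarith
  · have h1 := dist_lt_of_cutoff_ne_zero hr hx
    have h2 := dist_triangle x c 0
    rw [dist_zero_right c] at h2
    rw [Metric.mem_ball]
    linarith

theorem UnifIncl.union {E E' O : Set L2} (h : UnifIncl E O) (h' : UnifIncl E' O) :
    UnifIncl (E ∪ E') O := by
  obtain ⟨r, hr, R, hR, h1, h2⟩ := h
  obtain ⟨r', hr', R', hR', h1', h2'⟩ := h'
  refine ⟨min r r', lt_min hr hr', max R R', lt_max_of_lt_left hR, ?_, ?_⟩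
  · refine Set.iUnion₂_subset fun x hx y hy => ?_
    rw [Metric.mem_ball, lt_min_iff] at hy
    rcases hx with hx | hx
    · exact h1 (Set.mem_iUnion₂.2 ⟨x, hx, hy.1⟩)
    · exact h1' (Set.mem_iUnion₂.2 ⟨x, hx, hy.2⟩)
  · refine Set.union_subset (h2.trans (Metric.ball_subset_ball (le_max_left _ _)))
      (h2'.trans (Metric.ball_subset_ball (le_max_right _ _)))

/-- A compact subset of an open set has a smooth cut-off function. -/
theorem exists_cutoff_of_isCompact {K O : Set L2} (hK : IsCompact K) (hO : IsOpen O)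
    (hKO : K ⊆ O) : ∃ β : L2 → ℝ, BddSmooth β ∧ UnifIncl {x | β x ≠ 0} O ∧
      ∃ N, IsOpen N ∧ K ⊆ N ∧ ∀ x ∈ N, β x = 1 := by
  refine hK.induction_on (p := fun s => ∃ β : L2 → ℝ, BddSmooth β ∧ UnifIncl {x | β x ≠ 0} O ∧
      ∃ N, IsOpen N ∧ s ⊆ N ∧ ∀ x ∈ N, β x = 1) ?_ ?_ ?_ ?_
  · exact ⟨fun _ => 0, BddSmooth.const 0, ⟨1, one_pos, 1, one_pos, by simp, by simp⟩, ∅,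
      isOpen_empty, subset_rfl, by simp⟩
  · rintro s t hst ⟨β, h1, h2, N, h3, h4, h5⟩
    exact ⟨β, h1, h2, N, h3, hst.trans h4, h5⟩
  · rintro s t ⟨β, h1, h2, N, h3, h4, h5⟩ ⟨β', h1', h2', N', h3', h4', h5'⟩
    refine ⟨fun x => 1 - (1 - β x) * (1 - β' x), (h1.one_sub.mul h1'.one_sub).one_sub,
      (h2.union h2').mono fun x hx => ?_, N ∪ N', h3.union h3', Set.union_subset_union h4 h4', ?_⟩
    · by_contra hne
      simp only [Set.mem_union, Set.mem_ofPred_eq, not_or, not_not] at hne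
      exact hx (by simp [hne.1, hne.2])
    · rintro x (hx | hx)
      · simp [h5 x hx]
      · simp [h5' x hx]
  · intro x hx
    obtain ⟨r, hr, hball⟩ := Metric.isOpen_iff.1 hO x (hKO hx)
    refine ⟨Metric.ball x (r / 3),
      mem_nhdsWithin_of_mem_nhds (Metric.ball_mem_nhds _ (by positivity)),
      cutoff x (r / 3), bddSmooth_cutoff _ _, unifIncl_of_cutoff (by positivity) ?_,
      Metric.ball x (r / 3), Metric.isOpen_ball, subset_rfl, fun y hy => ?_⟩
    · rwa [mul_div_cancel₀ r (by norm_num : (3 : ℝ) ≠ 0)]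
    · exact cutoff_eq_one (by positivity) (Metric.mem_ball.1 hy).le

theorem pd_eq_zero_of_const {N : Set L2} (hN : IsOpen N) {β : L2 → ℝ} {c : ℝ}
    (h : ∀ x ∈ N, β x = c) {x : L2} (hx : x ∈ N) (i : ℕ) : pd i β x = 0 := by
  rw [pd_congr (g := fun _ => c) hN h i hx]; simp [pd]

theorem pd_cutoff_bdd (c : L2) : ∃ C : ℝ, ∀ r ≥ 1, ∀ i x, |pd i (cutoff c r) x| ≤ C := by
  obtain ⟨C, hC⟩ := bddSmooth_normCut.pd_bdd
  refine ⟨C, fun r hr i x => ?_⟩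
  have h1 : HasDerivAt (fun t : ℝ => normCut (r⁻¹ • (x - c) + t • e i))
      (pd i normCut (r⁻¹ • (x - c))) (r⁻¹ * 0) := by
    rw [mul_zero]; exact DifferentiableAt.hasDerivAt (bddSmooth_normCut.hasPd i _)
  have h2 := HasDerivAt.comp (h := fun t : ℝ => r⁻¹ * t) 0 h1
    ((hasDerivAt_id (0 : ℝ)).const_mul r⁻¹)
  have h3 : pd i (cutoff c r) x = pd i normCut (r⁻¹ • (x - c)) * r⁻¹ := by
    refine HasDerivAt.deriv ?_
    rw [mul_one] at h2
    refine h2.congr_of_eventuallyEq (Eventually.of_forall fun t => ?_)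
    simp only [cutoff, Function.comp, smul_sub, smul_add, smul_smul, add_sub_right_comm]
  rw [h3, abs_mul]
  have h4 : |r⁻¹| ≤ 1 := by
    rw [abs_of_pos (by positivity)]; exact inv_le_one_of_one_le₀ hr
  calc _ ≤ |pd i normCut (r⁻¹ • (x - c))| * 1 := by gcongr
    _ ≤ C := by rw [mul_one]; exact hC i _

/-- Smooth functions with bounded derivatives and bounded support. -/
def BddSmoothSupp (φ : L2 → ℝ) : Prop := BddSmooth φ ∧ ∃ R : ℝ, ∀ x, φ x ≠ 0 → ‖x‖ < R

theorem BddSmoothSupp.isCF {φ : L2 → ℝ} (h : BddSmoothSupp φ) : IsCF Set.univ φ := by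
  obtain ⟨h1, R, hR⟩ := h
  refine h1.isCF ⟨1, one_pos, max R 1, lt_max_of_lt_right one_pos,
    Set.subset_univ _, fun x hx => ?_⟩
  simpa using Or.inl (hR x hx)

theorem BddSmooth.mul_supp {f φ : L2 → ℝ} (hf : BddSmooth f) (h : BddSmoothSupp φ) :
    BddSmoothSupp fun x => f x * φ x := by
  obtain ⟨h1, R, hR⟩ := h
  exact ⟨hf.mul h1, R, fun x hx => hR x (right_ne_zero_of_mul hx)⟩

theorem bddSmoothSupp_cutoff (c : L2) {r : ℝ} (hr : 0 < r) : BddSmoothSupp (cutoff c r) := by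
  refine ⟨bddSmooth_cutoff c r, ‖c‖ + 2 * r, fun x hx => ?_⟩
  have h1 := dist_lt_of_cutoff_ne_zero hr hx
  have h2 := dist_triangle x c 0
  rw [dist_zero_right, dist_zero_right] at h2
  linarith

open ProbabilityTheory

/-! ### The space `ℓ²` and the Gaussian measure -/

/-- The truncations of a sequence to its first coordinates converge to it. -/
theorem tendsto_truncate (x : L2) :
    Tendsto (fun n => ∑ i ∈ Finset.range n, x i • e i) atTop (𝓝 x) := by
  have hx := (lp.hasSum_single (p := 2) (by simp) x).tendsto_sum_nat
  refine hx.congr fun n => Finset.sum_congr rfl fun i _ => ?_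
  rw [e, ← lp.single_smul]; simp

theorem truncate_apply (x : L2) (n j : ℕ) :
    (∑ i ∈ Finset.range n, x i • e i : L2) j = if j < n then x j else 0 := by
  rw [← inner_e_left, inner_sum]
  simp [inner_smul_right, inner_e_left, e_apply]

instance instSecondCountableTopologyL2 : SecondCountableTopology L2 := by
  have hsep : TopologicalSpace.SeparableSpace L2 := by
    have h1 : TopologicalSpace.IsSeparable
        ((Submodule.span ℝ (Set.range e) : Submodule ℝ L2) : Set L2) :=
      (Set.countable_range e).isSeparable.span
    have h2 : closure ((Submodule.span ℝ (Set.range e) : Submodule ℝ L2) : Set L2) = Set.univ :=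
      Set.eq_univ_of_forall fun x => mem_closure_of_tendsto (tendsto_truncate x)
        (Eventually.of_forall fun n => Submodule.sum_mem _ fun i _ =>
          Submodule.smul_mem _ _ (Submodule.subset_span ⟨i, rfl⟩))
    have h3 := h1.closure
    rw [h2] at h3
    exact TopologicalSpace.isSeparable_univ_iff.1 h3
  exact UniformSpace.secondCountable_of_separable L2

theorem continuous_coord (i : ℕ) : Continuous fun x : L2 => x i := by
  simp only [← inner_e_left]; fun_prop

theorem measurable_coord (i : ℕ) : Measurable fun x : L2 => x i := (continuous_coord i).measurable

/-- The one-dimensional centred normal law with standard deviation `s`. -/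
def normalLaw (s : ℝ) : Measure ℝ := gaussianReal 0 (Real.toNNReal (s ^ 2))

instance (s : ℝ) : IsProbabilityMeasure (normalLaw s) := by
  unfold normalLaw; infer_instance

theorem P_eq (a : ℕ → ℝ) : P a = Measure.comap (fun x : L2 => (x : ℕ → ℝ))
    (Measure.infinitePi fun i => normalLaw (a i)) := rfl

theorem map_P (a : ℕ → ℝ) : (P a).map (fun x : L2 => (x : ℕ → ℝ)) =
    (Measure.infinitePi fun i => normalLaw (a i)).restrict
      (Set.range fun x : L2 => (x : ℕ → ℝ)) :=
  measurableEmbedding_coe.map_comap _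

theorem lintegral_P (a : ℕ → ℝ) (f : (ℕ → ℝ) → ENNReal) :
    ∫⁻ x, f x ∂(P a) = ∫⁻ x in Set.range fun x : L2 => (x : ℕ → ℝ), f x
      ∂(Measure.infinitePi fun i => normalLaw (a i)) := by
  rw [← map_P, measurableEmbedding_coe.lintegral_map]

instance (a : ℕ → ℝ) : IsFiniteMeasure (P a) := by
  refine ⟨?_⟩
  have h := lintegral_P a fun _ => 1
  simp only [lintegral_const, one_mul] at h
  rw [h]
  exact measure_lt_top _ _

theorem lintegral_coord_le (a : ℕ → ℝ) (i : ℕ) {f : ℝ → ENNReal} (hf : Measurable f) :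
    ∫⁻ x, f (x i) ∂(P a) ≤ ∫⁻ s, f s ∂(normalLaw (a i)) := by
  rw [lintegral_P a fun x => f (x i)]
  refine (setLIntegral_le_lintegral _ _).trans (le_of_eq ?_)
  exact (measurePreserving_eval_infinitePi (fun i => normalLaw (a i)) i).lintegral_comp hf

theorem lintegral_sq_normalLaw (s : ℝ) :
    ∫⁻ x, ENNReal.ofReal (x ^ 2) ∂(normalLaw s) = ENNReal.ofReal (s ^ 2) := by
  have h2 : MemLp id 2 (normalLaw s) := memLp_id_gaussianReal 2
  have h1 : Integrable (fun x : ℝ => x ^ 2) (normalLaw s) := h2.integrable_sq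
  rw [← ofReal_integral_eq_lintegral_ofReal h1 (Eventually.of_forall fun x => sq_nonneg x)]
  congr 1
  have h3 := variance_of_integral_eq_zero (X := fun x : ℝ => x) (μ := normalLaw s)
    measurable_id.aemeasurable integral_id_gaussianReal
  rw [← h3, normalLaw, variance_fun_id_gaussianReal]
  exact Real.coe_toNNReal _ (sq_nonneg s)

theorem lintegral_sq_coord_le (a : ℕ → ℝ) (i : ℕ) :
    ∫⁻ x, ENNReal.ofReal (x i ^ 2) ∂(P a) ≤ ENNReal.ofReal (a i ^ 2) :=
  (lintegral_coord_le a i (f := fun s => ENNReal.ofReal (s ^ 2)) (by fun_prop)).trans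
    (lintegral_sq_normalLaw _).le

theorem memLp_coord (a : ℕ → ℝ) (i : ℕ) : MemLp (fun x : L2 => x i) 2 (P a) := by
  have hm := (measurable_coord i).aestronglyMeasurable (μ := P a)
  rw [memLp_two_iff_integrable_sq hm]
  refine ⟨(hm.pow 2), ?_⟩
  rw [hasFiniteIntegral_iff_ofReal (Eventually.of_forall fun x => sq_nonneg _)]
  exact (lintegral_sq_coord_le a i).trans_lt ENNReal.ofReal_lt_top

/-- Almost every point has finite norm in the space weighted by `1 / a i`; this is where the
summability of `a` enters. -/
theorem ae_summable_sq_div {a : ℕ → ℝ} (ha : ∀ i, 0 < a i) (hs : Summable a) :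
    ∀ᵐ x ∂(P a), Summable fun i => x i ^ 2 / a i := by
  have hm : ∀ i, Measurable fun x : L2 => ENNReal.ofReal (x i ^ 2 / a i) := fun i =>
    (((measurable_coord i).pow_const 2).div_const _).ennreal_ofReal
  have hle : ∀ i, ∫⁻ x, ENNReal.ofReal (x i ^ 2 / a i) ∂(P a) ≤ ENNReal.ofReal (a i) := by
    intro i
    have h1 : ∀ x : L2, ENNReal.ofReal (x i ^ 2 / a i) =
        ENNReal.ofReal (a i)⁻¹ * ENNReal.ofReal (x i ^ 2) := fun x => by
      rw [← ENNReal.ofReal_mul (inv_nonneg.2 (ha i).le), div_eq_inv_mul]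
    simp only [h1]
    rw [lintegral_const_mul _ ((measurable_coord i).pow_const 2).ennreal_ofReal]
    refine (mul_le_mul_right (lintegral_sq_coord_le a i) _).trans (le_of_eq ?_)
    rw [← ENNReal.ofReal_mul (inv_nonneg.2 (ha i).le)]
    congr 1
    field_simp [(ha i).ne']
  have hfin : ∫⁻ x, ∑' i, ENNReal.ofReal (x i ^ 2 / a i) ∂(P a) ≠ ⊤ := by
    rw [lintegral_tsum fun i => (hm i).aemeasurable]
    refine ne_top_of_le_ne_top ?_ (ENNReal.tsum_le_tsum hle)
    rw [← ENNReal.ofReal_tsum_of_nonneg (fun i => (ha i).le) hs]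
    exact ENNReal.ofReal_ne_top
  have hae := ae_lt_top (Measurable.tsum hm) hfin
  filter_upwards [hae] with x hx
  have h1 := ENNReal.summable_toReal hx.ne
  refine h1.congr fun i => ?_
  exact ENNReal.toReal_ofReal (div_nonneg (sq_nonneg _) (ha i).le)

/-! ### Translation of the Gaussian measure -/

/-- The density at `s` of the normal law with mean `t` and standard deviation `c` with respect to
the centred one. -/
def shiftDensity (c t s : ℝ) : ℝ := Real.exp (t * s / c ^ 2 - t ^ 2 / (2 * c ^ 2))

theorem shiftDensity_pos (c t s : ℝ) : 0 < shiftDensity c t s := Real.exp_pos _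

theorem continuous_shiftDensity (c t : ℝ) : Continuous (shiftDensity c t) := by
  unfold shiftDensity; fun_prop

theorem normalLaw_map_add {c : ℝ} (hc : 0 < c) (t : ℝ) :
    (normalLaw c).map (· + t) =
      (normalLaw c).withDensity fun s => ENNReal.ofReal (shiftDensity c t s) := by
  have hv : Real.toNNReal (c ^ 2) ≠ 0 := by
    rw [Ne, Real.toNNReal_eq_zero, not_le]; positivity
  rw [normalLaw, gaussianReal_map_add_const, zero_add, gaussianReal_of_var_ne_zero _ hv,
    gaussianReal_of_var_ne_zero _ hv, ← withDensity_mul _ (measurable_gaussianPDF _ _)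
      (continuous_shiftDensity c t).measurable.ennreal_ofReal]
  congr 1
  funext s
  rw [Pi.mul_apply, gaussianPDF, gaussianPDF, ← ENNReal.ofReal_mul (gaussianPDFReal_nonneg _ _ _)]
  congr 1
  rw [gaussianPDFReal, gaussianPDFReal, shiftDensity,
    mul_assoc _ (Real.exp _) (Real.exp _), ← Real.exp_add,
    Real.coe_toNNReal _ (sq_nonneg c)]
  congr 2
  field_simp
  ring

theorem infinitePi_map_add {a : ℕ → ℝ} {k : ℕ} (hk : 0 < a k) (t : ℝ) :
    (Measure.infinitePi fun i => normalLaw (a i)).map (fun x => x + Pi.single k t) =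
      (Measure.infinitePi fun i => normalLaw (a i)).withDensity
        fun x => ENNReal.ofReal (shiftDensity (a k) t (x k)) := by
  classical
  set ρ : ℝ → ENNReal := fun s => ENNReal.ofReal (shiftDensity (a k) t s) with hρ
  have hρm : Measurable ρ := (continuous_shiftDensity _ _).measurable.ennreal_ofReal
  have hmap := Measure.infinitePi_map_pi (fun i => normalLaw (a i))
    (f := fun i s => s + (Pi.single k t : ℕ → ℝ) i) (fun i => by fun_prop)
  have hprob : ∀ i, IsProbabilityMeasure
      ((normalLaw (a i)).map fun s => s + (Pi.single k t : ℕ → ℝ) i) := fun i =>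
    Measure.isProbabilityMeasure_map (by fun_prop)
  refine Eq.trans hmap (Measure.eq_infinitePi _ fun s A hA => ?_).symm
  have hbox : MeasurableSet ((s : Set ℕ).pi A) := .pi s.countable_toSet fun i _ => hA i
  -- Write the density on the box as a product of functions of single coordinates.
  let A' : ℕ → Set ℝ := fun i => if i ∈ s then A i else Set.univ
  have hA' : ∀ i, MeasurableSet (A' i) := fun i => by
    simp only [A']; split_ifs; exacts [hA i, .univ]
  let X : ℕ → ℝ → ENNReal := fun i => (A' i).indicator (if i = k then ρ else 1)
  have hX : ∀ i, Measurable (X i) := fun i => by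
    refine Measurable.indicator ?_ (hA' i)
    split_ifs
    exacts [hρm, measurable_one]
  have hprod : ∀ x : ℕ → ℝ, ((s : Set ℕ).pi A).indicator (fun x => ρ (x k)) x =
      ∏ i ∈ insert k s, X i (x i) := by
    intro x
    by_cases hx : x ∈ (s : Set ℕ).pi A
    · rw [Set.indicator_of_mem hx, Finset.prod_eq_single_of_mem k (Finset.mem_insert_self k s)]
      · have : x k ∈ A' k := by
          simp only [A']; split_ifs with h; exacts [hx k h, trivial]
        simp [X, this]
      · intro i hi hik
        have his : i ∈ s := (Finset.mem_insert.1 hi).resolve_left hik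
        have : x i ∈ A' i := by simp only [A', if_pos his]; exact hx i his
        simp [X, this, hik]
    · rw [Set.indicator_of_notMem hx]
      simp only [Set.mem_pi, not_forall] at hx
      obtain ⟨i, his, hi⟩ := hx
      refine (Finset.prod_eq_zero (Finset.mem_insert_of_mem his) ?_).symm
      have : x i ∉ A' i := by
        simp only [A', if_pos (Finset.mem_coe.1 his)]; exact hi
      simp [X, this]
  have hint : ∀ i, ∫⁻ x, X i x ∂(normalLaw (a i)) =
      (normalLaw (a i)).map (fun s => s + (Pi.single k t : ℕ → ℝ) i) (A' i) := by
    intro i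
    rw [lintegral_indicator (hA' i)]
    by_cases hik : i = k
    · subst hik
      rw [Pi.single_eq_same, normalLaw_map_add hk, withDensity_apply _ (hA' i)]
      simp [hρ]
    · simp [hik]
  rw [withDensity_apply _ hbox, ← lintegral_indicator hbox]
  refine (lintegral_congr hprod).trans ?_
  refine (lintegral_prod_eq_prod_lintegral_of_indepFun (insert k s)
    (fun i (x : ℕ → ℝ) => X i (x i)) (iIndepFun_infinitePi (P := fun i => normalLaw (a i)) hX)
    (fun i => (hX i).comp (measurable_pi_apply i))).trans ?_
  have hone : ∀ i, ∫⁻ x : ℕ → ℝ, X i (x i) ∂(Measure.infinitePi fun i => normalLaw (a i)) =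
      (normalLaw (a i)).map (fun s => s + (Pi.single k t : ℕ → ℝ) i) (A' i) := fun i =>
    ((measurePreserving_eval_infinitePi (fun i => normalLaw (a i)) i).lintegral_comp
      (hX i)).trans (hint i)
  simp only [hone]
  have hs : ∀ i ∈ s, A' i = A i := fun i hi => if_pos hi
  by_cases hks : k ∈ s
  · rw [Finset.insert_eq_of_mem hks]
    exact Finset.prod_congr rfl fun i hi => by rw [hs i hi]
  · rw [Finset.prod_insert hks]
    have : A' k = Set.univ := if_neg hks
    rw [this, measure_univ, one_mul]
    exact Finset.prod_congr rfl fun i hi => by rw [hs i hi]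

theorem coe_add_smul_e (x : L2) (k : ℕ) (t : ℝ) :
    ((x + t • e k : L2) : ℕ → ℝ) = (x : ℕ → ℝ) + Pi.single k t := by
  funext j
  change x j + t * (e k : ℕ → ℝ) j = x j + (Pi.single k t : ℕ → ℝ) j
  rw [e_apply, Pi.single_apply]
  simp [eq_comm]

/-- The Cameron–Martin formula for translations along a coordinate axis. -/
theorem P_map_add {a : ℕ → ℝ} {k : ℕ} (hk : 0 < a k) (t : ℝ) :
    (P a).map (fun x => x + t • e k) =
      (P a).withDensity fun x => ENNReal.ofReal (shiftDensity (a k) t (x k)) := by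
  ext B hB
  have hc : Measurable fun x : L2 => x + t • e k := by fun_prop
  set j : L2 → ℕ → ℝ := fun x => (x : ℕ → ℝ)
  have hjB : MeasurableSet (j '' B) := measurableEmbedding_coe.measurableSet_image.2 hB
  have hpre : j '' ((fun x => x + t • e k) ⁻¹' B) =
      (fun x : ℕ → ℝ => x + Pi.single k t) ⁻¹' (j '' B) := by
    ext y
    constructor
    · rintro ⟨x, hx, rfl⟩
      exact ⟨_, hx, coe_add_smul_e x k t⟩
    · rintro ⟨z, hz, hzy⟩
      have h1 : j (z + (-t) • e k) = y := by
        simp only [j, coe_add_smul_e] at hzy ⊢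
        rw [hzy, add_assoc, ← Pi.single_add, add_neg_cancel, Pi.single_zero, add_zero]
      refine ⟨z + (-t) • e k, ?_, h1⟩
      simpa [add_assoc, ← add_smul] using hz
  rw [Measure.map_apply hc hB, withDensity_apply _ hB, P_eq,
    measurableEmbedding_coe.comap_apply, hpre,
    ← Measure.map_apply (by fun_prop) hjB, infinitePi_map_add hk, withDensity_apply _ hjB,
    ← P_eq]
  have hm : Measurable fun x : ℕ → ℝ => ENNReal.ofReal (shiftDensity (a k) t (x k)) :=
    ((continuous_shiftDensity _ _).measurable.comp (measurable_pi_apply k)).ennreal_ofReal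
  have h1 := setLIntegral_map (μ := P a) hjB hm measurableEmbedding_coe.measurable
  rw [map_P, Measure.restrict_restrict hjB, Set.inter_eq_left.2 (Set.image_subset_range _ _)] at h1
  rw [h1, Set.preimage_image_eq _ measurableEmbedding_coe.injective]

theorem measurableEmbedding_add (v : L2) : MeasurableEmbedding fun x : L2 => x + v :=
  (MeasurableEquiv.addRight v).measurableEmbedding

theorem lintegral_add_smul_e {a : ℕ → ℝ} {k : ℕ} (hk : 0 < a k) (t : ℝ) (H : L2 → ENNReal) :
    ∫⁻ x, H (x + t • e k) ∂(P a) =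
      ∫⁻ x, ENNReal.ofReal (shiftDensity (a k) t (x k)) * H x ∂(P a) := by
  rw [← (measurableEmbedding_add _).lintegral_map, P_map_add hk,
    lintegral_withDensity_eq_lintegral_mul_non_measurable]
  · rfl
  · exact ((continuous_shiftDensity _ _).measurable.comp (measurable_coord k)).ennreal_ofReal
  · exact Eventually.of_forall fun x => ENNReal.ofReal_lt_top

theorem integral_add_smul_e {a : ℕ → ℝ} {k : ℕ} (hk : 0 < a k) (t : ℝ) (H : L2 → ℝ) :
    ∫ x, H (x + t • e k) ∂(P a) = ∫ x, shiftDensity (a k) t (x k) * H x ∂(P a) := by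
  rw [← (measurableEmbedding_add _).integral_map, P_map_add hk,
    integral_withDensity_eq_integral_toReal_smul]
  · simp only [ENNReal.toReal_ofReal (shiftDensity_pos _ _ _).le, smul_eq_mul]
  · exact ((continuous_shiftDensity _ _).measurable.comp (measurable_coord k)).ennreal_ofReal
  · exact Eventually.of_forall fun x => ENNReal.ofReal_lt_top

theorem shiftDensity_le {c : ℝ} {t s T R : ℝ} (ht : |t| ≤ T) (hs : |s| ≤ R) :
    shiftDensity c t s ≤ Real.exp (T * R / c ^ 2) := by
  refine Real.exp_le_exp.2 ?_
  have h1 : t * s ≤ T * R := by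
    refine (le_abs_self _).trans ?_
    rw [abs_mul]
    exact mul_le_mul ht hs (abs_nonneg _) ((abs_nonneg _).trans ht)
  have h2 : t * s / c ^ 2 ≤ T * R / c ^ 2 := by gcongr
  have h3 : 0 ≤ t ^ 2 / (2 * c ^ 2) := by positivity
  linarith

theorem hasDerivAt_shiftDensity (c t s : ℝ) :
    HasDerivAt (fun t => shiftDensity c t s) ((s - t) / c ^ 2 * shiftDensity c t s) t := by
  have h1 : HasDerivAt (fun t => t * s / c ^ 2 - t ^ 2 / (2 * c ^ 2)) ((s - t) / c ^ 2) t := by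
    have := (((hasDerivAt_id t).mul_const s).div_const (c ^ 2)).sub
      (((hasDerivAt_id t).pow 2).div_const (2 * c ^ 2))
    refine this.congr_deriv ?_
    by_cases hc : c = 0
    · simp [hc]
    · simp only [id, Nat.cast_ofNat]; field_simp; norm_num
  exact h1.exp.congr_deriv (mul_comm _ _)

/-- Gaussian integration by parts, by differentiating the Cameron–Martin formula. -/
theorem integral_pd_eq {a : ℕ → ℝ} {k : ℕ} (hk : 0 < a k) {H : L2 → ℝ} (hH : IsCSb Set.univ H)
    {R : ℝ} (hR : ∀ x, H x ≠ 0 → ‖x‖ < R) :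
    ∫ x, pd k H x ∂(P a) = ∫ x, x k / a k ^ 2 * H x ∂(P a) := by
  have hmeas : ∀ {u : L2 → ℝ}, IsCSb Set.univ u → Measurable u := fun {u} hu => by
    have := hu.tame.meas
    exact this.comp (measurable_id.subtype_mk (h := fun x => Set.mem_univ x))
  have hm := hmeas hH
  have hmd := hmeas (hH.pd k)
  obtain ⟨C, hC⟩ := hH.tame.bdd
  obtain ⟨D, hD⟩ := (hH.pd k).tame.bdd
  have hsh : ∀ t : ℝ, Measurable fun x : L2 => x + t • e k := fun t =>
    (measurableEmbedding_add _).measurable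
  have h1 := (hasDerivAt_integral_of_dominated_loc_of_deriv_le (μ := P a) (𝕜 := ℝ) (x₀ := 0)
    (F := fun t x => H (x + t • e k)) (F' := fun t x => pd k H (x + t • e k)) (bound := fun _ => D)
    (s := Set.univ) univ_mem
    (Eventually.of_forall fun t => (hm.comp (hsh t)).aestronglyMeasurable)
    (Integrable.of_bound (hm.comp (hsh 0)).aestronglyMeasurable C
      (Eventually.of_forall fun x => hC _ trivial))
    (hmd.comp (hsh 0)).aestronglyMeasurable
    (Eventually.of_forall fun x t _ => hD _ trivial) (integrable_const _)
    (Eventually.of_forall fun x t _ => (hH.tame.hasPd k _ trivial).hasDerivAt)).2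
  have hmr : ∀ t : ℝ, Measurable fun x : L2 => shiftDensity (a k) t (x k) := fun t =>
    (continuous_shiftDensity _ _).measurable.comp (measurable_coord k)
  have hk' : ∀ x : L2, |x k| ≤ ‖x‖ := fun x => lp.norm_apply_le_norm (by norm_num) x k
  have hR' : ∀ x, H x ≠ 0 → |x k| ≤ R := fun x hx => (hk' x).trans (hR x hx).le
  have hb : ∀ x, ∀ t ∈ Metric.ball (0 : ℝ) 1,
      ‖(x k - t) / a k ^ 2 * shiftDensity (a k) t (x k) * H x‖ ≤
        (|R| + 1) / a k ^ 2 * Real.exp (1 * |R| / a k ^ 2) * C := by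
    intro x t ht
    have hC0 : 0 ≤ C := (abs_nonneg _).trans (hC 0 trivial)
    by_cases hx : H x = 0
    · rw [hx, mul_zero, norm_zero]; positivity
    · have h2 := (hR' x hx).trans (le_abs_self R)
      have ht' : |t| ≤ 1 := by simpa using (Metric.mem_ball.1 ht).le
      rw [norm_mul, norm_mul, norm_div, Real.norm_eq_abs, Real.norm_eq_abs, Real.norm_eq_abs,
        Real.norm_eq_abs, abs_of_pos (shiftDensity_pos _ _ _), abs_of_nonneg (sq_nonneg (a k))]
      have h3 : |x k - t| ≤ |R| + 1 := (abs_sub _ _).trans (add_le_add h2 ht')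
      have h4 := shiftDensity_le (c := a k) ht' h2
      have h5 := hC x trivial
      have h6 := (shiftDensity_pos (a k) t (x k)).le
      gcongr
  have h2 := (hasDerivAt_integral_of_dominated_loc_of_deriv_le (μ := P a) (𝕜 := ℝ) (x₀ := 0)
    (F := fun t x => shiftDensity (a k) t (x k) * H x)
    (F' := fun t x => (x k - t) / a k ^ 2 * shiftDensity (a k) t (x k) * H x)
    (bound := fun _ => (|R| + 1) / a k ^ 2 * Real.exp (1 * |R| / a k ^ 2) * C)
    (s := Metric.ball 0 1) (Metric.ball_mem_nhds _ one_pos)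
    (Eventually.of_forall fun t => ((hmr t).mul hm).aestronglyMeasurable)
    (Integrable.of_bound ((hmr 0).mul hm).aestronglyMeasurable C
      (Eventually.of_forall fun x => by simpa [shiftDensity] using hC x trivial))
    (((((measurable_coord k).sub_const _).div_const _).mul (hmr 0)).mul hm).aestronglyMeasurable
    (Eventually.of_forall hb) (integrable_const _)
    (Eventually.of_forall fun x t _ => (hasDerivAt_shiftDensity _ _ _).mul_const _)).2
  simp only [integral_add_smul_e hk] at h1
  have h3 := h1.unique h2
  simpa [shiftDensity] using h3

/-! ### Uniqueness of characteristic functions -/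

theorem continuous_integral_cos (a : ℕ → ℝ) {u : L2 → ℝ} (hu : Integrable u (P a)) (c : ℝ) :
    Continuous fun l : L2 => ∫ x, u x * Real.cos (inner ℝ l x + c) ∂(P a) := by
  refine continuous_of_dominated (bound := fun x => ‖u x‖) (fun l => ?_) (fun l => ?_) hu.norm ?_
  · exact hu.1.mul (by fun_prop : Continuous fun x : L2 =>
      Real.cos (inner ℝ l x + c)).aestronglyMeasurable
  · refine Eventually.of_forall fun x => ?_
    rw [norm_mul]
    exact mul_le_of_le_one_right (norm_nonneg _) (Real.abs_cos_le_one _)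
  · exact Eventually.of_forall fun x => by fun_prop

/-- An integrable function is determined by its integrals against the trigonometric functions
of finitely many coordinates. -/
theorem ae_eq_zero_of_integral_cos_eq_zero (a : ℕ → ℝ) {u : L2 → ℝ} (hu : Integrable u (P a))
    (h : ∀ l : L2, (∃ N : ℕ, ∀ i ≥ N, l i = 0) → ∀ c : ℝ,
      ∫ x, u x * Real.cos (inner ℝ l x + c) ∂(P a) = 0) : u =ᵐ[P a] 0 := by
  have hall : ∀ (l : L2) (c : ℝ), ∫ x, u x * Real.cos (inner ℝ l x + c) ∂(P a) = 0 := by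
    intro l c
    have h1 := ((continuous_integral_cos a hu c).tendsto l).comp (tendsto_truncate l)
    refine tendsto_nhds_unique h1 ?_
    refine tendsto_const_nhds.congr fun n => (h _ ⟨n, fun i hi => ?_⟩ c).symm
    rw [truncate_apply, if_neg (not_lt.2 hi)]
  have hp : Integrable (fun x => ENNReal.toReal (ENNReal.ofReal (u x))) (P a) := by
    simpa [ENNReal.toReal_ofReal'] using hu.pos_part
  have hn : Integrable (fun x => ENNReal.toReal (ENNReal.ofReal (-u x))) (P a) := by
    simpa [ENNReal.toReal_ofReal'] using hu.neg_part
  have hfp : ∫⁻ x, ENNReal.ofReal (u x) ∂(P a) ≠ ⊤ := hu.lintegral_lt_top.ne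
  have hfn : ∫⁻ x, ENNReal.ofReal (-u x) ∂(P a) ≠ ⊤ := hu.neg.lintegral_lt_top.ne
  have := isFiniteMeasure_withDensity hfp
  have := isFiniteMeasure_withDensity hfn
  have hmp : AEMeasurable (fun x => ENNReal.ofReal (u x)) (P a) := hu.1.aemeasurable.ennreal_ofReal
  have hmn : AEMeasurable (fun x => ENNReal.ofReal (-u x)) (P a) :=
    hu.1.aemeasurable.neg.ennreal_ofReal
  have key : (P a).withDensity (fun x => ENNReal.ofReal (u x)) =
      (P a).withDensity (fun x => ENNReal.ofReal (-u x)) := by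
    refine Measure.ext_of_charFun (funext fun l => ?_)
    rw [charFun_apply, charFun_apply,
      integral_withDensity_eq_integral_toReal_smul₀ hmp
        (Eventually.of_forall fun x => ENNReal.ofReal_lt_top),
      integral_withDensity_eq_integral_toReal_smul₀ hmn
        (Eventually.of_forall fun x => ENNReal.ofReal_lt_top), ← sub_eq_zero]
    have hc : Continuous fun x : L2 => Complex.exp ((inner ℝ x l : ℝ) * Complex.I) := by fun_prop
    have hnorm : ∀ x : L2, ‖Complex.exp ((inner ℝ x l : ℝ) * Complex.I)‖ ≤ 1 := fun x => by
      rw [Complex.norm_exp_ofReal_mul_I]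
    have hip : Integrable (fun x => (ENNReal.ofReal (u x)).toReal •
        Complex.exp ((inner ℝ x l : ℝ) * Complex.I)) (P a) :=
      hp.smul_bdd 1 hc.aestronglyMeasurable (Eventually.of_forall hnorm)
    have hin : Integrable (fun x => (ENNReal.ofReal (-u x)).toReal •
        Complex.exp ((inner ℝ x l : ℝ) * Complex.I)) (P a) :=
      hn.smul_bdd 1 hc.aestronglyMeasurable (Eventually.of_forall hnorm)
    rw [← integral_sub hip hin]
    -- The real part is the case of phase `0`, the imaginary part that of phase `-π / 2`.
    have hpt : ∀ x : L2, (ENNReal.ofReal (u x)).toReal •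
        Complex.exp ((inner ℝ x l : ℝ) * Complex.I) - (ENNReal.ofReal (-u x)).toReal •
        Complex.exp ((inner ℝ x l : ℝ) * Complex.I) =
        ((u x * Real.cos (inner ℝ l x + 0) : ℝ) : ℂ) +
          ((u x * Real.cos (inner ℝ l x + -(Real.pi / 2)) : ℝ) : ℂ) * Complex.I := by
      intro x
      rw [← sub_smul, ENNReal.toReal_ofReal', ENNReal.toReal_ofReal',
        max_comm (u x), max_comm (-u x)]
      have h1 : max 0 (u x) - max 0 (-u x) = u x := by
        rcases le_total 0 (u x) with h | h
        · rw [max_eq_right h, max_eq_left (by linarith)]; ring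
        · rw [max_eq_left h, max_eq_right (by linarith)]; ring
      rw [h1, Complex.exp_mul_I, add_zero, ← sub_eq_add_neg, Real.cos_sub_pi_div_two,
        real_inner_comm]
      push_cast
      rw [Complex.real_smul]
      ring
    simp only [hpt]
    have hi : ∀ c : ℝ, Integrable (fun x => u x * Real.cos (inner ℝ l x + c)) (P a) := fun c =>
      hu.mul_bdd (c := 1) (by fun_prop : Continuous fun x : L2 =>
        Real.cos (inner ℝ l x + c)).aestronglyMeasurable
        (Eventually.of_forall fun x => Real.abs_cos_le_one _)
    rw [integral_add (hi 0).ofReal ((hi _).ofReal.mul_const _), integral_mul_const,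
      integral_complex_ofReal, integral_complex_ofReal, hall, hall]
    simp
  have hae := (withDensity_eq_iff hmp hmn hfp).1 key
  filter_upwards [hae] with x hx
  change u x = 0
  rcases le_total 0 (u x) with h | h
  · rw [ENNReal.ofReal_of_nonpos (neg_nonpos.2 h), ENNReal.ofReal_eq_zero] at hx
    exact le_antisymm hx h
  · rw [ENNReal.ofReal_of_nonpos h, eq_comm, ENNReal.ofReal_eq_zero] at hx
    exact le_antisymm h (by linarith)

/-! ### The measure space carrying a function together with its gradient -/

theorem eLpNorm_two_sq {α : Type*} [MeasurableSpace α] (μ : Measure α) (f : α → ℝ) :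
    eLpNorm f 2 μ ^ 2 = ∫⁻ x, ‖f x‖ₑ ^ 2 ∂μ := by
  rw [eLpNorm_eq_lintegral_rpow_enorm_toReal two_ne_zero ENNReal.ofNat_ne_top, ← ENNReal.rpow_two,
    ← ENNReal.rpow_mul]
  simp

/-- Dominated convergence in `L²`. -/
theorem tendsto_eLpNorm_two_of_dominated {α : Type*} [MeasurableSpace α] {μ : Measure α}
    {F : ℕ → α → ℝ} {f g : α → ℝ} (hF : ∀ n, AEStronglyMeasurable (F n) μ)
    (hf : AEStronglyMeasurable f μ) (hg : MemLp g 2 μ)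
    (hb : ∀ n, ∀ᵐ x ∂μ, |F n x - f x| ≤ g x)
    (hlim : ∀ᵐ x ∂μ, Tendsto (fun n => F n x) atTop (𝓝 (f x))) :
    Tendsto (fun n => eLpNorm (fun x => F n x - f x) 2 μ) atTop (𝓝 0) := by
  have h1 : Tendsto (fun n => ∫⁻ x, ‖F n x - f x‖ₑ ^ 2 ∂μ) atTop (𝓝 (∫⁻ _, 0 ∂μ)) := by
    refine tendsto_lintegral_of_dominated_convergence' (fun x => ‖g x‖ₑ ^ 2)
      (fun n => (((hF n).sub hf).enorm.pow_const 2)) (fun n => ?_) ?_ ?_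
    · filter_upwards [hb n] with x hx
      gcongr
      rw [Real.enorm_eq_ofReal_abs, Real.enorm_eq_ofReal_abs]
      exact ENNReal.ofReal_le_ofReal (hx.trans (le_abs_self _))
    · rw [← eLpNorm_two_sq]
      exact (ENNReal.pow_lt_top hg.2).ne
    · filter_upwards [hlim] with x hx
      have h2 : Tendsto (fun n => F n x - f x) atTop (𝓝 0) := by simpa using hx.sub_const (f x)
      have h3 := ENNReal.Tendsto.pow (n := 2) h2.enorm
      simpa using h3
  rw [lintegral_zero] at h1
  simp only [← eLpNorm_two_sq] at h1
  have h2 := (ENNReal.continuous_rpow_const (y := 1 / 2)).tendsto 0 |>.comp h1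
  rw [ENNReal.zero_rpow_of_pos (by norm_num)] at h2
  refine h2.congr fun n => ?_
  simp only [Function.comp, ← ENNReal.rpow_two, ← ENNReal.rpow_mul]
  norm_num

/-- The weights `1, a₀², a₁², …` of a function and of its partial derivatives in the norm of
`W^{1,2}`. -/
def wt (a : ℕ → ℝ) : ℕ → ENNReal
  | 0 => 1
  | i + 1 => ENNReal.ofReal (a i ^ 2)

/-- The measure on `ℕ × ℓ²` whose `L²`-norm is the norm of `W^{1,2}`, when a function `f` with
partial derivatives `g₀, g₁, …` is regarded as the function on `ℕ × ℓ²` with slices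
`f, g₀, g₁, …`. -/
def M (a : ℕ → ℝ) : Measure (ℕ × L2) :=
  Measure.sum fun n => wt a n • (P a).map (Prod.mk n)

theorem measurableEmbedding_mk (n : ℕ) : MeasurableEmbedding (Prod.mk n : L2 → ℕ × L2) :=
  MeasurableEmbedding.of_measurable_inverse (g := Prod.snd) measurable_prodMk_left
    (by
      have : Set.range (Prod.mk n : L2 → ℕ × L2) = Prod.fst ⁻¹' {n} := by
        ext ⟨m, x⟩; simp [eq_comm]
      rw [this]
      exact measurable_fst (measurableSet_singleton n)) measurable_snd (fun _ => rfl)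

theorem wt_ne_top (a : ℕ → ℝ) (n : ℕ) : wt a n ≠ ⊤ := by
  cases n <;> simp [wt]

theorem wt_ne_zero {a : ℕ → ℝ} (ha : ∀ i, 0 < a i) (n : ℕ) : wt a n ≠ 0 := by
  cases n with
  | zero => simp [wt]
  | succ n => have := ha n; simp [wt]; positivity

theorem lintegral_M (a : ℕ → ℝ) (H : ℕ × L2 → ENNReal) :
    ∫⁻ p, H p ∂(M a) = ∑' n, wt a n * ∫⁻ x, H (n, x) ∂(P a) := by
  rw [M, lintegral_sum_measure]
  refine tsum_congr fun n => ?_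
  rw [lintegral_smul_measure, (measurableEmbedding_mk n).lintegral_map, smul_eq_mul]

theorem ae_M_iff {a : ℕ → ℝ} (ha : ∀ i, 0 < a i) {Q : ℕ × L2 → Prop} :
    (∀ᵐ p ∂(M a), Q p) ↔ ∀ n, ∀ᵐ x ∂(P a), Q (n, x) := by
  rw [M, Measure.ae_sum_iff]
  refine forall_congr' fun n => ?_
  rw [Measure.ae_ennreal_smul_measure_iff (wt_ne_zero ha n), (measurableEmbedding_mk n).ae_map_iff]

theorem aestronglyMeasurable_M {a : ℕ → ℝ} {w : ℕ × L2 → ℝ}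
    (h : ∀ n, AEStronglyMeasurable (fun x => w (n, x)) (P a)) : AEStronglyMeasurable w (M a) := by
  rw [M, aestronglyMeasurable_sum_measure_iff]
  intro n
  exact ((measurableEmbedding_mk n).aestronglyMeasurable_map_iff.2 (h n)).smul_measure _

theorem map_absolutelyContinuous_M {a : ℕ → ℝ} (ha : ∀ i, 0 < a i) (n : ℕ) :
    (P a).map (Prod.mk n) ≪ M a := by
  refine Measure.AbsolutelyContinuous.trans ?_ (Measure.le_sum _ n).absolutelyContinuous
  intro s hs
  rw [Measure.smul_apply, smul_eq_mul, mul_eq_zero] at hs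
  exact hs.resolve_left (wt_ne_zero ha n)

theorem AEStronglyMeasurable.slice {a : ℕ → ℝ} (ha : ∀ i, 0 < a i) {w : ℕ × L2 → ℝ}
    (h : AEStronglyMeasurable w (M a)) (n : ℕ) : AEStronglyMeasurable (fun x => w (n, x)) (P a) :=
  (measurableEmbedding_mk n).aestronglyMeasurable_map_iff.1
    (h.mono_ac (map_absolutelyContinuous_M ha n))

theorem tsum_wt_ne_top {a : ℕ → ℝ} (ha : ∀ i, 0 < a i) (hs : Summable a) {c : ℕ → ℝ}
    (hc : ∃ C, ∀ i, a i * c (i + 1) ^ 2 ≤ C) :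
    ∑' n, wt a n * ENNReal.ofReal (c n ^ 2) ≠ ⊤ := by
  obtain ⟨C, hC⟩ := hc
  have h1 : Summable fun i => a i ^ 2 * c (i + 1) ^ 2 := by
    refine Summable.of_nonneg_of_le (fun i => by positivity) (fun i => ?_) (hs.mul_right C)
    rw [sq (a i), mul_assoc]
    exact mul_le_mul_of_nonneg_left (hC i) (ha i).le
  rw [tsum_eq_zero_add' ENNReal.summable]
  refine ENNReal.add_ne_top.2 ⟨by simp [wt], ?_⟩
  have h2 : ∀ i, wt a (i + 1) * ENNReal.ofReal (c (i + 1) ^ 2) =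
      ENNReal.ofReal (a i ^ 2 * c (i + 1) ^ 2) := fun i => by
    rw [wt, ENNReal.ofReal_mul (sq_nonneg _)]
  simp only [h2]
  rw [← ENNReal.ofReal_tsum_of_nonneg (fun i => by positivity) h1]
  exact ENNReal.ofReal_ne_top

/-- A function of product form on `ℕ × ℓ²` is square integrable if the growth of its first factor
is compensated by the weights. -/
theorem memLp_M_of_le {a : ℕ → ℝ} (ha : ∀ i, 0 < a i) (hs : Summable a) {c : ℕ → ℝ}
    (hc : ∃ C, ∀ i, a i * c (i + 1) ^ 2 ≤ C) {f : L2 → ℝ} (hf : MemLp f 2 (P a)) :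
    MemLp (fun p : ℕ × L2 => c p.1 * f p.2) 2 (M a) := by
  have hm : AEStronglyMeasurable (fun p : ℕ × L2 => c p.1 * f p.2) (M a) :=
    aestronglyMeasurable_M fun n => hf.1.const_mul (c n)
  refine ⟨hm, ?_⟩
  suffices h : eLpNorm (fun p : ℕ × L2 => c p.1 * f p.2) 2 (M a) ^ 2 ≠ ⊤ by
    rw [lt_top_iff_ne_top]
    rintro h'
    simp [h'] at h
  rw [eLpNorm_two_sq, lintegral_M]
  have h1 : ∀ n, ∫⁻ x, ‖c n * f x‖ₑ ^ 2 ∂(P a) =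
      ENNReal.ofReal (c n ^ 2) * eLpNorm f 2 (P a) ^ 2 := by
    intro n
    rw [eLpNorm_two_sq, ← lintegral_const_mul' _ _ ENNReal.ofReal_ne_top]
    refine lintegral_congr fun x => ?_
    rw [enorm_mul, mul_pow, Real.enorm_eq_ofReal_abs (c n), ← ENNReal.ofReal_pow (abs_nonneg _),
      sq_abs]
  simp only [h1, ← mul_assoc]
  rw [ENNReal.tsum_mul_right]
  exact ENNReal.mul_ne_top (tsum_wt_ne_top ha hs hc) (ENNReal.pow_lt_top hf.2).ne

theorem exists_le_of_summable {a : ℕ → ℝ} (hs : Summable a) : ∃ C, ∀ i, a i ≤ C := by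
  obtain ⟨C, hC⟩ := hs.tendsto_atTop_zero.bddAbove_range
  exact ⟨C, fun i => hC ⟨i, rfl⟩⟩

theorem memLp_M_snd {a : ℕ → ℝ} (ha : ∀ i, 0 < a i) (hs : Summable a) {f : L2 → ℝ}
    (hf : MemLp f 2 (P a)) : MemLp (fun p : ℕ × L2 => f p.2) 2 (M a) := by
  obtain ⟨C, hC⟩ := exists_le_of_summable hs
  simpa using memLp_M_of_le ha hs (c := fun _ => 1) ⟨C, by simpa using hC⟩ hf

theorem isFiniteMeasure_M {a : ℕ → ℝ} (ha : ∀ i, 0 < a i) (hs : Summable a) :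
    IsFiniteMeasure (M a) := by
  have h := memLp_M_snd ha hs (f := fun _ => 1) (memLp_const 1)
  rw [memLp_const_iff (by simp) (by simp)] at h
  exact ⟨h.resolve_left (by simp)⟩

theorem memLp_slice {a : ℕ → ℝ} (ha : ∀ i, 0 < a i) {w : ℕ × L2 → ℝ} (h : MemLp w 2 (M a))
    (n : ℕ) : MemLp (fun x => w (n, x)) 2 (P a) := by
  refine ⟨AEStronglyMeasurable.slice ha h.1 n, ?_⟩
  have h1 : eLpNorm w 2 (M a) ^ 2 < ⊤ := ENNReal.pow_lt_top h.2
  rw [eLpNorm_two_sq, lintegral_M] at h1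
  have h2 := ENNReal.lt_top_of_tsum_ne_top h1.ne n
  rw [← eLpNorm_two_sq (P a) fun x => w (n, x)] at h2
  by_contra h3
  rw [not_lt, top_le_iff] at h3
  rw [h3] at h2
  simp [ENNReal.mul_top (wt_ne_zero ha n)] at h2

theorem hasSum_integral_M {a : ℕ → ℝ} {H : ℕ × L2 → ℝ} (h : Integrable H (M a)) :
    HasSum (fun n => (wt a n).toReal * ∫ x, H (n, x) ∂(P a)) (∫ p, H p ∂(M a)) := by
  have h1 := hasSum_integral_measure h
  refine h1.congr_fun fun n => ?_
  rw [integral_smul_measure, (measurableEmbedding_mk n).integral_map, smul_eq_mul]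

theorem wt_succ_toReal (a : ℕ → ℝ) (i : ℕ) : (wt a (i + 1)).toReal = a i ^ 2 :=
  ENNReal.toReal_ofReal (sq_nonneg _)

/-! ### Weakly differentiable functions and their gradients -/

/-- Test functions on `ℓ²` whose support is uniformly included in `O`. -/
def IsTest (O : Set L2) (ψ : L2 → ℝ) : Prop := IsCF Set.univ ψ ∧ UnifIncl {x | ψ x ≠ 0} O

theorem IsTest.isCF {O : Set L2} {ψ : L2 → ℝ} (h : IsTest O ψ) : IsCF O ψ := by
  obtain ⟨h1, ⟨C, hC⟩, -⟩ := isCF_iff.1 h.1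
  exact isCF_iff.2 ⟨h1.mono (Set.subset_univ O), ⟨C, fun x _ => hC x trivial⟩,
    h.2.mono fun x hx => hx.2⟩

theorem IsCF.isTest {O : Set L2} (hO : IsOpen O) {φ : L2 → ℝ} (h : IsCF O φ) :
    IsTest O (O.indicator φ) := by
  refine ⟨h.indicator hO, (isCF_iff.1 h).2.2.mono fun x hx => ?_⟩
  have hxO : x ∈ O := Set.mem_of_indicator_ne_zero hx
  have hne : O.indicator φ x ≠ 0 := hx
  rw [Set.indicator_of_mem hxO] at hne
  exact ⟨hxO, hne⟩

theorem UnifIncl.mono_right {E O O' : Set L2} (h : UnifIncl E O) (hO : O ⊆ O') :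
    UnifIncl E O' := by
  obtain ⟨r, hr, R, hR, h1, h2⟩ := h
  exact ⟨r, hr, R, hR, h1.trans hO, h2⟩

theorem IsTest.mul {O : Set L2} {ψ β : L2 → ℝ} (h : IsTest O ψ) (hβ : BddSmooth β) :
    IsTest O fun x => β x * ψ x :=
  ⟨h.1.bddSmooth_mul isOpen_univ hβ, h.2.mono fun _ hx => right_ne_zero_of_mul hx⟩

theorem IsTest.mul_of_unifIncl {O O' : Set L2} {ψ β : L2 → ℝ} (h : IsTest O' ψ)
    (hβ : BddSmooth β) (hs : UnifIncl {x | β x ≠ 0} O) : IsTest O fun x => β x * ψ x :=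
  ⟨h.1.bddSmooth_mul isOpen_univ hβ, hs.mono fun _ hx => left_ne_zero_of_mul hx⟩

theorem BddSmooth.isTest {O : Set L2} {β : L2 → ℝ} (hβ : BddSmooth β)
    (hs : UnifIncl {x | β x ≠ 0} O) : IsTest O β :=
  ⟨hβ.isCF (hs.mono_right (Set.subset_univ _)), hs⟩

theorem IsCSb.measurable {u : L2 → ℝ} (hu : IsCSb Set.univ u) : Measurable u :=
  hu.tame.meas.comp (measurable_id.subtype_mk (h := fun x => Set.mem_univ x))

theorem IsCSb.exists_bound {u : L2 → ℝ} (hu : IsCSb Set.univ u) : ∃ C, ∀ x, |u x| ≤ C := by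
  obtain ⟨C, hC⟩ := hu.tame.bdd
  exact ⟨C, fun x => hC x trivial⟩

theorem IsTest.csb {O : Set L2} {ψ : L2 → ℝ} (h : IsTest O ψ) : IsCSb Set.univ ψ := h.1.csb

theorem IsTest.hasPd {O : Set L2} {ψ : L2 → ℝ} (h : IsTest O ψ) (i : ℕ) (x : L2) : HasPd i ψ x :=
  h.csb.tame.hasPd i x trivial

theorem IsTest.exists_radius {O : Set L2} {ψ : L2 → ℝ} (h : IsTest O ψ) :
    ∃ R > 0, ∀ x, R < ‖x‖ → ψ x = 0 ∧ ∀ i, pd i ψ x = 0 := by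
  obtain ⟨R, hR, hb⟩ := h.1.exists_bound
  have hz : ∀ x ∈ {x : L2 | R < ‖x‖}, ψ x = 0 := fun x hx => by
    by_contra hne
    exact absurd (hb x trivial hne) (not_lt.2 (le_of_lt hx))
  have ho : IsOpen {x : L2 | R < ‖x‖} := isOpen_lt continuous_const continuous_norm
  exact ⟨R, hR, fun x hx => ⟨hz x hx, fun i => pd_eq_zero_of_const ho hz hx i⟩⟩

theorem abs_coord_le (x : L2) (i : ℕ) : |x i| ≤ ‖x‖ := lp.norm_apply_le_norm (by norm_num) x i

theorem IsTest.measurable_pdStar {O : Set L2} {ψ : L2 → ℝ} (h : IsTest O ψ) (a : ℕ → ℝ) (i : ℕ) :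
    Measurable (pdStar a i ψ) :=
  (h.csb.pd i).measurable.neg.add (((measurable_coord i).div_const _).mul h.csb.measurable)

theorem IsTest.pdStar_bdd {O : Set L2} {ψ : L2 → ℝ} (h : IsTest O ψ) (a : ℕ → ℝ) (i : ℕ) :
    ∃ C, ∀ x, |pdStar a i ψ x| ≤ C := by
  obtain ⟨R, hR, hb⟩ := h.exists_radius
  obtain ⟨C, hC⟩ := h.csb.exists_bound
  obtain ⟨D, hD⟩ := (h.csb.pd i).exists_bound
  refine ⟨D + R / a i ^ 2 * C, fun x => ?_⟩
  refine (abs_add_le _ _).trans (add_le_add ((abs_neg _).trans_le (hD x)) ?_)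
  have hC0 := (abs_nonneg _).trans (hC x)
  rcases le_or_gt ‖x‖ R with hx | hx
  · rw [abs_mul, abs_div, abs_of_nonneg (sq_nonneg (a i))]
    have h1 := (abs_coord_le x i).trans hx
    have h2 := hC x
    gcongr
  · rw [(hb x hx).1, mul_zero, abs_zero]; positivity

theorem integrable_mul_bdd {a : ℕ → ℝ} {F u : L2 → ℝ} (hF : MemLp F 2 (P a)) (hu : Measurable u)
    (hb : ∃ C, ∀ x, |u x| ≤ C) : Integrable (fun x => F x * u x) (P a) := by
  obtain ⟨C, hC⟩ := hb
  exact (hF.integrable one_le_two).mul_bdd (c := C) hu.aestronglyMeasurable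
    (Eventually.of_forall hC)

/-- The function on `ℕ × ℓ²` with slices `0, D₀φ, D₁φ, …`. -/
def gradPart (φ : L2 → ℝ) (p : ℕ × L2) : ℝ :=
  match p.1 with
  | 0 => 0
  | i + 1 => pd i φ p.2

/-- The function on `ℕ × ℓ²` with slices `φ, D₀φ, D₁φ, …`. -/
def jet (φ : L2 → ℝ) (p : ℕ × L2) : ℝ :=
  match p.1 with
  | 0 => φ p.2
  | i + 1 => pd i φ p.2

/-- The product rule: if `w` consists of a function and its weak partial derivatives, this consists
of the product of that function with `β` and its weak partial derivatives. -/
def mulJet (β : L2 → ℝ) (w : ℕ × L2 → ℝ) (p : ℕ × L2) : ℝ :=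
  β p.2 * w p + gradPart β p * w (0, p.2)

/-- `w` consists of a function of class `W^{1,2}(O)` and its weak partial derivatives, all extended
by zero. -/
structure MemW (a : ℕ → ℝ) (O : Set L2) (w : ℕ × L2 → ℝ) : Prop where
  memLp : MemLp w 2 (M a)
  zero_off : ∀ x ∉ O, ∀ n, w (n, x) = 0
  weak : ∀ ψ, IsTest O ψ → ∀ i,
    ∫ x, w (i + 1, x) * ψ x ∂(P a) = ∫ x, w (0, x) * pdStar a i ψ x ∂(P a)

theorem BddSmooth.aestronglyMeasurable_gradPart {β : L2 → ℝ} (hβ : BddSmooth β) (a : ℕ → ℝ) :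
    AEStronglyMeasurable (gradPart β) (M a) := by
  refine aestronglyMeasurable_M fun n => ?_
  cases n with
  | zero => exact aestronglyMeasurable_const
  | succ i => exact (hβ.pd i).continuous.aestronglyMeasurable

theorem BddSmooth.gradPart_bdd {β : L2 → ℝ} (hβ : BddSmooth β) :
    ∃ C, ∀ p, |gradPart β p| ≤ C := by
  obtain ⟨C, hC⟩ := hβ.pd_bdd
  refine ⟨C, fun ⟨n, x⟩ => ?_⟩
  cases n with
  | zero => simpa [gradPart] using (abs_nonneg _).trans (hC 0 0)
  | succ i => exact hC i x

theorem BddSmooth.memLp_jet {φ : L2 → ℝ} (hφ : BddSmooth φ) {a : ℕ → ℝ} (ha : ∀ i, 0 < a i)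
    (hs : Summable a) : MemLp (jet φ) 2 (M a) := by
  have := isFiniteMeasure_M ha hs
  obtain ⟨C, hC⟩ := hφ.gradPart_bdd
  obtain ⟨D, hD⟩ := hφ.bdd
  refine MemLp.of_bound (aestronglyMeasurable_M fun n => ?_) (max C D) (Eventually.of_forall ?_)
  · cases n with
    | zero => exact hφ.continuous.aestronglyMeasurable
    | succ i => exact (hφ.pd i).continuous.aestronglyMeasurable
  · rintro ⟨n, x⟩
    cases n with
    | zero => exact (hD x).trans (le_max_right _ _)
    | succ i => exact (hC (i + 1, x)).trans (le_max_left _ _)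

theorem BddSmooth.memLp_mulJet {β : L2 → ℝ} (hβ : BddSmooth β) {a : ℕ → ℝ} (ha : ∀ i, 0 < a i)
    (hs : Summable a) {w : ℕ × L2 → ℝ} (hw : MemLp w 2 (M a)) : MemLp (mulJet β w) 2 (M a) := by
  obtain ⟨C, hC⟩ := hβ.gradPart_bdd
  obtain ⟨D, hD⟩ := hβ.bdd
  have h0 := memLp_M_snd ha hs (memLp_slice ha hw 0)
  refine MemLp.add (MemLp.of_le_mul (c := D) hw ?_ (Eventually.of_forall fun p => ?_))
    (MemLp.of_le_mul (c := C) h0 ?_ (Eventually.of_forall fun p => ?_))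
  · exact (hβ.continuous.comp continuous_snd).aestronglyMeasurable.mul hw.1
  · rw [norm_mul]; gcongr; exact hD _
  · exact (hβ.aestronglyMeasurable_gradPart a).mul h0.1
  · rw [norm_mul]; gcongr; exact hC _

/-- Multiplication by a smooth function `β` maps `W^{1,2}(O)` to `W^{1,2}(O')` as soon as it maps
test functions on `O'` to test functions on `O`. -/
theorem MemW.mulJet_of {a : ℕ → ℝ} (ha : ∀ i, 0 < a i) (hs : Summable a) {O O' : Set L2}
    (hOO' : O ⊆ O') {w : ℕ × L2 → ℝ} (hw : MemW a O w) {β : L2 → ℝ} (hβ : BddSmooth β)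
    (h : ∀ ψ, IsTest O' ψ → IsTest O fun x => β x * ψ x) : MemW a O' (mulJet β w) := by
  refine ⟨hβ.memLp_mulJet ha hs hw.memLp, fun x hx n => ?_, fun ψ hψ i => ?_⟩
  · have hx' : x ∉ O := fun hxO => hx (hOO' hxO)
    simp only [mulJet, hw.zero_off x hx', mul_zero, add_zero]
  · have h1 := hw.weak _ (h ψ hψ) i
    have hF := memLp_slice ha hw.memLp 0
    have hG := memLp_slice ha hw.memLp (i + 1)
    have hβψ := h ψ hψ
    have e1 : Integrable (fun x => w (i + 1, x) * (β x * ψ x)) (P a) :=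
      integrable_mul_bdd hG hβψ.csb.measurable hβψ.csb.exists_bound
    have hc : IsTest O' fun x => pd i β x * ψ x := hψ.mul (hβ.pd i)
    have e2 : Integrable (fun x => w (0, x) * (pd i β x * ψ x)) (P a) :=
      integrable_mul_bdd hF hc.csb.measurable hc.csb.exists_bound
    have e3 : Integrable (fun x => w (0, x) * pdStar a i (fun y => β y * ψ y) x) (P a) :=
      integrable_mul_bdd hF (hβψ.measurable_pdStar a i) (hβψ.pdStar_bdd a i)
    calc ∫ x, mulJet β w (i + 1, x) * ψ x ∂(P a)
        = ∫ x, w (i + 1, x) * (β x * ψ x) + w (0, x) * (pd i β x * ψ x) ∂(P a) := by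
          refine integral_congr_ae (Eventually.of_forall fun x => ?_)
          simp only [mulJet, gradPart]; ring
      _ = ∫ x, w (0, x) * pdStar a i (fun y => β y * ψ y) x + w (0, x) * (pd i β x * ψ x)
            ∂(P a) := by
          rw [integral_add e1 e2, integral_add e3 e2, h1]
      _ = ∫ x, mulJet β w (0, x) * pdStar a i ψ x ∂(P a) := by
          refine integral_congr_ae (Eventually.of_forall fun x => ?_)
          simp only [mulJet, gradPart, pdStar_mul (hβ.hasPd i x) (hψ.hasPd i x)]; ring

theorem MemW.mulJet {a : ℕ → ℝ} (ha : ∀ i, 0 < a i) (hs : Summable a) {O : Set L2}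
    {w : ℕ × L2 → ℝ} (hw : MemW a O w) {β : L2 → ℝ} (hβ : BddSmooth β) :
    MemW a O (mulJet β w) :=
  hw.mulJet_of ha hs subset_rfl hβ fun _ hψ => hψ.mul hβ

/-- Extension by zero. -/
theorem MemW.mulJet_univ {a : ℕ → ℝ} (ha : ∀ i, 0 < a i) (hs : Summable a) {O : Set L2}
    {w : ℕ × L2 → ℝ} (hw : MemW a O w) {β : L2 → ℝ} (hβ : BddSmooth β)
    (hsupp : UnifIncl {x | β x ≠ 0} O) : MemW a Set.univ (GaussSobolev.mulJet β w) :=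
  hw.mulJet_of ha hs (Set.subset_univ O) hβ fun _ hψ => hψ.mul_of_unifIncl hβ hsupp

/-- Smooth functions satisfy the integration by parts formula defining weak derivatives. -/
theorem BddSmooth.weak {a : ℕ → ℝ} (ha : ∀ i, 0 < a i) {O : Set L2} {φ ψ : L2 → ℝ}
    (hφ : BddSmooth φ) (hψ : IsTest O ψ) (i : ℕ) :
    ∫ x, GaussSobolev.pd i φ x * ψ x ∂(P a) = ∫ x, φ x * pdStar a i ψ x ∂(P a) := by
  have hH := hψ.mul hφ
  obtain ⟨R, hR, hb⟩ := hH.1.exists_bound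
  have h1 := integral_pd_eq (ha i) hH.csb (R := R) fun x hx => hb x trivial hx
  have hφL : MemLp φ 2 (P a) := by
    obtain ⟨C, hC⟩ := hφ.bdd
    exact MemLp.of_bound hφ.continuous.aestronglyMeasurable C (Eventually.of_forall hC)
  have e1 := integrable_mul_bdd hφL (hψ.measurable_pdStar a i) (hψ.pdStar_bdd a i)
  have hc := hψ.mul (hφ.pd i)
  have e2 : Integrable (fun x => GaussSobolev.pd i φ x * ψ x) (P a) := by
    obtain ⟨C, hC⟩ := hc.csb.exists_bound
    exact Integrable.of_bound hc.csb.measurable.aestronglyMeasurable C (Eventually.of_forall hC)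
  have e3 : Integrable (fun x => GaussSobolev.pd i (fun y => φ y * ψ y) x) (P a) := by
    obtain ⟨C, hC⟩ := (hH.csb.pd i).exists_bound
    exact Integrable.of_bound (hH.csb.pd i).measurable.aestronglyMeasurable C
      (Eventually.of_forall hC)
  have h2 : ∀ x, φ x * pdStar a i ψ x = x i / a i ^ 2 * (φ x * ψ x) -
      GaussSobolev.pd i (fun y => φ y * ψ y) x + GaussSobolev.pd i φ x * ψ x := by
    intro x
    rw [pd_mul (hφ.hasPd i x) (hψ.hasPd i x), pdStar]; ring
  have e4 : Integrable (fun x : L2 => x i / a i ^ 2 * (φ x * ψ x)) (P a) := by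
    refine ((e1.sub e2).add e3).congr (Eventually.of_forall fun x => ?_)
    simp only [Pi.add_apply, Pi.sub_apply, h2]; ring
  have e5 : Integrable (fun x : L2 => x i / a i ^ 2 * (φ x * ψ x) -
      GaussSobolev.pd i (fun y => φ y * ψ y) x) (P a) := e4.sub e3
  simp only [h2]
  rw [integral_add e5 e2, integral_sub e4 e3, h1, sub_self, zero_add]

/-! ### Translation of weakly differentiable functions -/

theorem IsTest.comp_add {O : Set L2} {ψ : L2 → ℝ} (h : IsTest O ψ) (v : L2) :
    IsTest ((· + v) ⁻¹' O) fun x => ψ (x + v) := by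
  refine ⟨by simpa using h.1.comp_add v, ?_⟩
  obtain ⟨r, hr, R, hR, h3, h4⟩ := h.2
  refine ⟨r, hr, R + ‖v‖, by positivity, ?_, ?_⟩
  · refine Set.iUnion₂_subset fun x hx y hy => ?_
    refine h3 (Set.mem_biUnion (x := x + v) hx ?_)
    simpa using hy
  · intro x hx
    have : ‖x + v‖ < R := by simpa using h4 (show x + v ∈ {x | ψ x ≠ 0} from hx)
    have h5 : ‖x‖ ≤ ‖x + v‖ + ‖v‖ := by simpa using norm_sub_le (x + v) v
    simp only [Metric.mem_ball, dist_zero_right]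
    linarith

/-- A smooth function with compact support on the line that agrees with the density of a
translated normal law on a given interval. -/
theorem exists_bddSmooth_eq_shiftDensity (c t : ℝ) {R : ℝ} (hR : 0 < R) :
    ∃ κ : ℝ → ℝ, BddSmooth κ ∧ ∀ s, |s| < R → κ s = shiftDensity c t s := by
  let b : ContDiffBump (0 : ℝ) := ⟨R, R + 1, hR, by linarith⟩
  refine ⟨fun s => shiftDensity c t s * b s, BddSmooth.of_hasCompactSupport ?_ ?_, fun s hs => ?_⟩
  · refine ContDiff.mul ?_ b.contDiff
    unfold shiftDensity
    fun_prop
  · exact b.hasCompactSupport.mul_left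
  · have : b s = 1 := b.one_of_mem_closedBall (by simpa using hs.le)
    simp only [this, mul_one]

theorem hasDerivAt_shiftDensity_right (c t s : ℝ) :
    HasDerivAt (shiftDensity c t) (t / c ^ 2 * shiftDensity c t s) s := by
  have h1 : HasDerivAt (fun s => t * s / c ^ 2 - t ^ 2 / (2 * c ^ 2)) (t / c ^ 2) s := by
    simpa using (((hasDerivAt_id s).const_mul t).div_const (c ^ 2)).sub_const (t ^ 2 / (2 * c ^ 2))
  exact h1.exp.congr_deriv (mul_comm _ _)

theorem add_smul_e_apply (x : L2) (i k : ℕ) (t : ℝ) :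
    (x + t • e i : L2) k = x k + if i = k then t else 0 := by
  change x k + t * (e i : ℕ → ℝ) k = _
  rw [e_apply]; simp

theorem pd_comp_coord {κ : ℝ → ℝ} {κ' : ℝ} (i k : ℕ) (x : L2) (h : HasDerivAt κ κ' (x k)) :
    pd i (fun y : L2 => κ (y k)) x = if i = k then κ' else 0 := by
  by_cases hik : i = k
  · subst hik
    simp only [pd, add_smul_e_apply, if_true]
    exact (HasDerivAt.comp_const_add (x i) 0 (by rwa [add_zero])).deriv
  · simp [pd, add_smul_e_apply, hik]

/-- The translation by `t` in the direction of the `k`-th unit vector. -/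
def shiftJet (k : ℕ) (t : ℝ) (w : ℕ × L2 → ℝ) (p : ℕ × L2) : ℝ := w (p.1, p.2 + t • e k)

theorem aestronglyMeasurable_shiftJet {a : ℕ → ℝ} (ha : ∀ i, 0 < a i) {k : ℕ} (t : ℝ)
    {w : ℕ × L2 → ℝ} (hw : AEStronglyMeasurable w (M a)) :
    AEStronglyMeasurable (shiftJet k t w) (M a) := by
  refine aestronglyMeasurable_M fun n => ?_
  have h1 := AEStronglyMeasurable.slice ha hw n
  refine h1.comp_quasiMeasurePreserving (f := fun x : L2 => x + t • e k)
    ⟨(measurableEmbedding_add _).measurable, ?_⟩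
  rw [P_map_add (ha k)]
  exact withDensity_absolutelyContinuous _ _

/-- Translations by bounded amounts are uniformly bounded on functions supported in a slab. -/
theorem eLpNorm_shiftJet_le {a : ℕ → ℝ} (ha : ∀ i, 0 < a i) {k : ℕ} {t T R : ℝ} (ht : |t| ≤ T)
    {w : ℕ × L2 → ℝ} (hR : ∀ n x, w (n, x) ≠ 0 → |x k| ≤ R) :
    eLpNorm (shiftJet k t w) 2 (M a) ≤
      ENNReal.ofReal (Real.exp (T * R / a k ^ 2)) ^ (1 / 2 : ℝ) * eLpNorm w 2 (M a) := by
  have h1 : eLpNorm (shiftJet k t w) 2 (M a) ^ 2 ≤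
      ENNReal.ofReal (Real.exp (T * R / a k ^ 2)) * eLpNorm w 2 (M a) ^ 2 := by
    rw [eLpNorm_two_sq, eLpNorm_two_sq, lintegral_M, lintegral_M, ← ENNReal.tsum_mul_left]
    refine ENNReal.tsum_le_tsum fun n => ?_
    rw [mul_left_comm]
    gcongr
    rw [← lintegral_const_mul' _ _ ENNReal.ofReal_ne_top]
    have h2 := lintegral_add_smul_e (ha k) t fun x => ‖w (n, x)‖ₑ ^ 2
    refine (le_of_eq h2).trans (lintegral_mono fun x => ?_)
    by_cases hx : w (n, x) = 0
    · simp [hx]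
    · beta_reduce
      gcongr
      exact shiftDensity_le ht (hR n x hx)
  have h3 := ENNReal.rpow_le_rpow h1 (by norm_num : (0 : ℝ) ≤ 1 / 2)
  rw [ENNReal.mul_rpow_of_nonneg _ _ (by norm_num), ← ENNReal.rpow_two, ← ENNReal.rpow_two,
    ← ENNReal.rpow_mul, ← ENNReal.rpow_mul] at h3
  norm_num at h3 ⊢
  exact h3

theorem memLp_shiftJet {a : ℕ → ℝ} (ha : ∀ i, 0 < a i) {k : ℕ} (t : ℝ) {R : ℝ}
    {w : ℕ × L2 → ℝ} (hw : MemLp w 2 (M a)) (hR : ∀ n x, w (n, x) ≠ 0 → |x k| ≤ R) :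
    MemLp (shiftJet k t w) 2 (M a) := by
  refine ⟨aestronglyMeasurable_shiftJet ha t hw.1, (eLpNorm_shiftJet_le ha le_rfl hR).trans_lt ?_⟩
  exact ENNReal.mul_lt_top (ENNReal.rpow_lt_top_of_nonneg (by norm_num) ENNReal.ofReal_ne_top) hw.2

/-- A translate of a weakly differentiable function is weakly differentiable. The density of the
translated Gaussian measure is absorbed into the test function. -/
theorem MemW.shiftJet {a : ℕ → ℝ} (ha : ∀ i, 0 < a i) {O : Set L2}
    {w : ℕ × L2 → ℝ} (hw : MemW a O w) {k : ℕ} (t : ℝ) {R : ℝ}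
    (hR : ∀ n x, w (n, x) ≠ 0 → |x k| ≤ R) :
    MemW a ((· + t • e k) ⁻¹' O) (shiftJet k t w) := by
  refine ⟨memLp_shiftJet ha t hw.memLp hR, fun x hx n => hw.zero_off _ hx n, fun ψ hψ i => ?_⟩
  obtain ⟨R₀, hR₀, hψ0⟩ := hψ.exists_radius
  obtain ⟨κ, hκ, hκe⟩ := exists_bddSmooth_eq_shiftDensity (a k) t (R := R₀ + |t| + 1)
    (by positivity)
  have hκ' : BddSmooth fun y : L2 => κ (y k) := by
    have := hκ.comp_clm (innerSL ℝ (e k))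
    simpa [inner_e_left] using this
  have hψ' : IsTest O fun y => ψ (y + (-t) • e k) := by
    have := hψ.comp_add ((-t) • e k)
    have h2 : (· + (-t) • e k) ⁻¹' ((· + t • e k) ⁻¹' O) = O := by
      ext x; simp [add_assoc]
    rwa [h2] at this
  have h1 := hw.weak _ (hψ'.mul hκ') i
  have hsmall : ∀ y : L2, ‖y + (-t) • e k‖ ≤ R₀ → |y k| < R₀ + |t| + 1 := by
    intro y hy
    have h2 := (abs_coord_le _ k).trans hy
    rw [add_smul_e_apply, if_pos rfl] at h2
    have h3 : |y k| ≤ |y k + -t| + |t| := by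
      simpa using abs_sub (y k + -t) (-t)
    linarith
  have e1 : ∀ y : L2, shiftDensity (a k) t (y k) * (w (i + 1, y) * ψ (y + (-t) • e k)) =
      w (i + 1, y) * (κ (y k) * ψ (y + (-t) • e k)) := by
    intro y
    rcases le_or_gt ‖y + (-t) • e k‖ R₀ with hy | hy
    · rw [hκe _ (hsmall y hy)]; ring
    · rw [(hψ0 _ hy).1]; ring
  have e2 : ∀ y : L2, shiftDensity (a k) t (y k) * (w (0, y) * pdStar a i ψ (y + (-t) • e k)) =
      w (0, y) * pdStar a i (fun y => κ (y k) * ψ (y + (-t) • e k)) y := by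
    intro y
    rw [pdStar_mul (hκ'.hasPd i y) (hψ'.hasPd i y), pdStar, pdStar, pd_comp_add]
    rcases le_or_gt ‖y + (-t) • e k‖ R₀ with hy | hy
    · have hd : HasDerivAt κ (t / a k ^ 2 * shiftDensity (a k) t (y k)) (y k) := by
        refine (hasDerivAt_shiftDensity_right _ _ _).congr_of_eventuallyEq ?_
        filter_upwards [(isOpen_lt continuous_abs continuous_const).mem_nhds (hsmall y hy)]
          with s hs using hκe s hs
      rw [pd_comp_coord i k y hd, hκe _ (hsmall y hy), add_smul_e_apply]
      by_cases hik : k = i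
      · subst hik
        have := (ha k).ne'
        simp only [if_true]
        field_simp
        ring
      · rw [if_neg hik, if_neg (Ne.symm hik)]; ring
    · rw [(hψ0 _ hy).1, (hψ0 _ hy).2]; ring
  have h2 := integral_add_smul_e (ha k) t fun y => w (i + 1, y) * ψ (y + (-t) • e k)
  have h3 := integral_add_smul_e (ha k) t fun y => w (0, y) * pdStar a i ψ (y + (-t) • e k)
  simp only [e1, e2] at h2 h3
  rw [← h1] at h3
  have h4 := h2.trans h3.symm
  simpa [add_assoc, ← add_smul, GaussSobolev.shiftJet] using h4

/-! ### Density of smooth functions on the whole space -/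

theorem jet_mul {β φ : L2 → ℝ} (hβ : BddSmooth β) (hφ : BddSmooth φ) (p : ℕ × L2) :
    jet (fun x => β x * φ x) p = mulJet β (jet φ) p := by
  obtain ⟨n, x⟩ := p
  cases n with
  | zero => simp [jet, mulJet, gradPart]
  | succ i => simp only [jet, mulJet, gradPart, pd_mul (hβ.hasPd i x) (hφ.hasPd i x)]; ring

/-- The cut-off functions on growing balls are eventually `1` near a given point. -/
theorem eventually_cutoff_eq (x : L2) :
    ∀ᶠ n : ℕ in atTop, cutoff 0 (n + 1) x = 1 ∧ ∀ i, pd i (cutoff 0 (n + 1)) x = 0 := by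
  obtain ⟨m, hm⟩ := exists_nat_gt ‖x‖
  filter_upwards [eventually_ge_atTop m] with n hn
  have hn' : (m : ℝ) ≤ n := by exact_mod_cast hn
  have h1 : ∀ y ∈ Metric.ball (0 : L2) (n + 1), cutoff 0 (n + 1 : ℝ) y = 1 := fun y hy =>
    cutoff_eq_one (by positivity) (Metric.mem_ball.1 hy).le
  have hx : x ∈ Metric.ball (0 : L2) (n + 1) := by
    rw [mem_ball_zero_iff]; linarith
  exact ⟨h1 x hx, fun i => pd_eq_zero_of_const Metric.isOpen_ball h1 hx i⟩

theorem abs_cutoff_le (c : L2) (r : ℝ) (x : L2) : |cutoff c r x| ≤ 1 := by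
  rw [abs_of_nonneg (cutoff_nonneg c r x)]; exact cutoff_le_one c r x

theorem gradPart_cutoff_bdd :
    ∃ C : ℝ, ∀ n : ℕ, ∀ p, |gradPart (cutoff 0 (n + 1)) p| ≤ C := by
  obtain ⟨C, hC⟩ := pd_cutoff_bdd 0
  refine ⟨C, fun n ⟨m, x⟩ => ?_⟩
  have hn : (n : ℝ) + 1 ≥ 1 := by linarith [n.cast_nonneg (α := ℝ)]
  cases m with
  | zero => simpa [gradPart] using (abs_nonneg _).trans (hC _ hn 0 0)
  | succ i => exact hC _ hn i x

/-- A function orthogonal to the smooth functions with bounded support is orthogonal to all smooth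
functions with bounded derivatives. -/
theorem integral_mul_jet_eq_zero {a : ℕ → ℝ} (ha : ∀ i, 0 < a i) (hs : Summable a)
    {r : ℕ × L2 → ℝ} (hr : MemLp r 2 (M a))
    (h : ∀ φ, BddSmoothSupp φ → ∫ p, r p * jet φ p ∂(M a) = 0) {φ : L2 → ℝ} (hφ : BddSmooth φ) :
    ∫ p, r p * jet φ p ∂(M a) = 0 := by
  have := isFiniteMeasure_M ha hs
  obtain ⟨C, hC⟩ := gradPart_cutoff_bdd
  obtain ⟨D, hD⟩ := hφ.bdd
  obtain ⟨B, hB⟩ := hφ.gradPart_bdd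
  have hjB : ∀ p, |jet φ p| ≤ max B D := by
    rintro ⟨n, x⟩
    cases n with
    | zero => exact (hD x).trans (le_max_right _ _)
    | succ i => exact (hB (i + 1, x)).trans (le_max_left _ _)
  have hsm : ∀ n : ℕ, BddSmooth fun x => cutoff 0 (n + 1) x * φ x := fun n =>
    (bddSmooth_cutoff _ _).mul hφ
  have hcs : ∀ n : ℕ, BddSmoothSupp fun x => cutoff 0 (n + 1) x * φ x := fun n => by
    simpa only [mul_comm] using hφ.mul_supp (bddSmoothSupp_cutoff 0 (r := n + 1) (by positivity))
  have hlim := tendsto_integral_of_dominated_convergence (μ := M a)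
    (F := fun (n : ℕ) p => r p * jet (fun x => cutoff 0 (n + 1) x * φ x) p)
    (f := fun p => r p * jet φ p) (fun p => |r p| * (max B D + C * D))
    (fun n => hr.1.mul ((hsm n).memLp_jet ha hs).1)
    ((hr.integrable one_le_two).abs.mul_const _)
    (fun n => Eventually.of_forall fun p => ?_) (Eventually.of_forall fun p => ?_)
  · simp only [h _ (hcs _)] at hlim
    exact (tendsto_nhds_unique hlim tendsto_const_nhds)
  · rw [norm_mul, Real.norm_eq_abs, Real.norm_eq_abs]
    refine mul_le_mul_of_nonneg_left ?_ (abs_nonneg _)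
    rw [jet_mul (bddSmooth_cutoff _ _) hφ, mulJet]
    refine (abs_add_le _ _).trans (add_le_add ?_ ?_)
    · rw [abs_mul]
      exact (mul_le_of_le_one_left (abs_nonneg _) (abs_cutoff_le _ _ _)).trans (hjB p)
    · rw [abs_mul]
      exact mul_le_mul (hC n p) (hD _) (abs_nonneg _) ((abs_nonneg _).trans (hC n p))
  · refine tendsto_const_nhds.congr' ?_
    filter_upwards [eventually_cutoff_eq p.2] with n hn
    rw [jet_mul (bddSmooth_cutoff _ _) hφ, mulJet, hn.1]
    have : gradPart (cutoff 0 (n + 1)) p = 0 := by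
      obtain ⟨m, x⟩ := p
      cases m with
      | zero => rfl
      | succ i => exact hn.2 i
    rw [this, zero_mul, add_zero, one_mul]

theorem integrable_mul_coord {a : ℕ → ℝ} {F : L2 → ℝ} (hF : MemLp F 2 (P a)) (i : ℕ) :
    Integrable (fun x : L2 => F x * x i) (P a) :=
  hF.integrable_mul (memLp_coord a i)

/-- On the whole space, the formula defining weak derivatives extends to test functions of
unbounded support. -/
theorem MemW.weak_bddSmooth {a : ℕ → ℝ} {r : ℕ × L2 → ℝ} (ha : ∀ i, 0 < a i)
    (hr : MemW a Set.univ r) {φ : L2 → ℝ} (hφ : BddSmooth φ) (i : ℕ) :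
    ∫ x, r (i + 1, x) * φ x ∂(P a) = ∫ x, r (0, x) * pdStar a i φ x ∂(P a) := by
  obtain ⟨C, hC⟩ := pd_cutoff_bdd 0
  obtain ⟨D, hD⟩ := hφ.bdd
  obtain ⟨B, hB⟩ := (hφ.pd i).bdd
  have hD0 : 0 ≤ D := (abs_nonneg _).trans (hD 0)
  have hF := memLp_slice ha hr.memLp 0
  have hG := memLp_slice ha hr.memLp (i + 1)
  have hsm : ∀ n : ℕ, BddSmooth fun x => cutoff 0 (n + 1) x * φ x := fun n =>
    (bddSmooth_cutoff _ _).mul hφ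
  have hcs : ∀ n : ℕ, IsTest Set.univ fun x => cutoff 0 (n + 1) x * φ x := fun n => by
    have h1 : BddSmoothSupp fun x => cutoff 0 (n + 1) x * φ x := by
      simpa only [mul_comm] using hφ.mul_supp (bddSmoothSupp_cutoff 0 (r := n + 1) (by positivity))
    refine ⟨h1.isCF, (isCF_iff.1 h1.isCF).2.2.mono ?_⟩
    exact fun x hx => (⟨trivial, hx⟩ : x ∈ Set.univ ∧ cutoff 0 (n + 1) x * φ x ≠ 0)
  have hlim1 : Tendsto (fun n : ℕ => ∫ x, r (i + 1, x) * (cutoff 0 (n + 1) x * φ x) ∂(P a)) atTop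
      (𝓝 (∫ x, r (i + 1, x) * φ x ∂(P a))) := by
    refine tendsto_integral_of_dominated_convergence (fun x => |r (i + 1, x)| * D)
      (fun n => hG.1.mul (hsm n).continuous.aestronglyMeasurable)
      ((hG.integrable one_le_two).abs.mul_const _)
      (fun n => Eventually.of_forall fun x => ?_) (Eventually.of_forall fun x => ?_)
    · rw [norm_mul, Real.norm_eq_abs, Real.norm_eq_abs, abs_mul]
      refine mul_le_mul_of_nonneg_left ?_ (abs_nonneg _)
      exact (mul_le_of_le_one_left (abs_nonneg _) (abs_cutoff_le _ _ _)).trans (hD x)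
    · refine tendsto_const_nhds.congr' ?_
      filter_upwards [eventually_cutoff_eq x] with n hn
      rw [hn.1, one_mul]
  have hlim2 : Tendsto (fun n : ℕ => ∫ x, r (0, x) *
      pdStar a i (fun x => cutoff 0 (n + 1) x * φ x) x ∂(P a)) atTop
      (𝓝 (∫ x, r (0, x) * pdStar a i φ x ∂(P a))) := by
    refine tendsto_integral_of_dominated_convergence
      (fun x => |r (0, x)| * (B + C * D) + |r (0, x) * x i| * (D / a i ^ 2))
      (fun n => hF.1.mul ((hcs n).measurable_pdStar a i).aestronglyMeasurable)
      (((hF.integrable one_le_two).abs.mul_const _).add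
        ((integrable_mul_coord hF i).abs.mul_const _))
      (fun n => Eventually.of_forall fun x => ?_) (Eventually.of_forall fun x => ?_)
    · rw [norm_mul, Real.norm_eq_abs, Real.norm_eq_abs, abs_mul _ (x i), mul_assoc, ← mul_add]
      refine mul_le_mul_of_nonneg_left ?_ (abs_nonneg _)
      rw [pdStar_mul ((bddSmooth_cutoff _ _).hasPd i x) (hφ.hasPd i x), pdStar]
      have hn : (n : ℝ) + 1 ≥ 1 := by linarith [n.cast_nonneg (α := ℝ)]
      have h1 : |-pd i φ x + x i / a i ^ 2 * φ x| ≤ B + |x i| * (D / a i ^ 2) := by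
        refine (abs_add_le _ _).trans (add_le_add ((abs_neg _).trans_le (hB x)) ?_)
        rw [abs_mul, abs_div, abs_of_nonneg (sq_nonneg (a i)), div_mul_eq_mul_div, mul_div_assoc]
        have := hD x
        gcongr
      have h2 : |pd i (cutoff 0 (n + 1)) x * φ x| ≤ C * D := by
        rw [abs_mul]
        exact mul_le_mul (hC _ hn i x) (hD x) (abs_nonneg _) ((abs_nonneg _).trans (hC _ hn i x))
      refine (abs_sub _ _).trans ?_
      rw [abs_mul]
      have h3 := mul_le_of_le_one_left (abs_nonneg (-pd i φ x + x i / a i ^ 2 * φ x))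
        (abs_cutoff_le 0 (n + 1) x)
      linarith
    · refine tendsto_const_nhds.congr' ?_
      filter_upwards [eventually_cutoff_eq x] with n hn
      rw [pdStar_mul ((bddSmooth_cutoff _ _).hasPd i x) (hφ.hasPd i x), hn.1, hn.2 i, one_mul,
        zero_mul, sub_zero]
  refine tendsto_nhds_unique hlim1 (hlim2.congr fun n => ?_)
  exact (hr.weak _ (hcs n) i).symm

/-- The trigonometric function `cos (⟨l, x⟩ + c)`. -/
def cosFun (l : L2) (c : ℝ) (x : L2) : ℝ := Real.cos (inner ℝ l x + c)

theorem bddSmooth_cosFun (l : L2) (c : ℝ) : BddSmooth (cosFun l c) :=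
  (bddSmooth_cos.comp_add c).comp_clm (innerSL ℝ l)

theorem pd_cosFun (l : L2) (c : ℝ) (i : ℕ) (x : L2) :
    pd i (cosFun l c) x = l i * cosFun l (c + Real.pi / 2) x := by
  have h1 : HasDerivAt (fun t : ℝ => inner ℝ l x + t * l i + c) (l i) 0 := by
    simpa using (((hasDerivAt_id (0 : ℝ)).mul_const (l i)).const_add (inner ℝ l x)).add_const c
  have h2 := h1.cos
  have h3 : pd i (cosFun l c) x = -Real.sin (inner ℝ l x + 0 * l i + c) * l i := by
    refine HasDerivAt.deriv (h2.congr_of_eventuallyEq (Eventually.of_forall fun t => ?_))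
    simp only [cosFun, inner_add_right, inner_smul_right, inner_e_right]
  rw [h3, cosFun, ← add_assoc, Real.cos_add_pi_div_two]
  ring_nf

theorem cosFun_add_pi (l : L2) (c : ℝ) (x : L2) :
    cosFun l (c + Real.pi / 2 + Real.pi / 2) x = -cosFun l c x := by
  rw [cosFun, cosFun, add_assoc c, add_halves, ← add_assoc, Real.cos_add_pi]

theorem inner_eq_sum {l : L2} {N : ℕ} (hN : ∀ i ≥ N, l i = 0) (x : L2) :
    inner ℝ l x = ∑ i ∈ Finset.range N, l i * x i := by
  have h1 := lp.hasSum_inner (𝕜 := ℝ) l x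
  have h2 := hasSum_sum_of_ne_finset_zero (L := SummationFilter.unconditional ℕ)
    (f := fun i => inner ℝ (l i) (x i)) (s := Finset.range N) fun i hi => by
      rw [hN i (by simpa using hi), inner_zero_left]
  rw [h1.unique h2]
  refine Finset.sum_congr rfl fun i _ => ?_
  simp [mul_comm]

/-- A solution `C` of `C + s C' + s² q C = 0` on the real line vanishes, since
`s C(s) exp(s² q / 2)` is constant. -/
theorem eq_zero_of_ode {C C' : ℝ → ℝ} {q : ℝ} (hC : ∀ s, HasDerivAt C (C' s) s)
    (h : ∀ s, C s + s * C' s + s ^ 2 * q * C s = 0) : C 1 = 0 := by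
  have hd : ∀ s, HasDerivAt (fun s => s * C s * Real.exp (s ^ 2 * q / 2)) 0 s := by
    intro s
    have h1 := (hasDerivAt_id s).mul (hC s)
    have h2 : HasDerivAt (fun s : ℝ => s ^ 2 * q / 2) (s * q) s := by
      refine ((((hasDerivAt_id s).pow 2).mul_const q).div_const 2).congr_deriv ?_
      simp; ring
    refine (h1.mul h2.exp).congr_deriv ?_
    have h3 := h s
    simp only [id, Pi.mul_apply]
    linear_combination Real.exp (s ^ 2 * q / 2) * h3
  have h1 := is_const_of_deriv_eq_zero (fun s => (hd s).differentiableAt)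
    (fun s => (hd s).deriv) 1 0
  simpa using h1

/-- A function of class `W^{1,2}(ℓ²)` orthogonal to all smooth functions vanishes. Testing with
`cos (s ⟨l, x⟩ + c)` yields a differential equation in `s` for the Fourier transform. -/
theorem MemW.ae_eq_zero {a : ℕ → ℝ} (ha : ∀ i, 0 < a i) (hs : Summable a) {r : ℕ × L2 → ℝ}
    (hr : MemW a Set.univ r) (h : ∀ φ, BddSmoothSupp φ → ∫ p, r p * jet φ p ∂(M a) = 0) :
    r =ᵐ[M a] 0 := by
  have hF := memLp_slice ha hr.memLp 0
  have hbdd : ∀ l c, Measurable (cosFun l c) ∧ ∃ C, ∀ x, |cosFun l c x| ≤ C := fun l c =>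
    ⟨(bddSmooth_cosFun l c).continuous.measurable, (bddSmooth_cosFun l c).bdd⟩
  have hFc : ∀ l c, Integrable (fun x => r (0, x) * cosFun l c x) (P a) := fun l c =>
    integrable_mul_bdd hF (hbdd l c).1 (hbdd l c).2
  have hFxc : ∀ l c i, Integrable (fun x => r (0, x) * (x i * cosFun l c x)) (P a) := by
    intro l c i
    have := (integrable_mul_coord hF i).mul_bdd (c := 1) (g := cosFun l c)
      (hbdd l c).1.aestronglyMeasurable (Eventually.of_forall fun x => Real.abs_cos_le_one _)
    simpa only [mul_assoc] using this
  have hzero : (fun x => r (0, x)) =ᵐ[P a] 0 := by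
    refine ae_eq_zero_of_integral_cos_eq_zero a (hF.integrable one_le_two) ?_
    rintro l ⟨N, hN⟩ c
    set q : ℝ := ∑ i ∈ Finset.range N, a i ^ 2 * l i ^ 2
    let C : ℝ → ℝ := fun s => ∫ x, r (0, x) * cosFun (s • l) c x ∂(P a)
    let C' : ℝ → ℝ := fun s =>
      ∫ x, r (0, x) * (inner ℝ l x * cosFun (s • l) (c + Real.pi / 2) x) ∂(P a)
    have hl : MemLp (fun x : L2 => (inner ℝ l x : ℝ)) 2 (P a) := by
      simp only [inner_eq_sum hN]
      exact memLp_finsetSum _ fun i _ => (memLp_coord a i).const_mul _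
    have hC : ∀ s, HasDerivAt C (C' s) s := by
      intro s
      refine (hasDerivAt_integral_of_dominated_loc_of_deriv_le (μ := P a) (𝕜 := ℝ) (x₀ := s)
        (F := fun s x => r (0, x) * cosFun (s • l) c x)
        (F' := fun s x => r (0, x) * (inner ℝ l x * cosFun (s • l) (c + Real.pi / 2) x))
        (bound := fun x => |r (0, x) * inner ℝ l x|) (s := Set.univ) univ_mem
        (Eventually.of_forall fun t => (hFc _ _).1) (hFc _ _) ?_
        (Eventually.of_forall fun x t _ => ?_) (hF.integrable_mul hl).abs
        (Eventually.of_forall fun x t _ => ?_)).2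
      · exact hF.1.mul (hl.1.mul (hbdd _ _).1.aestronglyMeasurable)
      · rw [← mul_assoc, norm_mul]
        exact mul_le_of_le_one_right (norm_nonneg _) (Real.abs_cos_le_one _)
      · have h1 : HasDerivAt (fun t : ℝ => t * inner ℝ l x + c) (inner ℝ l x) t := by
          simpa using ((hasDerivAt_id t).mul_const (inner ℝ l x)).add_const c
        refine ((h1.cos.const_mul (r (0, x))).congr_of_eventuallyEq
          (Eventually.of_forall fun t => ?_)).congr_deriv ?_
        · simp only [cosFun, real_inner_smul_left]
        · simp only [cosFun, real_inner_smul_left, ← add_assoc, Real.cos_add_pi_div_two]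
          ring
    have hode : ∀ s, C s + s * C' s + s ^ 2 * q * C s = 0 := by
      intro s
      have hsm := bddSmooth_cosFun (s • l) c
      have h1 := integral_mul_jet_eq_zero ha hs hr.memLp h hsm
      have hint : Integrable (fun p => r p * jet (cosFun (s • l) c) p) (M a) :=
        hr.memLp.integrable_mul (hsm.memLp_jet ha hs)
      have h2 := hasSum_integral_M hint
      rw [h1] at h2
      have hterm : ∀ i, (wt a (i + 1)).toReal *
          ∫ x, r (i + 1, x) * jet (cosFun (s • l) c) (i + 1, x) ∂(P a) =
          s ^ 2 * (a i ^ 2 * l i ^ 2) * C s +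
          s * (l i * ∫ x, r (0, x) * (x i * cosFun (s • l) (c + Real.pi / 2) x) ∂(P a)) := by
        intro i
        have h3 := hr.weak_bddSmooth ha (bddSmooth_cosFun (s • l) (c + Real.pi / 2)) i
        have h4 : ∀ x : L2, r (i + 1, x) * jet (cosFun (s • l) c) (i + 1, x) =
            s * l i * (r (i + 1, x) * cosFun (s • l) (c + Real.pi / 2) x) := by
          intro x
          simp only [jet, pd_cosFun]
          change _ * (s * l i * _) = _
          ring
        have h5 : ∀ x : L2, r (0, x) * pdStar a i (cosFun (s • l) (c + Real.pi / 2)) x =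
            s * l i * (r (0, x) * cosFun (s • l) c x) +
            (a i ^ 2)⁻¹ * (r (0, x) * (x i * cosFun (s • l) (c + Real.pi / 2) x)) := by
          intro x
          simp only [pdStar, pd_cosFun, cosFun_add_pi]
          change _ * (-(s * l i * _) + _) = _
          ring
        simp only [h4, wt_succ_toReal]
        rw [integral_const_mul, h3]
        simp only [h5]
        rw [integral_add ((hFc _ _).const_mul _) ((hFxc _ _ i).const_mul _), integral_const_mul,
          integral_const_mul]
        have := (ha i).ne'
        simp only [C]
        field_simp
      have h6 := (hasSum_nat_add_iff' 1).2 h2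
      simp only [hterm] at h6
      have h7 := hasSum_sum_of_ne_finset_zero (L := SummationFilter.unconditional ℕ)
        (s := Finset.range N)
        (f := fun i => s ^ 2 * (a i ^ 2 * l i ^ 2) * C s +
          s * (l i * ∫ x, r (0, x) * (x i * cosFun (s • l) (c + Real.pi / 2) x) ∂(P a)))
        fun i hi => by rw [hN i (by simpa using hi)]; ring
      have h8 := h6.unique h7
      have h9 : C' s = ∑ i ∈ Finset.range N,
          l i * ∫ x, r (0, x) * (x i * cosFun (s • l) (c + Real.pi / 2) x) ∂(P a) := by
        simp only [← integral_const_mul]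
        rw [← integral_finsetSum _ fun i _ => (hFxc _ _ i).const_mul _]
        refine integral_congr_ae (Eventually.of_forall fun x => ?_)
        simp only [inner_eq_sum hN, Finset.sum_mul, Finset.mul_sum]
        refine Finset.sum_congr rfl fun i _ => ?_
        ring
      rw [Finset.sum_add_distrib, ← Finset.mul_sum, ← h9, ← Finset.sum_mul, ← Finset.mul_sum] at h8
      simp only [Finset.sum_range_one, wt, ENNReal.toReal_one, one_mul, jet] at h8
      change 0 - C s = _ at h8
      linarith
    have := eq_zero_of_ode hC hode
    simp only [C, one_smul] at this
    exact this
  refine (ae_M_iff ha).2 fun n => ?_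
  cases n with
  | zero => exact hzero
  | succ i =>
    have hG := memLp_slice ha hr.memLp (i + 1)
    refine ae_eq_zero_of_integral_cos_eq_zero a (hG.integrable one_le_two) fun l _ c => ?_
    refine (hr.weak_bddSmooth ha (bddSmooth_cosFun l c) i).trans ?_
    refine integral_eq_zero_of_ae ?_
    filter_upwards [hzero] with x hx
    simp only [Pi.zero_apply] at hx
    rw [hx, zero_mul]; rfl

/-- On `O`, the function `w 0` with the gradient `w 1, w 2, …` is a limit of smooth functions with
bounded support in the norm of `W^{1,2}(O)`. -/
def Approx (a : ℕ → ℝ) (O : Set L2) (w : ℕ × L2 → ℝ) : Prop :=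
  ∀ ε : ENNReal, ε ≠ 0 → ∃ φ, BddSmoothSupp φ ∧
    eLpNorm (fun p => jet φ p - w p) 2 ((M a).restrict (Prod.snd ⁻¹' O)) ≤ ε

theorem BddSmoothSupp.add {φ ψ : L2 → ℝ} (hφ : BddSmoothSupp φ) (hψ : BddSmoothSupp ψ) :
    BddSmoothSupp fun x => φ x + ψ x := by
  obtain ⟨h1, R, hR⟩ := hφ
  obtain ⟨h2, S, hS⟩ := hψ
  refine ⟨h1.add h2, max R S, fun x hx => ?_⟩
  by_contra hle
  rw [not_lt, max_le_iff] at hle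
  refine hx ?_
  have h3 : φ x = 0 := by by_contra hne; exact absurd (hR x hne) (not_lt.2 hle.1)
  have h4 : ψ x = 0 := by by_contra hne; exact absurd (hS x hne) (not_lt.2 hle.2)
  simp only [h3, h4, add_zero]

theorem BddSmoothSupp.const_mul {φ : L2 → ℝ} (hφ : BddSmoothSupp φ) (c : ℝ) :
    BddSmoothSupp fun x => c * φ x :=
  (BddSmooth.const c).mul_supp hφ

theorem jet_add {φ ψ : L2 → ℝ} (hφ : BddSmooth φ) (hψ : BddSmooth ψ) (p : ℕ × L2) :
    jet (fun x => φ x + ψ x) p = jet φ p + jet ψ p := by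
  obtain ⟨n, x⟩ := p
  cases n with
  | zero => rfl
  | succ i => exact pd_add (hφ.hasPd i x) (hψ.hasPd i x)

theorem jet_const_mul {φ : L2 → ℝ} (hφ : BddSmooth φ) (c : ℝ) (p : ℕ × L2) :
    jet (fun x => c * φ x) p = c * jet φ p := by
  rw [jet_mul (BddSmooth.const c) hφ, mulJet]
  have : gradPart (fun _ : L2 => c) p = 0 := by
    obtain ⟨n, x⟩ := p
    cases n with
    | zero => rfl
    | succ i => exact pd_eq_zero_of_const isOpen_univ (fun _ _ => rfl) (Set.mem_univ x) i
  rw [this, zero_mul, add_zero]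

/-- The subspace of `L²(M a)` formed by the smooth functions with bounded support. -/
def smoothSubspace (a : ℕ → ℝ) : Submodule ℝ (Lp ℝ 2 (M a)) where
  carrier := {g | ∃ φ, BddSmoothSupp φ ∧ g =ᵐ[M a] jet φ}
  add_mem' := by
    rintro f g ⟨φ, hφ, hf⟩ ⟨ψ, hψ, hg⟩
    refine ⟨_, hφ.add hψ, ?_⟩
    filter_upwards [hf, hg, Lp.coeFn_add f g] with p h1 h2 h3
    rw [h3, Pi.add_apply, h1, h2, jet_add hφ.1 hψ.1]
  zero_mem' := by
    refine ⟨fun _ => 0 * 0, BddSmoothSupp.const_mul (φ := fun _ => 0)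
      ⟨BddSmooth.const 0, 0, by simp⟩ 0, ?_⟩
    filter_upwards [Lp.coeFn_zero ℝ 2 (M a)] with p hp
    rw [hp, jet_const_mul (BddSmooth.const 0), zero_mul]; rfl
  smul_mem' := by
    rintro c f ⟨φ, hφ, hf⟩
    refine ⟨_, hφ.const_mul c, ?_⟩
    filter_upwards [hf, Lp.coeFn_smul c f] with p h1 h2
    rw [h2, Pi.smul_apply, h1, jet_const_mul hφ.1, smul_eq_mul]

/-- The function on `ℕ × ℓ²` that represents the functional
`w ↦ ∫ w (i + 1) ψ - ∫ w 0 (-D_i ψ + x_i ψ / a_i²)` as an inner product. -/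
def weakTest (a : ℕ → ℝ) (i : ℕ) (ψ : L2 → ℝ) (p : ℕ × L2) : ℝ :=
  if p.1 = 0 then -pdStar a i ψ p.2 else if p.1 = i + 1 then ψ p.2 / a i ^ 2 else 0

theorem memLp_weakTest {a : ℕ → ℝ} (ha : ∀ i, 0 < a i) (hs : Summable a) {O : Set L2} {ψ : L2 → ℝ}
    (hψ : IsTest O ψ) (i : ℕ) : MemLp (weakTest a i ψ) 2 (M a) := by
  have := isFiniteMeasure_M ha hs
  obtain ⟨C, hC⟩ := hψ.csb.exists_bound
  obtain ⟨D, hD⟩ := hψ.pdStar_bdd a i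
  refine MemLp.of_bound (aestronglyMeasurable_M fun n => ?_) (max D (C / a i ^ 2))
    (Eventually.of_forall fun p => ?_)
  · simp only [weakTest]
    split_ifs
    exacts [(hψ.measurable_pdStar a i).neg.aestronglyMeasurable,
      (hψ.csb.measurable.div_const _).aestronglyMeasurable, aestronglyMeasurable_const]
  · unfold weakTest
    split_ifs
    · rw [norm_neg]; exact (hD _).trans (le_max_left _ _)
    · rw [norm_div, Real.norm_eq_abs, Real.norm_eq_abs, abs_of_nonneg (sq_nonneg (a i))]
      refine le_trans ?_ (le_max_right _ _)
      gcongr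
      exact hC _
    · rw [norm_zero]
      exact ((abs_nonneg _).trans (hD 0)).trans (le_max_left _ _)

theorem integral_mul_weakTest {a : ℕ → ℝ} (ha : ∀ i, 0 < a i) (hs : Summable a) {O : Set L2}
    {ψ : L2 → ℝ} (hψ : IsTest O ψ) (i : ℕ) {w : ℕ × L2 → ℝ} (hw : MemLp w 2 (M a)) :
    ∫ p, w p * weakTest a i ψ p ∂(M a) =
      ∫ x, w (i + 1, x) * ψ x ∂(P a) - ∫ x, w (0, x) * pdStar a i ψ x ∂(P a) := by
  have hint : Integrable (fun p => w p * weakTest a i ψ p) (M a) :=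
    hw.integrable_mul (memLp_weakTest ha hs hψ i)
  have h1 := hasSum_integral_M hint
  have h2 := hasSum_sum_of_ne_finset_zero (L := SummationFilter.unconditional ℕ)
    (s := ({0, i + 1} : Finset ℕ))
    (f := fun n => (wt a n).toReal * ∫ x, w (n, x) * weakTest a i ψ (n, x) ∂(P a)) fun n hn => by
      simp only [Finset.mem_insert, Finset.mem_singleton, not_or] at hn
      simp [weakTest, hn.1, hn.2]
  rw [h1.unique h2, Finset.sum_pair (by simp), wt_succ_toReal]
  have h3 : ∀ x, w (i + 1, x) * weakTest a i ψ (i + 1, x) = w (i + 1, x) * ψ x * (a i ^ 2)⁻¹ := by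
    intro x
    simp only [weakTest, Nat.succ_ne_zero, if_false, if_true]
    ring
  have h4 : ∀ x, w (0, x) * weakTest a i ψ (0, x) = -(w (0, x) * pdStar a i ψ x) := by
    intro x
    simp [weakTest]
  simp only [h3, h4]
  rw [integral_mul_const, integral_neg, wt]
  have := (ha i).ne'
  field_simp
  simp
  ring

theorem integral_mul_eq_inner {a : ℕ → ℝ} {f g : ℕ × L2 → ℝ} (hf : MemLp f 2 (M a))
    (hg : MemLp g 2 (M a)) : ∫ p, f p * g p ∂(M a) = inner ℝ (hg.toLp g) (hf.toLp f) := by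
  rw [L2.inner_def]
  refine integral_congr_ae ?_
  filter_upwards [hf.coeFn_toLp, hg.coeFn_toLp] with p h1 h2
  rw [h1, h2]; simp

/-- Smooth functions with bounded support are dense in `W^{1,2}(ℓ²)`. -/
theorem MemW.approx_univ {a : ℕ → ℝ} (ha : ∀ i, 0 < a i) (hs : Summable a) {w : ℕ × L2 → ℝ}
    (hw : MemW a Set.univ w) : Approx a Set.univ w := by
  set V := smoothSubspace a with hV
  set K := V.topologicalClosure with hK
  have hKc : IsClosed (K : Set (Lp ℝ 2 (M a))) := V.isClosed_topologicalClosure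
  have : CompleteSpace K := hKc.completeSpace_coe
  set W : Lp ℝ 2 (M a) := hw.memLp.toLp w with hW
  set q : Lp ℝ 2 (M a) := K.starProjection W with hq
  have hqK : q ∈ K := K.starProjection_apply_mem W
  have horth : W - q ∈ Kᗮ := K.sub_starProjection_mem_orthogonal W
  have hjet : ∀ {φ : L2 → ℝ} (hφ : BddSmoothSupp φ), (hφ.1.memLp_jet ha hs).toLp (jet φ) ∈ V :=
    fun {φ} hφ => ⟨φ, hφ, (hφ.1.memLp_jet ha hs).coeFn_toLp⟩
  -- The component orthogonal to the smooth functions is of class `W^{1,2}`, hence zero.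
  have hr : MemW a Set.univ (W - q : Lp ℝ 2 (M a)) := by
    refine ⟨Lp.memLp _, fun x hx => absurd trivial hx, fun ψ hψ i => ?_⟩
    rw [← sub_eq_zero, ← integral_mul_weakTest ha hs hψ i (Lp.memLp _),
      integral_mul_eq_inner (Lp.memLp _) (memLp_weakTest ha hs hψ i), Lp.toLp_coeFn,
      inner_sub_right]
    have h1 : inner ℝ ((memLp_weakTest ha hs hψ i).toLp _) W = (0 : ℝ) := by
      rw [hW, ← integral_mul_eq_inner hw.memLp, integral_mul_weakTest ha hs hψ i hw.memLp,
        hw.weak ψ hψ i, sub_self]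
    have h2 : (memLp_weakTest ha hs hψ i).toLp _ ∈ Vᗮ := by
      rw [Submodule.mem_orthogonal']
      rintro g ⟨φ, hφ, hg⟩
      have hg' : g = (hφ.1.memLp_jet ha hs).toLp (jet φ) := by
        refine Lp.ext (hg.trans (hφ.1.memLp_jet ha hs).coeFn_toLp.symm)
      rw [hg', ← integral_mul_eq_inner, integral_mul_weakTest ha hs hψ i (hφ.1.memLp_jet ha hs),
        sub_eq_zero]
      exact hφ.1.weak ha hψ i
    rw [← Submodule.orthogonal_closure] at h2
    rw [h1, Submodule.inner_left_of_mem_orthogonal hqK h2, sub_self]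
  have hz := hr.ae_eq_zero ha hs fun φ hφ => by
    rw [integral_mul_eq_inner (Lp.memLp _) (hφ.1.memLp_jet ha hs), Lp.toLp_coeFn]
    exact Submodule.inner_right_of_mem_orthogonal (V.le_topologicalClosure (hjet hφ)) horth
  have hWq : W - q = 0 := Lp.ext (hz.trans (Lp.coeFn_zero ℝ 2 (M a)).symm)
  have hWK : W ∈ closure (V : Set (Lp ℝ 2 (M a))) := by
    rw [sub_eq_zero.1 hWq]; exact hqK
  intro ε hε
  obtain ⟨g, ⟨φ, hφ, hg⟩, hdist⟩ := EMetric.mem_closure_iff.1 hWK ε (pos_iff_ne_zero.2 hε)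
  refine ⟨φ, hφ, (eLpNorm_mono_measure _ Measure.restrict_le_self).trans ?_⟩
  rw [edist_comm, Lp.edist_def] at hdist
  refine (le_of_eq (eLpNorm_congr_ae ?_)).trans hdist.le
  filter_upwards [hg, hw.memLp.coeFn_toLp] with p h1 h2
  rw [Pi.sub_apply, h1, h2]

/-! ### Limits and sums of approximable functions -/

theorem Approx.mono {a : ℕ → ℝ} {O O' : Set L2} (h : O' ⊆ O) {w : ℕ × L2 → ℝ}
    (hw : Approx a O w) : Approx a O' w := by
  intro ε hε
  obtain ⟨φ, hφ, hle⟩ := hw ε hε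
  exact ⟨φ, hφ, (eLpNorm_mono_measure _
    (Measure.restrict_mono (Set.preimage_mono h) le_rfl)).trans hle⟩

theorem Approx.congr {a : ℕ → ℝ} {O : Set L2} (hO : IsOpen O) {w w' : ℕ × L2 → ℝ}
    (h : ∀ x ∈ O, ∀ n, w (n, x) = w' (n, x)) (hw : Approx a O w) : Approx a O w' := by
  intro ε hε
  obtain ⟨φ, hφ, hle⟩ := hw ε hε
  refine ⟨φ, hφ, (le_of_eq (eLpNorm_congr_ae ?_)).trans hle⟩
  filter_upwards [ae_restrict_mem (measurable_snd hO.measurableSet)] with p hp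
  rw [h p.2 hp p.1]

theorem Approx.add {a : ℕ → ℝ} (ha : ∀ i, 0 < a i) (hs : Summable a) {O : Set L2}
    {w w' : ℕ × L2 → ℝ} (hm : MemLp w 2 (M a)) (hm' : MemLp w' 2 (M a)) (hw : Approx a O w)
    (hw' : Approx a O w') : Approx a O fun p => w p + w' p := by
  intro ε hε
  have hε2 : ε / 2 ≠ 0 := by simpa using hε
  obtain ⟨φ, hφ, hle⟩ := hw (ε / 2) hε2
  obtain ⟨φ', hφ', hle'⟩ := hw' (ε / 2) hε2
  refine ⟨_, hφ.add hφ', ?_⟩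
  have h1 : (fun p => jet (fun x => φ x + φ' x) p - (w p + w' p)) =
      (fun p => jet φ p - w p) + fun p => jet φ' p - w' p := by
    funext p
    rw [jet_add hφ.1 hφ'.1, Pi.add_apply]; ring
  rw [h1]
  refine (eLpNorm_add_le ?_ ?_ one_le_two).trans ?_
  · exact ((hφ.1.memLp_jet ha hs).1.sub hm.1).restrict
  · exact ((hφ'.1.memLp_jet ha hs).1.sub hm'.1).restrict
  · rw [← ENNReal.add_halves ε]
    exact add_le_add hle hle'

theorem Approx.of_tendsto {a : ℕ → ℝ} (ha : ∀ i, 0 < a i) (hs : Summable a) {O : Set L2}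
    {u : ℕ → ℕ × L2 → ℝ} {w : ℕ × L2 → ℝ} (hu : ∀ n, MemLp (u n) 2 (M a)) (hw : MemLp w 2 (M a))
    (h : ∀ᶠ n in atTop, Approx a O (u n))
    (hlim : Tendsto (fun n => eLpNorm (fun p => u n p - w p) 2 (M a)) atTop (𝓝 0)) :
    Approx a O w := by
  intro ε hε
  have hε2 : ε / 2 ≠ 0 := by simpa using hε
  obtain ⟨n, hn1, hn2⟩ := (h.and (hlim.eventually_le_const (pos_iff_ne_zero.2 hε2))).exists
  obtain ⟨φ, hφ, hle⟩ := hn1 (ε / 2) hε2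
  refine ⟨φ, hφ, ?_⟩
  have h1 : (fun p => jet φ p - w p) = (fun p => jet φ p - u n p) + fun p => u n p - w p := by
    funext p
    rw [Pi.add_apply]; ring
  rw [h1]
  refine (eLpNorm_add_le ?_ ?_ one_le_two).trans ?_
  · exact ((hφ.1.memLp_jet ha hs).1.sub (hu n).1).restrict
  · exact ((hu n).1.sub hw.1).restrict
  · rw [← ENNReal.add_halves ε]
    exact add_le_add hle ((eLpNorm_mono_measure _ Measure.restrict_le_self).trans hn2)

/-! ### Truncation to compact sets -/

/-- The cube is a continuous image of a product of intervals, by dominated convergence. -/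
theorem isCompact_cube {c : ℕ → ℝ} (hc : Summable fun i => c i ^ 2) :
    IsCompact {x : L2 | ∀ i, |x i| ≤ c i} := by
  let B : Set (ℕ → ℝ) := Set.pi Set.univ fun i => Set.Icc (-c i) (c i)
  have hB : IsCompact B := isCompact_univ_pi fun i => isCompact_Icc
  have : CompactSpace B := isCompact_iff_compactSpace.1 hB
  have hmem : ∀ y : B, ∀ i, |y.1 i| ≤ c i := fun y i => abs_le.2 (y.2 i trivial)
  have hsum : ∀ y : B, Memℓp y.1 2 := fun y => by
    refine memℓp_gen (Summable.of_nonneg_of_le (fun i => by positivity) (fun i => ?_) hc)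
    simp only [ENNReal.toReal_ofNat, Real.rpow_ofNat, Real.norm_eq_abs]
    exact pow_le_pow_left₀ (abs_nonneg _) (hmem y i) 2
  let f : B → L2 := fun y => ⟨y.1, hsum y⟩
  have hf : Continuous f := by
    refine continuous_iff_continuousAt.2 fun y => tendsto_iff_norm_sub_tendsto_zero.2 ?_
    have h1 : Tendsto (fun y' : B => ∑' i, (y'.1 i - y.1 i) ^ 2) (𝓝 y) (𝓝 (∑' _ : ℕ, (0 : ℝ))) := by
      refine tendsto_tsum_of_dominated_convergence (bound := fun i => (2 * c i) ^ 2) ?_ ?_ ?_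
      · simpa only [mul_pow] using hc.mul_left _
      · intro i
        have h2 : Continuous fun y' : B => (y'.1 i - y.1 i) ^ 2 :=
          (((continuous_apply i).comp continuous_subtype_val).sub continuous_const).pow 2
        simpa using h2.tendsto y
      · refine Eventually.of_forall fun y' i => ?_
        rw [norm_pow]
        refine pow_le_pow_left₀ (norm_nonneg _) ?_ 2
        have h3 := abs_sub (y'.1 i) (y.1 i)
        have h4 := hmem y' i
        have h5 := hmem y i
        rw [Real.norm_eq_abs]
        linarith
    rw [tsum_zero] at h1
    have h2 : ∀ y' : B, ‖f y' - f y‖ = Real.sqrt (∑' i, (y'.1 i - y.1 i) ^ 2) := by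
      intro y'
      have h : ∑' i, (y'.1 i - y.1 i) ^ 2 = ‖f y' - f y‖ ^ 2 :=
        (norm_sq_eq_tsum (f y' - f y)).tsum_eq
      rw [h, Real.sqrt_sq (norm_nonneg _)]
    simp only [h2]
    have h3 := (Real.continuous_sqrt.tendsto 0).comp h1
    rw [Real.sqrt_zero] at h3
    exact h3
  have hrange : {x : L2 | ∀ i, |x i| ≤ c i} = Set.range f := by
    ext x
    constructor
    · intro hx
      exact ⟨⟨x, fun i _ => abs_le.1 (hx i)⟩, rfl⟩
    · rintro ⟨y, rfl⟩ i
      exact hmem y i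
  rw [hrange]
  exact isCompact_range hf

/-- The space `W^{1,2}(O)` is closed. -/
theorem MemW.of_tendsto {a : ℕ → ℝ} (ha : ∀ i, 0 < a i) (hs : Summable a) {O : Set L2}
    {u : ℕ → ℕ × L2 → ℝ} {w : ℕ × L2 → ℝ} (hu : ∀ n, MemW a O (u n)) (hw : MemLp w 2 (M a))
    (hzero : ∀ x ∉ O, ∀ n, w (n, x) = 0)
    (hlim : Tendsto (fun n => eLpNorm (fun p => u n p - w p) 2 (M a)) atTop (𝓝 0)) :
    MemW a O w := by
  refine ⟨hw, hzero, fun ψ hψ i => ?_⟩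
  rw [← sub_eq_zero, ← integral_mul_weakTest ha hs hψ i hw,
    integral_mul_eq_inner hw (memLp_weakTest ha hs hψ i)]
  have h1 : Tendsto (fun n => (hu n).memLp.toLp (u n)) atTop (𝓝 (hw.toLp w)) := by
    rw [tendsto_iff_edist_tendsto_0]
    refine hlim.congr fun n => ?_
    rw [Lp.edist_toLp_toLp]; rfl
  have h2 := (tendsto_const_nhds (x := (memLp_weakTest ha hs hψ i).toLp _)).inner (𝕜 := ℝ) h1
  refine tendsto_nhds_unique h2 (tendsto_const_nhds.congr fun n => ?_)
  rw [← integral_mul_eq_inner (hu n).memLp, integral_mul_weakTest ha hs hψ i (hu n).memLp,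
    (hu n).weak ψ hψ i, sub_self]

/-- A smooth function on the line, equal to `1` on `(-∞, 1]` and to `0` on `[2, ∞)`. -/
def profile (s : ℝ) : ℝ := Real.smoothTransition (2 - s)

theorem contDiff_profile : ContDiff ℝ (⊤ : ℕ∞) profile :=
  Real.smoothTransition.contDiff.comp (contDiff_const.sub contDiff_id)

theorem profile_eq_zero {s : ℝ} (hs : 2 ≤ s) : profile s = 0 :=
  Real.smoothTransition.zero_of_nonpos (by linarith)

theorem profile_eq_one {s : ℝ} (hs : s ≤ 1) : profile s = 1 :=
  Real.smoothTransition.one_of_one_le (by linarith)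

theorem deriv_profile_of_gt {s : ℝ} (hs : 2 < s) : deriv profile s = 0 := by
  have : profile =ᶠ[𝓝 s] fun _ => 0 := by
    filter_upwards [lt_mem_nhds hs] with t ht using profile_eq_zero (le_of_lt ht)
  rw [this.deriv_eq, deriv_const]

theorem deriv_profile_of_lt {s : ℝ} (hs : s < 1) : deriv profile s = 0 := by
  have : profile =ᶠ[𝓝 s] fun _ => 1 := by
    filter_upwards [gt_mem_nhds hs] with t ht using profile_eq_one (le_of_lt ht)
  rw [this.deriv_eq, deriv_const]

theorem deriv_profile_bdd : ∃ B, 0 ≤ B ∧ ∀ s, |deriv profile s| ≤ B := by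
  obtain ⟨B, hB⟩ := (isCompact_Icc (a := (1 : ℝ)) (b := 2)).exists_bound_of_continuousOn
    (contDiff_profile.continuous_deriv (by simp)).continuousOn
  refine ⟨max B 0, le_max_right _ _, fun s => ?_⟩
  by_cases h1 : s < 1
  · rw [deriv_profile_of_lt h1, abs_zero]; exact le_max_right _ _
  · by_cases h2 : 2 < s
    · rw [deriv_profile_of_gt h2, abs_zero]; exact le_max_right _ _
    · exact (hB s ⟨not_lt.1 h1, not_lt.1 h2⟩).trans (le_max_left _ _)

theorem profile_nonneg (s : ℝ) : 0 ≤ profile s := Real.smoothTransition.nonneg _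

theorem profile_le_one (s : ℝ) : profile s ≤ 1 := Real.smoothTransition.le_one _

/-- The square of the norm weighted by `1 / a i`, restricted to the first `m` coordinates. -/
def wnorm (a : ℕ → ℝ) (m : ℕ) (x : L2) : ℝ := ∑ i ∈ Finset.range m, x i ^ 2 / a i

/-- The cut-off function `x ↦ profile (wnorm a m x / ν)`, a smooth cylinder function. -/
def cylCut (a : ℕ → ℝ) (ν : ℝ) (m : ℕ) (x : L2) : ℝ := profile (wnorm a m x / ν)

/-- The cylinder function is the composition of `normCut` with a linear map of finite rank. -/
theorem bddSmooth_cylCut {a : ℕ → ℝ} (ha : ∀ i, 0 < a i) {ν : ℝ} (hν : 0 < ν) (m : ℕ) :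
    BddSmooth (cylCut a ν m) := by
  let T : L2 →L[ℝ] L2 := ∑ i ∈ Finset.range m,
    (√(a i * ν))⁻¹ • (innerSL ℝ (e i)).smulRight (e i)
  have hT : ∀ x, T x = ∑ i ∈ Finset.range m, ((√(a i * ν))⁻¹ * x i) • e i := by
    intro x
    simp only [T, _root_.sum_apply]
    refine Finset.sum_congr rfl fun i _ => ?_
    simp [inner_e_left, smul_smul]
  have hn : ∀ x, ‖T x‖ ^ 2 = wnorm a m x / ν := by
    intro x
    rw [← real_inner_self_eq_norm_sq, hT, sum_inner, wnorm, Finset.sum_div]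
    refine Finset.sum_congr rfl fun i hi => ?_
    rw [real_inner_smul_left, inner_sum, Finset.sum_eq_single_of_mem i hi]
    · have h1 : 0 < a i * ν := mul_pos (ha i) hν
      have h2 := Real.sq_sqrt h1.le
      rw [real_inner_smul_right, real_inner_self_eq_norm_sq, norm_e]
      have h3 : (√(a i * ν))⁻¹ * x i * ((√(a i * ν))⁻¹ * x i * 1 ^ 2) =
        x i ^ 2 / (√(a i * ν)) ^ 2 := by ring
      rw [h3, h2, div_div]
    · intro j _ hj
      rw [real_inner_smul_right, inner_e_left, e_apply, if_neg hj, mul_zero]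
  have := bddSmooth_normCut.comp_clm T
  have h3 : cylCut a ν m = fun x => normCut (T x) :=
    funext fun x => by simp only [cylCut, profile, normCut, hn]
  rw [h3]
  exact this

theorem pd_cylCut {a : ℕ → ℝ} (ν : ℝ) (m i : ℕ) (x : L2) :
    pd i (cylCut a ν m) x =
      if i < m then deriv profile (wnorm a m x / ν) * (2 * x i / a i / ν) else 0 := by
  have hd : Differentiable ℝ profile := contDiff_profile.differentiable (by simp)
  have h1 : HasDerivAt (fun t : ℝ => wnorm a m (x + t • e i) / ν)
      ((if i < m then 2 * x i / a i else 0) / ν) 0 := by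
    refine HasDerivAt.div_const ?_ ν
    have h2 : ∀ j ∈ Finset.range m, HasDerivAt (fun t : ℝ => (x + t • e i : L2) j ^ 2 / a j)
        (if i = j then 2 * x j / a j else 0) 0 := by
      intro j _
      simp only [add_smul_e_apply]
      by_cases hij : i = j
      · subst hij
        simp only [if_true]
        have := (((hasDerivAt_id (0 : ℝ)).const_add (x i)).pow 2).div_const (a i)
        simpa using this
      · simp only [if_neg hij, add_zero]
        exact hasDerivAt_const _ _
    have h3 := HasDerivAt.fun_sum h2
    simpa [wnorm, Finset.sum_ite_eq] using h3
  have h4 : HasDerivAt profile (deriv profile (wnorm a m x / ν))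
      (wnorm a m (x + (0 : ℝ) • e i) / ν) := by
    rw [zero_smul, add_zero]; exact (hd _).hasDerivAt
  have h5 := h4.comp (0 : ℝ) h1
  have h6 : pd i (cylCut a ν m) x = _ := h5.deriv
  rw [h6]
  split_ifs <;> simp

/-- The limit of `cylCut a ν m` as `m` grows. It is zero where the weighted norm is infinite, since
`profile` vanishes near infinity. -/
def fullCut (a : ℕ → ℝ) (ν : ℝ) (x : L2) : ℝ :=
  open Classical in
  if Summable fun i => x i ^ 2 / a i then profile ((∑' i, x i ^ 2 / a i) / ν) else 0

/-- The limit of the partial derivatives of `cylCut a ν m` as `m` grows. -/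
def fullCutGrad (a : ℕ → ℝ) (ν : ℝ) (p : ℕ × L2) : ℝ :=
  open Classical in
  match p.1 with
  | 0 => 0
  | i + 1 => if Summable fun i => p.2 i ^ 2 / a i then
      deriv profile ((∑' i, p.2 i ^ 2 / a i) / ν) * (2 * p.2 i / a i / ν) else 0

/-- The product of the function `w 0` and the cut-off function `fullCut a ν`, with its gradient. -/
def trunc (a : ℕ → ℝ) (ν : ℝ) (w : ℕ × L2 → ℝ) (p : ℕ × L2) : ℝ :=
  fullCut a ν p.2 * w p + fullCutGrad a ν p * w (0, p.2)

theorem tendsto_wnorm {a : ℕ → ℝ} {x : L2} (hx : Summable fun i => x i ^ 2 / a i) :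
    Tendsto (fun m => wnorm a m x) atTop (𝓝 (∑' i, x i ^ 2 / a i)) :=
  hx.hasSum.tendsto_sum_nat

theorem tendsto_mulJet_cylCut {a : ℕ → ℝ} (ν : ℝ) (w : ℕ × L2 → ℝ)
    {p : ℕ × L2} (hx : Summable fun i => p.2 i ^ 2 / a i) :
    Tendsto (fun m => mulJet (cylCut a ν m) w p) atTop (𝓝 (trunc a ν w p)) := by
  have h0 := (tendsto_wnorm hx).div_const ν
  have h1 : Tendsto (fun m => cylCut a ν m p.2) atTop (𝓝 (fullCut a ν p.2)) := by
    rw [fullCut, if_pos hx]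
    exact (contDiff_profile.continuous.tendsto _).comp h0
  have h2 : Tendsto (fun m => gradPart (cylCut a ν m) p) atTop (𝓝 (fullCutGrad a ν p)) := by
    obtain ⟨n, x⟩ := p
    cases n with
    | zero => exact tendsto_const_nhds
    | succ i =>
      simp only [gradPart, fullCutGrad, if_pos hx]
      have h3 := (((contDiff_profile.continuous_deriv (by simp)).tendsto _).comp h0).mul_const
        (2 * x i / a i / ν)
      refine h3.congr' ?_
      filter_upwards [eventually_gt_atTop i] with m hm
      rw [pd_cylCut, if_pos hm]; rfl
  exact (h1.mul_const _).add (h2.mul_const _)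

/-- The derivative of `profile (q / ν)`, where `q = ∑ i, x i ^ 2 / a i` and `y = x i`, `α = a i`: it
is supported in `q ≤ 2 ν`, where `|y| ≤ √(2 ν α)`. -/
theorem abs_deriv_profile_mul_le {B : ℝ} (hB : ∀ s, |deriv profile s| ≤ B) {α ν q y : ℝ}
    (hα : 0 < α) (hν : 1 ≤ ν) (hy : y ^ 2 / α ≤ q) :
    |deriv profile (q / ν) * (2 * y / α / ν)| ≤ 3 * B / √α := by
  have hν0 : 0 < ν := by linarith
  have hB0 : 0 ≤ B := (abs_nonneg _).trans (hB 0)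
  rcases lt_or_ge 2 (q / ν) with hq | hq
  · rw [deriv_profile_of_gt hq, zero_mul, abs_zero]; positivity
  · rw [abs_mul]
    have hs : 0 < √α := Real.sqrt_pos.2 hα
    have hsq : √α ^ 2 = α := Real.sq_sqrt hα.le
    have h1 : |2 * y / α / ν| ≤ 3 / √α := by
      refine abs_le_of_sq_le_sq ?_ (by positivity)
      rw [div_pow 3, hsq, div_pow, div_pow, mul_pow]
      rw [div_le_iff₀ hν0] at hq
      rw [div_le_iff₀ hα] at hy
      rw [div_div, div_le_div_iff₀ (by positivity) hα]
      have h2 : y ^ 2 ≤ 2 * ν * α := hy.trans (by gcongr)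
      have h3 : ν ≤ ν ^ 2 := by nlinarith
      have h4 : 2 ^ 2 * y ^ 2 * α ≤ 2 ^ 2 * (2 * ν * α) * α := by gcongr
      have h5 : ν * α ^ 2 ≤ ν ^ 2 * α ^ 2 := by gcongr
      have h6 : 0 ≤ ν ^ 2 * α ^ 2 := by positivity
      nlinarith
    calc _ ≤ B * (3 / √α) := mul_le_mul (hB _) h1 (abs_nonneg _) hB0
      _ = 3 * B / √α := by ring

theorem wnorm_ge {a : ℕ → ℝ} (ha : ∀ i, 0 < a i) {m i : ℕ} (hi : i < m) (x : L2) :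
    x i ^ 2 / a i ≤ wnorm a m x :=
  Finset.single_le_sum (f := fun i => x i ^ 2 / a i)
    (fun j _ => div_nonneg (sq_nonneg _) (ha j).le) (Finset.mem_range.2 hi)

/-- The growth in `n` of the bounds of the `n`-th slices of the gradients of the cut-off functions.
-/
def cutBound (a : ℕ → ℝ) (B : ℝ) : ℕ → ℝ
  | 0 => 0
  | i + 1 => 3 * B / √(a i)

theorem abs_gradPart_cylCut_le {a : ℕ → ℝ} (ha : ∀ i, 0 < a i) {B : ℝ} (hB0 : 0 ≤ B)
    (hB : ∀ s, |deriv profile s| ≤ B) {ν : ℝ} (hν : 1 ≤ ν) (m : ℕ) (p : ℕ × L2) :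
    |gradPart (cylCut a ν m) p| ≤ cutBound a B p.1 := by
  obtain ⟨n, x⟩ := p
  cases n with
  | zero => simp [gradPart, cutBound]
  | succ i =>
    simp only [gradPart, cutBound, pd_cylCut]
    split_ifs with hi
    · exact abs_deriv_profile_mul_le hB (ha i) hν (wnorm_ge ha hi x)
    · rw [abs_zero]; positivity

theorem abs_fullCutGrad_le {a : ℕ → ℝ} (ha : ∀ i, 0 < a i) {B : ℝ} (hB0 : 0 ≤ B)
    (hB : ∀ s, |deriv profile s| ≤ B) {ν : ℝ} (hν : 1 ≤ ν) (p : ℕ × L2) :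
    |fullCutGrad a ν p| ≤ cutBound a B p.1 := by
  obtain ⟨n, x⟩ := p
  cases n with
  | zero => simp [fullCutGrad, cutBound]
  | succ i =>
    simp only [fullCutGrad, cutBound]
    split_ifs with h
    · exact abs_deriv_profile_mul_le hB (ha i) hν
        (h.le_tsum i fun j _ => div_nonneg (sq_nonneg _) (ha j).le)
    · rw [abs_zero]; positivity

theorem abs_cylCut_le (a : ℕ → ℝ) (ν : ℝ) (m : ℕ) (x : L2) : |cylCut a ν m x| ≤ 1 := by
  rw [cylCut, abs_of_nonneg (profile_nonneg _)]; exact profile_le_one _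

theorem abs_fullCut_le (a : ℕ → ℝ) (ν : ℝ) (x : L2) : |fullCut a ν x| ≤ 1 := by
  unfold fullCut
  split_ifs
  · rw [abs_of_nonneg (profile_nonneg _)]; exact profile_le_one _
  · simp

theorem memLp_cutBound_mul {a : ℕ → ℝ} (ha : ∀ i, 0 < a i) (hs : Summable a) (B : ℝ) {f : L2 → ℝ}
    (hf : MemLp f 2 (P a)) : MemLp (fun p : ℕ × L2 => cutBound a B p.1 * f p.2) 2 (M a) := by
  refine memLp_M_of_le ha hs ⟨9 * B ^ 2, fun i => le_of_eq ?_⟩ hf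
  have h1 : √(a i) ^ 2 = a i := Real.sq_sqrt (ha i).le
  have h2 := (ha i).ne'
  rw [cutBound, div_pow, h1]
  field_simp
  ring

theorem ae_M_summable {a : ℕ → ℝ} (ha : ∀ i, 0 < a i) (hs : Summable a) :
    ∀ᵐ p ∂(M a), Summable fun i => p.2 i ^ 2 / a i :=
  (ae_M_iff ha).2 fun _ => ae_summable_sq_div ha hs

theorem memLp_trunc {a : ℕ → ℝ} (ha : ∀ i, 0 < a i) (hs : Summable a) {ν : ℝ} (hν : 1 ≤ ν)
    {w : ℕ × L2 → ℝ} (hw : MemLp w 2 (M a)) : MemLp (trunc a ν w) 2 (M a) := by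
  obtain ⟨B, hB0, hB⟩ := deriv_profile_bdd
  have hm : AEStronglyMeasurable (trunc a ν w) (M a) := by
    refine aestronglyMeasurable_of_tendsto_ae atTop (f := fun m => mulJet (cylCut a ν m) w)
      (fun m => ((bddSmooth_cylCut ha (by linarith) m).memLp_mulJet ha hs hw).1) ?_
    filter_upwards [ae_M_summable ha hs] with p hp using tendsto_mulJet_cylCut ν w hp
  have hg := hw.norm.add (memLp_cutBound_mul ha hs B (memLp_slice ha hw 0).norm)
  refine hg.of_le hm (Eventually.of_forall fun p => ?_)
  rw [Real.norm_eq_abs, Real.norm_eq_abs]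
  refine le_trans ?_ (le_abs_self _)
  refine (abs_add_le _ _).trans (add_le_add ?_ ?_)
  · rw [abs_mul]
    exact mul_le_of_le_one_left (abs_nonneg _) (abs_fullCut_le _ _ _)
  · rw [abs_mul]
    exact mul_le_mul_of_nonneg_right (abs_fullCutGrad_le ha hB0 hB hν p) (abs_nonneg _)

/-- The function `fullCut` is only a limit of smooth functions, but the truncated function is a
limit of smooth multiples of the given one. -/
theorem MemW.trunc {a : ℕ → ℝ} (ha : ∀ i, 0 < a i) (hs : Summable a) {O : Set L2} {ν : ℝ}
    (hν : 1 ≤ ν) {w : ℕ × L2 → ℝ} (hw : MemW a O w) : MemW a O (trunc a ν w) := by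
  obtain ⟨B, hB0, hB⟩ := deriv_profile_bdd
  have hsm := bddSmooth_cylCut ha (ν := ν) (by linarith)
  have hT := memLp_trunc ha hs hν hw.memLp
  refine MemW.of_tendsto ha hs (u := fun m => GaussSobolev.mulJet (cylCut a ν m) w)
    (fun m => hw.mulJet ha hs (hsm m)) hT (fun x hx n => ?_) ?_
  · simp only [GaussSobolev.trunc, hw.zero_off x hx, mul_zero, add_zero]
  · have hg := (hw.memLp.norm.const_mul 2).add
      ((memLp_cutBound_mul ha hs B (memLp_slice ha hw.memLp 0).norm).const_mul 2)
    refine tendsto_eLpNorm_two_of_dominated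
      (fun m => (hw.mulJet ha hs (hsm m)).memLp.1) hT.1 hg
      (fun m => Eventually.of_forall fun p => ?_) ?_
    · have h1 : GaussSobolev.mulJet (cylCut a ν m) w p - GaussSobolev.trunc a ν w p =
          (cylCut a ν m p.2 - fullCut a ν p.2) * w p +
          (gradPart (cylCut a ν m) p - fullCutGrad a ν p) * w (0, p.2) := by
        simp only [GaussSobolev.mulJet, GaussSobolev.trunc]; ring
      rw [h1]
      refine (abs_add_le _ _).trans (add_le_add ?_ ?_)
      · rw [abs_mul]
        refine mul_le_mul_of_nonneg_right ?_ (abs_nonneg _)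
        have h2 := abs_sub (cylCut a ν m p.2) (fullCut a ν p.2)
        have h3 := abs_cylCut_le a ν m p.2
        have h4 := abs_fullCut_le a ν p.2
        linarith
      · rw [abs_mul]
        have h2 := abs_sub (gradPart (cylCut a ν m) p) (fullCutGrad a ν p)
        have h3 := abs_gradPart_cylCut_le ha hB0 hB hν m p
        have h4 := abs_fullCutGrad_le ha hB0 hB hν p
        simp only [← mul_assoc, Real.norm_eq_abs]
        refine mul_le_mul_of_nonneg_right ?_ (abs_nonneg _)
        linarith
    · filter_upwards [ae_M_summable ha hs] with p hp using tendsto_mulJet_cylCut ν w hp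

/-- Truncation outside growing compact sets converges in the norm of `W^{1,2}`. -/
theorem tendsto_trunc {a : ℕ → ℝ} (ha : ∀ i, 0 < a i) (hs : Summable a) {w : ℕ × L2 → ℝ}
    (hw : MemLp w 2 (M a)) :
    Tendsto (fun n : ℕ => eLpNorm (fun p => trunc a (n + 1) w p - w p) 2 (M a)) atTop (𝓝 0) := by
  obtain ⟨B, hB0, hB⟩ := deriv_profile_bdd
  have hν : ∀ n : ℕ, (1 : ℝ) ≤ n + 1 := fun n => by linarith [n.cast_nonneg (α := ℝ)]
  have hg := (hw.norm.const_mul 2).add (memLp_cutBound_mul ha hs B (memLp_slice ha hw 0).norm)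
  refine tendsto_eLpNorm_two_of_dominated (fun n => (memLp_trunc ha hs (hν n) hw).1) hw.1 hg
    (fun n => Eventually.of_forall fun p => ?_) ?_
  · have h1 : trunc a (n + 1) w p - w p = (fullCut a (n + 1) p.2 - 1) * w p +
        fullCutGrad a (n + 1) p * w (0, p.2) := by
      simp only [trunc]; ring
    rw [h1]
    refine (abs_add_le _ _).trans (add_le_add ?_ ?_)
    · rw [abs_mul]
      refine mul_le_mul_of_nonneg_right ?_ (abs_nonneg _)
      have h2 := abs_sub (fullCut a (n + 1) p.2) 1
      have h4 := abs_fullCut_le a (n + 1) p.2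
      rw [abs_one] at h2
      linarith
    · rw [abs_mul]
      exact mul_le_mul_of_nonneg_right (abs_fullCutGrad_le ha hB0 hB (hν n) p) (abs_nonneg _)
  · filter_upwards [ae_M_summable ha hs] with p hp
    obtain ⟨m, hm⟩ := exists_nat_gt (∑' i, p.2 i ^ 2 / a i)
    refine tendsto_const_nhds.congr' ?_
    filter_upwards [eventually_ge_atTop m] with n hn
    have hn' : (m : ℝ) ≤ n := by exact_mod_cast hn
    have h1 : (∑' i, p.2 i ^ 2 / a i) / ((n : ℝ) + 1) < 1 := by
      rw [div_lt_one (by linarith [hν n])]; linarith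
    have h2 : fullCut a (n + 1) p.2 = 1 := by
      rw [fullCut, if_pos hp, profile_eq_one h1.le]
    have h3 : fullCutGrad a (n + 1) p = 0 := by
      obtain ⟨k, x⟩ := p
      cases k with
      | zero => rfl
      | succ i => simp only [fullCutGrad, if_pos hp, deriv_profile_of_lt h1, zero_mul]
    rw [trunc, h2, h3, one_mul, zero_mul, add_zero]

/-- The cut-off function vanishes outside the cube with sides `√(2 ν a i)`. -/
theorem exists_isCompact_trunc {a : ℕ → ℝ} (ha : ∀ i, 0 < a i) (hs : Summable a) {ν : ℝ}
    (hν : 1 ≤ ν) (w : ℕ × L2 → ℝ) :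
    ∃ K : Set L2, IsCompact K ∧ ∀ x ∉ K, ∀ n, trunc a ν w (n, x) = 0 := by
  refine ⟨_, isCompact_cube (c := fun i => √(2 * ν * a i)) ?_, fun x hx n => ?_⟩
  · refine (hs.mul_left (2 * ν)).congr fun i => ?_
    rw [Real.sq_sqrt]
    have := ha i
    positivity
  · have hν0 : 0 < ν := by linarith
    simp only [Set.mem_ofPred_eq, not_forall, not_le] at hx
    obtain ⟨i, hi⟩ := hx
    have h1 : 2 * ν < x i ^ 2 / a i := by
      rw [lt_div_iff₀ (ha i)]
      rw [Real.sqrt_lt' (lt_of_le_of_lt (Real.sqrt_nonneg _) hi), sq_abs] at hi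
      exact hi
    have key : fullCut a ν x = 0 ∧ fullCutGrad a ν (n, x) = 0 := by
      by_cases hsum : Summable fun i => x i ^ 2 / a i
      · have h2 : 2 < (∑' i, x i ^ 2 / a i) / ν := by
          rw [lt_div_iff₀ hν0]
          exact h1.trans_le (hsum.le_tsum i fun j _ => div_nonneg (sq_nonneg _) (ha j).le)
        refine ⟨by rw [fullCut, if_pos hsum, profile_eq_zero h2.le], ?_⟩
        cases n with
        | zero => rfl
        | succ j => simp only [fullCutGrad, if_pos hsum, deriv_profile_of_gt h2, zero_mul]
      · refine ⟨by rw [fullCut, if_neg hsum], ?_⟩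
        cases n with
        | zero => rfl
        | succ j => simp only [fullCutGrad, if_neg hsum]
    rw [trunc, key.1, key.2, zero_mul, zero_mul, add_zero]

/-! ### Continuity of translations -/

/-- A continuous function equal to `1` on `[-R, R]` and to `0` outside `[-R - 1, R + 1]`. -/
def slabCut (R s : ℝ) : ℝ := max 0 (min 1 (R + 1 - |s|))

theorem continuous_slabCut (R : ℝ) : Continuous (slabCut R) := by
  unfold slabCut; fun_prop

theorem slabCut_nonneg (R s : ℝ) : 0 ≤ slabCut R s := le_max_left _ _

theorem slabCut_le_one (R s : ℝ) : slabCut R s ≤ 1 := max_le zero_le_one (min_le_left _ _)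

theorem slabCut_eq_one {R s : ℝ} (h : |s| ≤ R) : slabCut R s = 1 := by
  rw [slabCut, min_eq_left (by linarith), max_eq_right zero_le_one]

theorem abs_le_of_slabCut_ne_zero {R s : ℝ} (h : slabCut R s ≠ 0) : |s| ≤ R + 1 := by
  by_contra hs
  exact h (max_eq_left ((min_le_right _ _).trans (by linarith)))

/-- Translations are continuous in `L²` on functions supported in a slab: they are uniformly bounded
there, and continuous on the dense set of bounded continuous functions. -/
theorem tendsto_shiftJet {a : ℕ → ℝ} (ha : ∀ i, 0 < a i) (hs : Summable a) {k : ℕ}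
    {w : ℕ × L2 → ℝ} (hw : MemLp w 2 (M a)) {R : ℝ} (hR : ∀ n x, w (n, x) ≠ 0 → |x k| ≤ R)
    {t : ℕ → ℝ} (ht : Tendsto t atTop (𝓝 0)) :
    Tendsto (fun n => eLpNorm (fun p => shiftJet k (t n) w p - w p) 2 (M a)) atTop (𝓝 0) := by
  have := isFiniteMeasure_M ha hs
  rw [ENNReal.tendsto_nhds_zero]
  intro ε hε
  set K : ENNReal := ENNReal.ofReal (Real.exp (1 * (R + 1) / a k ^ 2)) ^ (1 / 2 : ℝ) with hK
  have hKt : K + 1 ≠ ⊤ :=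
    ENNReal.add_ne_top.2 ⟨ENNReal.rpow_ne_top_of_nonneg (by norm_num) ENNReal.ofReal_ne_top,
      ENNReal.one_ne_top⟩
  have hε2 : ε / 2 ≠ 0 := by simpa using hε.ne'
  have hη : ε / 2 / (K + 1) ≠ 0 := ENNReal.div_ne_zero.2 ⟨hε2, hKt⟩
  obtain ⟨ψ, hψ, hψm⟩ := hw.exists_boundedContinuous_eLpNorm_sub_le (by simp) hη
  set v : ℕ × L2 → ℝ := fun p => slabCut R (p.2 k) * ψ p with hv
  have hvc : Continuous v :=
    ((continuous_slabCut R).comp ((continuous_coord k).comp continuous_snd)).mul ψ.continuous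
  have hvb : ∀ p, |v p| ≤ ‖ψ‖ := fun p => by
    rw [hv, abs_mul, abs_of_nonneg (slabCut_nonneg _ _)]
    exact (mul_le_of_le_one_left (abs_nonneg _) (slabCut_le_one _ _)).trans (ψ.norm_coe_le_norm p)
  have hvR : ∀ n x, w (n, x) - v (n, x) ≠ 0 → |x k| ≤ R + 1 := fun n x hx => by
    by_contra hne
    refine hx ?_
    have h1 : w (n, x) = 0 := by
      by_contra h; exact hne ((hR n x h).trans (by linarith))
    have h2 : slabCut R (x k) = 0 := by
      by_contra h; exact hne (abs_le_of_slabCut_ne_zero h)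
    simp only [hv, h1, h2, zero_mul, sub_zero]
  have hwv : eLpNorm (fun p => w p - v p) 2 (M a) ≤ ε / 2 / (K + 1) := by
    refine (eLpNorm_mono fun p => ?_).trans hψ
    have h1 : w p - v p = slabCut R (p.2 k) * (w p - ψ p) := by
      by_cases h : w p = 0
      · simp only [hv, h]; ring
      · simp only [hv, slabCut_eq_one (hR p.1 p.2 h), one_mul]
    rw [h1, norm_mul, Real.norm_of_nonneg (slabCut_nonneg _ _), Pi.sub_apply]
    exact mul_le_of_le_one_left (norm_nonneg _) (slabCut_le_one _ _)
  have hvm : AEStronglyMeasurable v (M a) := hvc.aestronglyMeasurable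
  have hlim : Tendsto (fun n => eLpNorm (fun p => shiftJet k (t n) v p - v p) 2 (M a)) atTop
      (𝓝 0) := by
    refine tendsto_eLpNorm_two_of_dominated (g := fun _ => 2 * ‖ψ‖)
      (fun n => aestronglyMeasurable_shiftJet ha _ hvm) hvm (memLp_const _)
      (fun n => Eventually.of_forall fun p => ?_) (Eventually.of_forall fun p => ?_)
    · have h1 := abs_sub (shiftJet k (t n) v p) (v p)
      have h2 := hvb p
      have h3 : |shiftJet k (t n) v p| ≤ ‖ψ‖ := hvb _
      linarith
    · have h1 : Tendsto (fun n => (p.1, p.2 + t n • e k)) atTop (𝓝 (p.1, p.2 + (0 : ℝ) • e k)) :=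
        tendsto_const_nhds.prodMk_nhds (tendsto_const_nhds.add (ht.smul_const _))
      rw [zero_smul, add_zero] at h1
      exact (hvc.tendsto p).comp h1
  have ht1 : ∀ᶠ n in atTop, |t n| ≤ 1 := by
    have h1 := ht.abs
    rw [abs_zero] at h1
    exact h1.eventually_le_const one_pos
  filter_upwards [ht1, hlim.eventually_le_const (pos_iff_ne_zero.2 hε2)] with n hn1 hn2
  have hwvm : AEStronglyMeasurable (fun p => w p - v p) (M a) := hw.1.sub hvm
  have h1 : (fun p => shiftJet k (t n) w p - w p) =
      (shiftJet k (t n) (fun p => w p - v p) - fun p => w p - v p) +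
        fun p => shiftJet k (t n) v p - v p := by
    funext p
    simp only [Pi.add_apply, Pi.sub_apply, shiftJet]; ring
  rw [h1]
  have hm1 := aestronglyMeasurable_shiftJet ha (k := k) (t n) hwvm
  refine (eLpNorm_add_le (hm1.sub hwvm)
    ((aestronglyMeasurable_shiftJet ha _ hvm).sub hvm) one_le_two).trans ?_
  rw [← ENNReal.add_halves ε]
  refine add_le_add ((eLpNorm_sub_le hm1 hwvm one_le_two).trans ?_) hn2
  refine (add_le_add_left (eLpNorm_shiftJet_le ha hn1 hvR) _).trans ?_
  calc K * eLpNorm (fun p => w p - v p) 2 (M a) + eLpNorm (fun p => w p - v p) 2 (M a)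
      = (K + 1) * eLpNorm (fun p => w p - v p) 2 (M a) := by rw [add_mul, one_mul]
    _ ≤ (K + 1) * (ε / 2 / (K + 1)) := by gcongr
    _ ≤ ε / 2 := ENNReal.mul_div_le

/-! ### Approximation near a point -/

/-- Suppose that, on `O`, a function of class `W^{1,2}(O')` vanishes off a compact subset of `O'`.
Multiplication by a cut-off function does not change it on `O`, and gives a function that extends by
zero to a function of class `W^{1,2}(ℓ²)`. -/
theorem MemW.approx_of_cutoff {a : ℕ → ℝ} (ha : ∀ i, 0 < a i) (hs : Summable a)
    {O O' A : Set L2} (hO : IsOpen O) (hO' : IsOpen O') (hA : IsCompact A) (hAO' : A ⊆ O')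
    {w : ℕ × L2 → ℝ} (hw : MemW a O' w) (hz : ∀ x ∈ O, x ∉ A → ∀ n, w (n, x) = 0) :
    Approx a O w := by
  obtain ⟨β, hβ, hsupp, N, hN, hAN, hβ1⟩ := exists_cutoff_of_isCompact hA hO' hAO'
  refine ((hw.mulJet_univ ha hs hβ hsupp).approx_univ ha hs).mono (Set.subset_univ O)
    |>.congr hO fun x hx n => ?_
  by_cases hxA : x ∈ A
  · have h1 : gradPart β (n, x) = 0 := by
      cases n with
      | zero => rfl
      | succ i => exact pd_eq_zero_of_const hN hβ1 (hAN hxA) i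
    simp only [GaussSobolev.mulJet, h1, hβ1 x (hAN hxA), one_mul, zero_mul, add_zero]
  · simp only [GaussSobolev.mulJet, hz x hx hxA, mul_zero, add_zero]

theorem exists_apply_e_ne_zero {T : L2 →L[ℝ] ℝ} (hT : T ≠ 0) : ∃ k, T (e k) ≠ 0 := by
  by_contra! h
  refine hT (ContinuousLinearMap.ext fun x => ?_)
  refine tendsto_nhds_unique ((T.continuous.tendsto x).comp (tendsto_truncate x)) ?_
  refine tendsto_const_nhds.congr fun n => ?_
  simp [h]

theorem IsCompact.exists_abs_coord_le {C : Set L2} (hC : IsCompact C) (k : ℕ) :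
    ∃ R, ∀ x ∈ C, |x k| ≤ R :=
  hC.exists_bound_of_continuousOn (continuous_coord k).continuousOn

/-- Near a boundary point, the domain is moved into itself by small translations in a coordinate
direction. -/
theorem IsC1Domain.exists_shift {O : Set L2} {g : L2 → ℝ} (hO : IsC1Domain O g) {x₀ : L2}
    (hx₀ : x₀ ∈ frontier O) : ∃ (k : ℕ) (c r : ℝ), 0 < r ∧
      ∀ x ∈ closure O, ∀ t > 0, x ∈ Metric.ball x₀ r → x + (t * c) • e k ∈ Metric.ball x₀ r →
        x + (t * c) • e k ∈ O := by
  obtain ⟨k, hk⟩ := exists_apply_e_ne_zero (hO.fderiv_ne x₀ hx₀)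
  set c := fderiv ℝ g x₀ (e k) with hc
  have hg : Differentiable ℝ g := hO.contDiff.differentiable (by simp)
  have hcont : Continuous fun x => fderiv ℝ g x (e k) * c :=
    ((hO.contDiff.continuous_fderiv (by simp)).clm_apply continuous_const).mul continuous_const
  have hpos : ∀ᶠ x in 𝓝 x₀, 0 < fderiv ℝ g x (e k) * c :=
    hcont.continuousAt.eventually_const_lt (mul_self_pos.2 hk)
  obtain ⟨r, hr, hball⟩ := Metric.eventually_nhds_iff_ball.1 hpos
  refine ⟨k, c, r, hr, fun x hx t ht hxb hyb => ?_⟩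
  have hgx : 0 ≤ g x := by
    have h1 : closure O ⊆ {y | 0 ≤ g y} := by
      refine closure_minimal ?_ (isClosed_le continuous_const hg.continuous)
      rw [hO.eq_pos]
      exact fun y hy => (show 0 < g y from hy).le
    exact h1 hx
  have hd : ∀ s : ℝ, HasDerivAt (fun s : ℝ => g (x + s • ((t * c) • e k)))
      (fderiv ℝ g (x + s • ((t * c) • e k)) ((t * c) • e k)) s := by
    intro s
    have h1 : HasDerivAt (fun s : ℝ => x + s • ((t * c) • e k)) ((t * c) • e k) s := by
      simpa using ((hasDerivAt_id s).smul_const ((t * c) • e k)).const_add x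
    exact (hg _).hasFDerivAt.comp_hasDerivAt s h1
  have hmono : StrictMonoOn (fun s : ℝ => g (x + s • ((t * c) • e k))) (Set.Icc 0 1) := by
    refine strictMonoOn_of_deriv_pos (convex_Icc 0 1)
      (fun s _ => (hd s).continuousAt.continuousWithinAt) fun s hs => ?_
    rw [interior_Icc] at hs
    have hmem : x + s • ((t * c) • e k) ∈ Metric.ball x₀ r := by
      have h2 := (convex_ball x₀ r).add_smul_mem hxb hyb (t := s) ⟨hs.1.le, hs.2.le⟩
      exact h2
    have h3 := hball _ hmem
    rw [(hd s).deriv, map_smul, smul_eq_mul]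
    calc (0 : ℝ) < t * (fderiv ℝ g (x + s • ((t * c) • e k)) (e k) * c) := mul_pos ht h3
      _ = _ := by ring
  have h4 := hmono (Set.left_mem_Icc.2 zero_le_one) (Set.right_mem_Icc.2 zero_le_one) one_pos
  simp only [zero_smul, add_zero, one_smul] at h4
  rw [hO.eq_pos]
  exact lt_of_le_of_lt hgx h4

/-- Near a boundary point, functions of class `W^{1,2}(O)` with compact support are translated
inwards and then extended by zero. -/
theorem MemW.approx_frontier {a : ℕ → ℝ} (ha : ∀ i, 0 < a i) (hs : Summable a)
    {O : Set L2} {g : L2 → ℝ} (hO : IsC1Domain O g) {x₀ : L2} (hx₀ : x₀ ∈ frontier O) :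
    ∃ r > 0, ∀ C, IsCompact C → C ⊆ Metric.ball x₀ r → ∀ w, MemW a O w →
      (∀ x ∉ C, ∀ n, w (n, x) = 0) → Approx a O w := by
  obtain ⟨k, c, r, hr, hshift⟩ := hO.exists_shift hx₀
  refine ⟨r / 2, by positivity, fun C hC hCr w hw hz => ?_⟩
  obtain ⟨R, hR⟩ := IsCompact.exists_abs_coord_le hC k
  have hwR : ∀ n x, w (n, x) ≠ 0 → |x k| ≤ R := fun n x hx => by
    by_contra hne
    exact hx (hz x (fun h => hne (hR x h)) n)
  -- The sign of `c` makes `g` increase under the translation.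
  let t : ℕ → ℝ := fun n => 1 / ((n : ℝ) + 1) * c
  have ht : Tendsto t atTop (𝓝 0) := by
    have h1 := (tendsto_one_div_add_atTop_nhds_zero_nat (𝕜 := ℝ)).mul_const c
    rwa [zero_mul] at h1
  have ht2 : ∀ᶠ n in atTop, |t n| < r / 2 := by
    have h1 := ht.abs
    rw [abs_zero] at h1
    exact h1.eventually_lt_const (by positivity)
  refine Approx.of_tendsto ha hs (u := fun n => GaussSobolev.shiftJet k (t n) w)
    (fun n => memLp_shiftJet ha _ hw.memLp hwR) hw.memLp ?_ (tendsto_shiftJet ha hs hw.memLp hwR ht)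
  filter_upwards [ht2] with n hn
  let h : L2 ≃ₜ L2 := Homeomorph.addRight (t n • e k)
  -- The part of the closure of `O` where the translate may be nonzero.
  have hA : IsCompact (closure O ∩ h ⁻¹' C) :=
    (h.isCompact_preimage.2 hC).inter_left isClosed_closure
  refine (hw.shiftJet ha (t n) hwR).approx_of_cutoff ha hs hO.isOpen
    (hO.isOpen.preimage h.continuous) hA ?_ ?_
  · rintro x ⟨hxO, hxC⟩
    have hy : x + t n • e k ∈ Metric.ball x₀ (r / 2) := hCr hxC
    refine hshift x hxO (1 / ((n : ℝ) + 1)) (by positivity) ?_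
      (Metric.ball_subset_ball (by linarith) hy)
    rw [Metric.mem_ball] at hy ⊢
    have h1 : dist x (x + t n • e k) < r / 2 := by
      rwa [dist_self_add_right, norm_smul, norm_e, mul_one]
    linarith [dist_triangle x (x + t n • e k) x₀]
  · intro x hxO hxA m
    exact hz _ (fun hxC => hxA ⟨subset_closure hxO, hxC⟩) m

/-- Every point has a ball in which compactly supported functions can be approximated. -/
theorem MemW.approx_near {a : ℕ → ℝ} (ha : ∀ i, 0 < a i) (hs : Summable a)
    {O : Set L2} {g : L2 → ℝ} (hO : IsC1Domain O g) (x₀ : L2) :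
    ∃ r > 0, ∀ C, IsCompact C → C ⊆ Metric.ball x₀ r → ∀ w, MemW a O w →
      (∀ x ∉ C, ∀ n, w (n, x) = 0) → Approx a O w := by
  by_cases h1 : x₀ ∈ O
  · obtain ⟨r, hr, hball⟩ := Metric.isOpen_iff.1 hO.isOpen x₀ h1
    exact ⟨r, hr, fun C hC hCr w hw hz =>
      hw.approx_of_cutoff ha hs hO.isOpen hO.isOpen hC (hCr.trans hball) fun x _ hx => hz x hx⟩
  by_cases h2 : x₀ ∈ closure O
  · refine MemW.approx_frontier ha hs hO ?_
    rw [hO.isOpen.frontier_eq]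
    exact ⟨h2, h1⟩
  · obtain ⟨r, hr, hball⟩ := Metric.isOpen_iff.1 isClosed_closure.isOpen_compl x₀ h2
    refine ⟨r, hr, fun C hC hCr w hw hz => hw.approx_of_cutoff ha hs hO.isOpen hO.isOpen
      isCompact_empty (Set.empty_subset _) fun x hx _ => hz x fun hxC => ?_⟩
    exact hball (hCr hxC) (subset_closure hx)

/-! ### Approximation of compactly supported functions -/

/-- Functions supported in a finite union of balls are split by means of cut-off functions:
multiplication by `cutoff c (r c)` localizes to the ball of radius `3 * r c` around `c`, and the
rest vanishes on the ball of radius `r c`. -/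
theorem MemW.approx_of_subset_iUnion {a : ℕ → ℝ} (ha : ∀ i, 0 < a i) (hs : Summable a)
    {O : Set L2} (hO : IsOpen O) {r : L2 → ℝ} (hr : ∀ c, 0 < r c)
    (hloc : ∀ c, ∀ C, IsCompact C → C ⊆ Metric.ball c (3 * r c) → ∀ w, MemW a O w →
      (∀ x ∉ C, ∀ n, w (n, x) = 0) → Approx a O w) (S : Finset L2) :
    ∀ C, IsCompact C → C ⊆ ⋃ c ∈ S, Metric.ball c (r c) → ∀ w, MemW a O w →
      (∀ x ∉ C, ∀ n, w (n, x) = 0) → Approx a O w := by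
  classical
  induction S using Finset.induction_on with
  | empty =>
    intro C hC hCS w hw hz
    refine hloc 0 ∅ isCompact_empty (Set.empty_subset _) w hw fun x _ => hz x fun hx => ?_
    simpa using hCS hx
  | insert c S _ ih =>
    intro C hC hCS w hw hz
    have hβ := bddSmooth_cutoff c (r c)
    have hz' : ∀ β : L2 → ℝ, ∀ x ∉ C, ∀ n, GaussSobolev.mulJet β w (n, x) = 0 := fun β x hx n => by
      simp only [GaussSobolev.mulJet, hz x hx, mul_zero, add_zero]
    have h1 : Approx a O (GaussSobolev.mulJet (cutoff c (r c)) w) := by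
      refine hloc c (C ∩ Metric.closedBall c (2 * r c)) (hC.inter_right Metric.isClosed_closedBall)
        ?_ _ (hw.mulJet ha hs hβ) fun x hx n => ?_
      · refine Set.inter_subset_right.trans (Metric.closedBall_subset_ball ?_)
        linarith [hr c]
      · by_cases hxC : x ∈ C
        · have hxc : x ∈ (Metric.closedBall c (2 * r c))ᶜ := fun h => hx ⟨hxC, h⟩
          have h0 : ∀ y ∈ (Metric.closedBall c (2 * r c))ᶜ, cutoff c (r c) y = 0 := by
            intro y hy
            by_contra hne
            exact hy (dist_lt_of_cutoff_ne_zero (hr c) hne).le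
          have h2 : gradPart (cutoff c (r c)) (n, x) = 0 := by
            cases n with
            | zero => rfl
            | succ i => exact pd_eq_zero_of_const Metric.isClosed_closedBall.isOpen_compl h0 hxc i
          simp only [GaussSobolev.mulJet, h2, h0 x hxc, zero_mul, add_zero]
        · exact hz' _ x hxC n
    have h2 : Approx a O (GaussSobolev.mulJet (fun x => 1 - cutoff c (r c) x) w) := by
      refine ih (C \ Metric.ball c (r c)) (hC.diff Metric.isOpen_ball) ?_ _
        (hw.mulJet ha hs hβ.one_sub) fun x hx n => ?_
      · rintro x ⟨hxC, hxb⟩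
        have h3 := hCS hxC
        rw [Finset.set_biUnion_insert] at h3
        exact h3.resolve_left hxb
      · by_cases hxC : x ∈ C
        · have hxb : x ∈ Metric.ball c (r c) := by
            by_contra h; exact hx ⟨hxC, h⟩
          have h0 : ∀ y ∈ Metric.ball c (r c), 1 - cutoff c (r c) y = 0 := fun y hy => by
            rw [cutoff_eq_one (hr c) (Metric.mem_ball.1 hy).le, sub_self]
          have h2 : gradPart (fun x => 1 - cutoff c (r c) x) (n, x) = 0 := by
            cases n with
            | zero => rfl
            | succ i => exact pd_eq_zero_of_const Metric.isOpen_ball h0 hxb i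
          simp only [GaussSobolev.mulJet, h2, h0 x hxb, zero_mul, add_zero]
        · exact hz' _ x hxC n
    refine (h1.add ha hs (hw.mulJet ha hs hβ).memLp (hw.mulJet ha hs hβ.one_sub).memLp h2).congr
      hO fun x _ n => ?_
    have h4 : gradPart (fun x => 1 - cutoff c (r c) x) (n, x) =
        -gradPart (cutoff c (r c)) (n, x) := by
      cases n with
      | zero => simp [gradPart]
      | succ i => simp [gradPart, GaussSobolev.pd]
    simp only [GaussSobolev.mulJet, h4]
    ring

/-- Smooth functions with bounded support are dense in `W^{1,2}(O)`. -/
theorem MemW.approx {a : ℕ → ℝ} (ha : ∀ i, 0 < a i) (hs : Summable a)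
    {O : Set L2} {g : L2 → ℝ} (hO : IsC1Domain O g) {w : ℕ × L2 → ℝ} (hw : MemW a O w) :
    Approx a O w := by
  have hν : ∀ n : ℕ, (1 : ℝ) ≤ n + 1 := fun n => by linarith [n.cast_nonneg (α := ℝ)]
  choose r hr hloc using MemW.approx_near ha hs hO
  refine Approx.of_tendsto ha hs (fun n => memLp_trunc ha hs (hν n) hw.memLp) hw.memLp
    (Eventually.of_forall fun n => ?_) (tendsto_trunc ha hs hw.memLp)
  obtain ⟨C, hC, hz⟩ := exists_isCompact_trunc ha hs (hν n) w
  obtain ⟨S, -, hS⟩ := hC.elim_nhds_subcover (fun c => Metric.ball c (r c / 3))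
    fun c _ => Metric.ball_mem_nhds c (by linarith [hr c])
  refine MemW.approx_of_subset_iUnion ha hs hO.isOpen (r := fun c => r c / 3)
    (fun c => by linarith [hr c])
    (fun c C' hC' hC'r => ?_) S C hC hS _ (hw.trunc ha hs (hν n)) hz
  rw [mul_div_cancel₀ (r c) (by norm_num : (3 : ℝ) ≠ 0)] at hC'r
  exact hloc c C' hC' hC'r

/-! ### Uniqueness of weak derivatives and the norm of `W^{1,2}` -/

/-- Multiplied by a cut-off function, `v` has zero Fourier transform, so that `v` vanishes
locally. -/
theorem ae_eq_zero_of_forall_isTest {a : ℕ → ℝ} {O : Set L2} (hO : IsOpen O) {v : L2 → ℝ}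
    (hv : MemLp v 2 (P a)) (hz : ∀ x ∉ O, v x = 0)
    (h : ∀ ψ, IsTest O ψ → ∫ x, v x * ψ x ∂(P a) = 0) : v =ᵐ[P a] 0 := by
  rw [EventuallyEq, ae_iff]
  refine measure_null_of_locally_null _ fun c hc => ?_
  have hcO : c ∈ O := by
    by_contra hcO; exact hc (hz c hcO)
  obtain ⟨r, hr, hball⟩ := Metric.isOpen_iff.1 hO c hcO
  have hr3 : 0 < r / 3 := by positivity
  have hβ := bddSmooth_cutoff c (r / 3)
  have hβs : UnifIncl {x | cutoff c (r / 3) x ≠ 0} O := by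
    refine unifIncl_of_cutoff hr3 ?_
    rwa [mul_div_cancel₀ r (by norm_num : (3 : ℝ) ≠ 0)]
  have h1 : (fun x => v x * cutoff c (r / 3) x) =ᵐ[P a] 0 := by
    refine ae_eq_zero_of_integral_cos_eq_zero a
      (integrable_mul_bdd hv hβ.continuous.measurable hβ.bdd) fun l _ s => ?_
    rw [← h _ (((bddSmooth_cosFun l s).mul hβ).isTest
      (hβs.mono fun _ hx => right_ne_zero_of_mul hx))]
    refine integral_congr_ae (Eventually.of_forall fun x => ?_)
    simp only [cosFun]; ring
  refine ⟨Metric.ball c (r / 3) ∩ {x | v x ≠ 0},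
    Filter.inter_mem (mem_nhdsWithin_of_mem_nhds (Metric.ball_mem_nhds c hr3))
      self_mem_nhdsWithin, ?_⟩
  refine measure_mono_null ?_ (ae_iff.1 h1)
  rintro x ⟨hxb, hxv⟩ hx0
  beta_reduce at hx0
  rw [Pi.zero_apply, cutoff_eq_one hr3 (Metric.mem_ball.1 hxb).le, mul_one] at hx0
  exact hxv hx0

theorem IsCF.pdStar_indicator {O : Set L2} (hO : IsOpen O) {ψ : L2 → ℝ} (h : IsCF O ψ) (a : ℕ → ℝ)
    (i : ℕ) (x : L2) : pdStar a i (O.indicator ψ) x = O.indicator (pdStar a i ψ) x := by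
  obtain ⟨r, hr, hsupp⟩ := h.suppIncl
  rw [pdStar, pd_indicator hr hO hsupp]
  by_cases hx : x ∈ O
  · simp only [Set.indicator_of_mem hx, pdStar]
  · simp only [Set.indicator_of_notMem hx, neg_zero, mul_zero, add_zero]

/-- Weak partial derivatives in terms of functions extended by zero, with test functions defined on
the whole space. -/
theorem isWeakPd_iff {a : ℕ → ℝ} {O : Set L2} (hO : IsOpen O) {i : ℕ} {f v : L2 → ℝ} :
    IsWeakPd a O i f v ↔ MemLp (O.indicator v) 2 (P a) ∧ ∀ ψ, IsTest O ψ →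
      ∫ x, O.indicator v x * ψ x ∂(P a) = ∫ x, O.indicator f x * pdStar a i ψ x ∂(P a) := by
  have key : ∀ u ψ : L2 → ℝ, ∫ x in O, u x * ψ x ∂(P a) = ∫ x, O.indicator u x * ψ x ∂(P a) := by
    intro u ψ
    rw [← integral_indicator hO.measurableSet]
    simp only [Set.indicator_mul_left]
  have key' : ∀ u ψ : L2 → ℝ, ∫ x in O, u x * ψ x ∂(P a) =
      ∫ x, O.indicator u x * O.indicator ψ x ∂(P a) := by
    intro u ψ
    rw [← integral_indicator hO.measurableSet]
    simp only [Set.indicator_mul]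
  rw [IsWeakPd, memLp_indicator_iff_restrict hO.measurableSet]
  refine and_congr_right fun _ => ⟨fun h ψ hψ => ?_, fun h ψ hψ => ?_⟩
  · rw [← key, ← key, h ψ hψ.isCF]
  · rw [key', key', h _ (hψ.isTest hO)]
    simp only [hψ.pdStar_indicator hO]

/-- Weak partial derivatives are unique. -/
theorem IsWeakPd.ae_eq {a : ℕ → ℝ} {O : Set L2} (hO : IsOpen O) {i : ℕ} {f v v' : L2 → ℝ}
    (h : IsWeakPd a O i f v) (h' : IsWeakPd a O i f v') : v =ᵐ[(P a).restrict O] v' := by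
  rw [isWeakPd_iff hO] at h h'
  have h1 := ae_eq_zero_of_forall_isTest hO (h.1.sub h'.1)
    (fun x hx => by simp only [Pi.sub_apply, Set.indicator_of_notMem hx, sub_zero]) fun ψ hψ => by
      have hm := hψ.csb.measurable
      have hb := hψ.csb.exists_bound
      simp only [Pi.sub_apply, sub_mul]
      rw [integral_sub (integrable_mul_bdd h.1 hm hb) (integrable_mul_bdd h'.1 hm hb), h.2 ψ hψ,
        h'.2 ψ hψ, sub_self]
  filter_upwards [ae_restrict_of_ae h1, ae_restrict_mem hO.measurableSet] with x hx hxO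
  simp only [Pi.sub_apply, Set.indicator_of_mem hxO, Pi.zero_apply] at hx
  exact sub_eq_zero.1 hx

theorem BddSmooth.isWeakPd {a : ℕ → ℝ} (ha : ∀ i, 0 < a i) {O : Set L2} (hO : IsOpen O) {φ : L2 → ℝ}
    (hφ : BddSmooth φ) (i : ℕ) : IsWeakPd a O i φ (GaussSobolev.pd i φ) := by
  obtain ⟨C, hC⟩ := (hφ.pd i).bdd
  refine (isWeakPd_iff hO).2 ⟨(MemLp.of_bound (hφ.pd i).continuous.aestronglyMeasurable C
    (Eventually.of_forall hC)).indicator hO.measurableSet, fun ψ hψ => ?_⟩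
  have h1 : ∀ x ∉ O, ψ x = 0 := fun x hx => by
    by_contra hne
    obtain ⟨r, hr, -, -, hsub, -⟩ := hψ.2
    exact hx (hsub (Set.mem_iUnion₂.2 ⟨x, hne, Metric.mem_ball_self hr⟩))
  have h2 : O.indicator ψ = ψ := Set.indicator_eq_self.2 fun x hx => by
    by_contra hxO; exact hx (h1 x hxO)
  have h3 : ∀ x ∉ O, pdStar a i ψ x = 0 := fun x hx => by
    rw [← h2, hψ.isCF.pdStar_indicator hO, Set.indicator_of_notMem hx]
  have h4 : ∀ x, O.indicator (GaussSobolev.pd i φ) x * ψ x =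
      GaussSobolev.pd i φ x * ψ x := fun x => by
    by_cases hx : x ∈ O
    · rw [Set.indicator_of_mem hx]
    · rw [h1 x hx, mul_zero, mul_zero]
  have h5 : ∀ x, O.indicator φ x * pdStar a i ψ x = φ x * pdStar a i ψ x := fun x => by
    by_cases hx : x ∈ O
    · rw [Set.indicator_of_mem hx]
    · rw [h3 x hx, mul_zero, mul_zero]
  simp only [h4, h5]
  exact hφ.weak ha hψ i

theorem IsWeakPd.sub {a : ℕ → ℝ} {O : Set L2} (hO : IsOpen O) {i : ℕ} {f f' v v' : L2 → ℝ}
    (hf : MemLp f 2 ((P a).restrict O)) (hf' : MemLp f' 2 ((P a).restrict O))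
    (h : IsWeakPd a O i f v) (h' : IsWeakPd a O i f' v') :
    IsWeakPd a O i (fun x => f x - f' x) fun x => v x - v' x := by
  rw [isWeakPd_iff hO] at h h' ⊢
  rw [← memLp_indicator_iff_restrict hO.measurableSet] at hf hf'
  have hsub : ∀ u u' : L2 → ℝ, O.indicator (fun x => u x - u' x) =
      fun x => O.indicator u x - O.indicator u' x := fun u u' => Set.indicator_sub' O u u'
  rw [hsub v v', hsub f f']
  refine ⟨h.1.sub h'.1, fun ψ hψ => ?_⟩
  have hm := hψ.csb.measurable
  have hb := hψ.csb.exists_bound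
  have hm' := hψ.measurable_pdStar a i
  have hb' := hψ.pdStar_bdd a i
  simp only [sub_mul]
  rw [integral_sub (integrable_mul_bdd h.1 hm hb) (integrable_mul_bdd h'.1 hm hb),
    integral_sub (integrable_mul_bdd hf hm' hb') (integrable_mul_bdd hf' hm' hb'), h.2 ψ hψ,
    h'.2 ψ hψ]

theorem isWeakPd_weakPd {a : ℕ → ℝ} {O : Set L2} {i : ℕ} {f : L2 → ℝ}
    (h : ∃ g, IsWeakPd a O i f g) : IsWeakPd a O i f (weakPd a O i f) := by
  rw [weakPd, dif_pos h]
  exact h.choose_spec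

/-- The norm of `W^{1,2}(O)` is the `L²`-norm with respect to `M`. -/
theorem summable_and_normW12_eq {a : ℕ → ℝ} {O : Set L2} (hO : IsOpen O) {f : L2 → ℝ}
    {u : ℕ × L2 → ℝ} (hu : MemLp u 2 ((M a).restrict (Prod.snd ⁻¹' O)))
    (h0 : ∀ x ∈ O, u (0, x) = f x)
    (h : ∀ i, (fun x => u (i + 1, x)) =ᵐ[(P a).restrict O] weakPd a O i f) :
    (Summable fun i => a i ^ 2 * ∫ x in O, |weakPd a O i f x| ^ 2 ∂(P a)) ∧
      normW12 a O f = (eLpNorm u 2 ((M a).restrict (Prod.snd ⁻¹' O))).toReal := by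
  have hOm : MeasurableSet (Prod.snd ⁻¹' O : Set (ℕ × L2)) := measurable_snd hO.measurableSet
  have hint : IntegrableOn (fun p => u p ^ 2) (Prod.snd ⁻¹' O) (M a) := hu.integrable_sq
  have hsum := hasSum_integral_M ((integrable_indicator_iff hOm).2 hint)
  have hslice : ∀ n, ∫ x, (Prod.snd ⁻¹' O).indicator (fun p => u p ^ 2) (n, x) ∂(P a) =
      ∫ x in O, u (n, x) ^ 2 ∂(P a) := fun n => by
    rw [← integral_indicator hO.measurableSet]; rfl
  simp only [hslice] at hsum
  rw [integral_indicator hOm] at hsum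
  have hz : ∫ x in O, u (0, x) ^ 2 ∂(P a) = ∫ x in O, |f x| ^ 2 ∂(P a) :=
    setIntegral_congr_fun hO.measurableSet fun x hx => by simp only [h0 x hx, sq_abs]
  have hi : ∀ i, ∫ x in O, u (i + 1, x) ^ 2 ∂(P a) = ∫ x in O, |weakPd a O i f x| ^ 2 ∂(P a) := by
    intro i
    refine integral_congr_ae ?_
    filter_upwards [h i] with x hx
    rw [hx, sq_abs]
  have hsum1 := (summable_nat_add_iff 1).2 hsum.summable
  have htot := hsum.tsum_eq
  rw [hsum.summable.tsum_eq_zero_add] at htot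
  simp only [wt_succ_toReal, hi] at hsum1 htot
  refine ⟨hsum1, ?_⟩
  rw [hz, wt, ENNReal.toReal_one, one_mul] at htot
  rw [normW12, htot]
  have h1 : ∫ p in Prod.snd ⁻¹' O, u p ^ 2 ∂(M a) =
      (eLpNorm u 2 ((M a).restrict (Prod.snd ⁻¹' O))).toReal ^ 2 := by
    rw [← ENNReal.toReal_pow, eLpNorm_two_sq, integral_eq_lintegral_of_nonneg_ae
      (Eventually.of_forall fun p => sq_nonneg _) hint.aestronglyMeasurable]
    congr 1
    refine lintegral_congr fun p => ?_
    rw [Real.enorm_eq_ofReal_abs, ← ENNReal.ofReal_pow (abs_nonneg _), sq_abs]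
  rw [h1, Real.sqrt_sq ENNReal.toReal_nonneg]

/-- The function on `ℕ × ℓ²` formed by `f` and its weak partial derivatives, extended by zero. -/
def weakJet (a : ℕ → ℝ) (O : Set L2) (f : L2 → ℝ) (p : ℕ × L2) : ℝ :=
  match p.1 with
  | 0 => O.indicator f p.2
  | i + 1 => O.indicator (weakPd a O i f) p.2

theorem MemW12.memW {a : ℕ → ℝ} {O : Set L2} (hO : IsOpen O) {f : L2 → ℝ}
    (hf : MemW12 a O f) : MemW a O (weakJet a O f) := by
  have hw := fun i => (isWeakPd_iff hO).1 (isWeakPd_weakPd (hf.exists_weakPd i))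
  have hslice : ∀ n, MemLp (fun x => weakJet a O f (n, x)) 2 (P a) := fun n => by
    cases n with
    | zero => exact (memLp_indicator_iff_restrict hO.measurableSet).2 hf.memLp
    | succ i => exact (hw i).1
  refine ⟨⟨aestronglyMeasurable_M fun n => (hslice n).1, ?_⟩, fun x hx n => ?_,
    fun ψ hψ i => (hw i).2 ψ hψ⟩
  · have h1 : ∀ n, wt a n * ∫⁻ x, ‖weakJet a O f (n, x)‖ₑ ^ 2 ∂(P a) =
        ENNReal.ofReal ((wt a n).toReal * ∫ x, weakJet a O f (n, x) ^ 2 ∂(P a)) := fun n => by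
      rw [ENNReal.ofReal_mul ENNReal.toReal_nonneg, ENNReal.ofReal_toReal (wt_ne_top a n),
        ofReal_integral_eq_lintegral_ofReal (hslice n).integrable_sq
          (Eventually.of_forall fun x => sq_nonneg _)]
      congr 1
      refine lintegral_congr fun x => ?_
      rw [Real.enorm_eq_ofReal_abs, ← ENNReal.ofReal_pow (abs_nonneg _), sq_abs]
    have h2 : Summable fun n => (wt a n).toReal * ∫ x, weakJet a O f (n, x) ^ 2 ∂(P a) := by
      rw [← summable_nat_add_iff 1]
      refine hf.summable.congr fun i => ?_
      rw [wt_succ_toReal, ← integral_indicator hO.measurableSet]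
      congr 1
      refine integral_congr_ae (Eventually.of_forall fun x => ?_)
      by_cases hx : x ∈ O <;> simp [weakJet, hx]
    have h3 : eLpNorm (weakJet a O f) 2 (M a) ^ 2 ≠ ⊤ := by
      rw [eLpNorm_two_sq, lintegral_M]
      simp only [h1]
      exact h2.tsum_ofReal_ne_top
    by_contra h4
    rw [not_lt, top_le_iff] at h4
    exact h3 (by rw [h4]; simp)
  · cases n <;> exact Set.indicator_of_notMem hx _

theorem BddSmooth.memW12 {a : ℕ → ℝ} (ha : ∀ i, 0 < a i) (hs : Summable a) {O : Set L2}
    (hO : IsOpen O) {φ : L2 → ℝ} (hφ : BddSmooth φ) : MemW12 a O φ := by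
  have hw := fun i => hφ.isWeakPd ha hO i
  have hj := hφ.memLp_jet ha hs
  refine ⟨(memLp_slice ha hj 0).restrict O, fun i => ⟨_, hw i⟩, ?_⟩
  exact (summable_and_normW12_eq hO (hj.restrict _) (fun x _ => rfl) fun i =>
    (hw i).ae_eq hO (isWeakPd_weakPd ⟨_, hw i⟩)).1

theorem normW12_sub_eq {a : ℕ → ℝ} (ha : ∀ i, 0 < a i) (hs : Summable a) {O : Set L2}
    (hO : IsOpen O) {φ f : L2 → ℝ} (hφ : BddSmooth φ) (hf : MemW12 a O f) :
    normW12 a O (fun x => φ x - f x) =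
      (eLpNorm (fun p => jet φ p - weakJet a O f p) 2
        ((M a).restrict (Prod.snd ⁻¹' O))).toReal := by
  have hφ' := hφ.memW12 ha hs hO
  refine (summable_and_normW12_eq hO
    (((hφ.memLp_jet ha hs).sub (hf.memW hO).memLp).restrict _) (fun x hx => ?_) fun i => ?_).2
  · simp only [Pi.sub_apply, jet, weakJet, Set.indicator_of_mem hx]
  · have h1 := (hφ.isWeakPd ha hO i).sub hO hφ'.memLp hf.memLp
      (isWeakPd_weakPd (hf.exists_weakPd i))
    filter_upwards [h1.ae_eq hO (isWeakPd_weakPd ⟨_, h1⟩), ae_restrict_mem hO.measurableSet]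
      with x hx hxO
    rw [← hx]
    simp only [Pi.sub_apply, jet, weakJet, Set.indicator_of_mem hxO]

end GaussSobolev

end

theorem mainTheorem9 (a : ℕ → ℝ) (ha_pos : ∀ i, 0 < a i) (ha_sum : Summable a)
    (O : Set GaussSobolev.L2) (g : GaussSobolev.L2 → ℝ) (hO : GaussSobolev.IsC1Domain O g)
    (hstr : ∀ x₀ ∈ frontier O, ∃ k : ℕ, ∃ r : ℝ, 0 < r ∧
      GaussSobolev.Straightens a O g (Metric.ball x₀ r) k)
    (f : GaussSobolev.L2 → ℝ) (hf : GaussSobolev.MemW12 a O f) :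
    ∃ φ : ℕ → GaussSobolev.L2 → ℝ,
      (∀ n, GaussSobolev.IsCSb Set.univ (φ n) ∧ GaussSobolev.IsCF Set.univ (φ n)) ∧
      (∀ n, GaussSobolev.MemW12 a O (φ n)) ∧
      Filter.Tendsto (fun n => GaussSobolev.normW12 a O (fun x => φ n x - f x))
        Filter.atTop (nhds 0) := by
  have happ := (hf.memW hO.isOpen).approx ha_pos ha_sum hO
  choose φ hφ hle using fun n : ℕ => happ (ENNReal.ofReal (1 / ((n : ℝ) + 1))) (by
    rw [ne_eq, ENNReal.ofReal_eq_zero, not_le]; positivity)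
  refine ⟨φ, fun n => ⟨(hφ n).1.isCSb Set.univ, (hφ n).isCF⟩,
    fun n => (hφ n).1.memW12 ha_pos ha_sum hO.isOpen, ?_⟩
  refine squeeze_zero (fun n => Real.sqrt_nonneg _) (fun n => ?_)
    tendsto_one_div_add_atTop_nhds_zero_nat
  rw [GaussSobolev.normW12_sub_eq ha_pos ha_sum hO.isOpen (hφ n).1 hf]
  exact ENNReal.toReal_le_of_le_ofReal (by positivity) (hle n)
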